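/- Let $N\ge 2$, let $\mathbb T^N=(\mathbb R/\mathbb Z)^N$ (total measure $1$), let $\alpha\ge 2$ and let $p$ satisfy $1<p<1+\frac{\alpha}{N+2}$ and $p<1+\frac2N$. Let $v\in L^\infty(\mathbb R_+;L^{\frac{\alpha}{p-1}}(\mathbb T^N;\mathbb R^N))$ be incompressible, i.e. $\operatorname{div} v(t)=0$ in the sense of distributions for a.e. $t>0$, and let $u_0\in L^2(\mathbb T^N)$ be real-valued (no mean-zero condition is imposed). Consider $$u_t+v\cdot\nabla u-\Delta u=|u|^p-\int_{\mathbb T^N}|u|^p\,dx \quad\text{on } \mathbb T^N,\qquad u(0)=u_0. \tag{1}$$ Let $e^{t\Delta}$ be the heat semigroup on $\mathbb T^N$ (Fourier multiplier $e^{-4\pi^2|k|^2t}$, $k\in\mathbb Z^N$). Let $T>0$ and let $u$ be a mild solution of (1) on $[0,T]$ in the class $X_T$; that is, $u\in C([0,T];L^2(\mathbb T^N))$ is real-valued, $\nabla u(t)\in L^2$ for $0<t\le T$ with $\sup_{0<t\le T}t^{1/2}\|\nabla u(t)\|_{L^2}<\infty$, and for all $t\in[0,T]$ $$u(t)=e^{t\Delta}u_0+\int_0^te^{(t-\tau)\Delta}(|u|^p)\,d\tau-\int_0^te^{(t-\tau)\Delta}(v\cdot\nabla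 u)\,d\tau-\int_0^t\int_{\mathbb T^N}|u|^p\,dx\,d\tau,$$ the integrals being Bochner integrals in $L^2(\mathbb T^N)$. Then $u$ is a weak solution of (1) on $[0,T)$: $u\in L^\infty([0,T];L^2)\cap L^2([0,T];H^1)$, $u(0)=u_0$, $\partial_tu\in L^2([0,T];H^{-1})$, and for every $\varphi\in C_c^\infty([0,T)\times\mathbb T^N)$ all the integrals below exist and $$\int_{\mathbb T^N}u_0\varphi(0)\,dx+\int_0^T\!\!\int_{\mathbb T^N}u\,\partial_t\varphi\,dx\,dt=\int_0^T\!\!\int_{\mathbb T^N}\varphi\,(v\cdot\nabla u)\,dx\,dt-\int_0^T\!\!\int_{\mathbb T^N}|u|^p\varphi\,dx\,dt+\int_0^T\!\!\int_{\mathbb T^N}\nabla u\cdot\nabla\varphi\,dx\,dt+\int_0^T\Big(\int_{\mathbb T^N}|u|^p\,dx\Big)\Big(\int_{\mathbb T^N}\varphi\,dx\Big)dt.$$ Moreover $u$ satisfies, for every $0\le t<T$, the energy identity (all integrals existing) $$\|u_0\|_{L^2}^2+2\int_0^t\!\!\int_{\mathbb T^N}|u|^pu\,dx\,d\tau-2\int_0^t\Big(\int_{\mathbb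 T^N}|u|^p\,dx\Big)\Big(\int_{\mathbb T^N}u\,dx\Big)d\tau=\|u(t)\|_{L^2}^2+2\int_0^t\!\!\int_{\mathbb T^N}|\nabla u|^2\,dx\,d\tau.$$ -/

import Mathlib

open MeasureTheory Set
open scoped ENNReal ContDiff

-- Mathlib's normalisation of the measure on the circle `ℝ / ℤ` (total mass one), under which
-- its Fourier series on the torus `UnitAddTorus d` are stated.
attribute [local instance] instMeasureSpaceUnitAddCircle
attribute [local instance] instIsAddHaarMeasureUnitAddCircleVolume
attribute [local instance] instIsProbabilityMeasureUnitAddCircleVolume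

noncomputable section

namespace AdvectionTorus

/-- The torus `𝕋^N = (ℝ / ℤ)^N`, with its normalised Lebesgue measure. -/
abbrev Torus (N : ℕ) : Type := UnitAddTorus (Fin N)

/-- Real-valued `L²(𝕋^N)`. -/
abbrev L2 (N : ℕ) : Type := Lp ℝ 2 (volume : Measure (Torus N))

/-- Values of vector fields. -/
abbrev Vec (N : ℕ) : Type := EuclideanSpace ℝ (Fin N)

/-! ### Fourier series, Sobolev norms, heat semigroup, gradient -/

/-- The Fourier coefficient `f̂(k) = ∫ f(x) e^{-2π i k·x} dx` of a real-valued function. -/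
def fourierCoef {N : ℕ} (f : Torus N → ℝ) (k : Fin N → ℤ) : ℂ :=
  UnitAddTorus.mFourierCoeff (fun x => (f x : ℂ)) k

/-- `|k|²`. -/
def freqSq {N : ℕ} (k : Fin N → ℤ) : ℝ := ∑ i, (k i : ℝ) ^ 2

/-- The squared `H^s(𝕋^N)`-norm `∑_k (1 + |k|²)^s |a_k|²` of the (possibly distributional) object
with Fourier coefficients `a`; it lies in `H^s` iff this is finite. -/
def sobolevNormSq {N : ℕ} (s : ℝ) (a : (Fin N → ℤ) → ℂ) : ℝ≥0∞ :=
  ∑' k, ENNReal.ofReal ((1 + freqSq k) ^ s * ‖a k‖ ^ 2)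

/-- `f ∈ H¹(𝕋^N)`. -/
def MemH1 {N : ℕ} (f : Torus N → ℝ) : Prop := sobolevNormSq 1 (fourierCoef f) < ⊤

/-- The Fourier multiplier `f ↦ 𝓕⁻¹ (m f̂)`, as an element of `L²(𝕋^N)`: the sum in `L²` of
`∑_k m(k) f̂(k) e^{2π i k·x}`. It is used only where `m f̂` is square summable and the sum is
real. -/
def multiplier {N : ℕ} (m : (Fin N → ℤ) → ℂ) (f : Torus N → ℝ) : L2 N :=
  Complex.reCLM.compLp
    (∑' k, (m k * fourierCoef f k) • UnitAddTorus.mFourierLp (d := Fin N) 2 k)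

/-- The heat semigroup `e^{tΔ} f`. On `ℝ^N / ℤ^N` the eigenvalue of `Δ` on `e^{2π i k·x}` is
`-4π²|k|²`. Meaningful for `f ∈ L²`, `t ≥ 0`, and for `f ∈ L¹`, `t > 0`. -/
def heat {N : ℕ} (t : ℝ) (f : Torus N → ℝ) : L2 N :=
  multiplier (fun k => (Real.exp (-(4 * Real.pi ^ 2 * freqSq k) * t) : ℂ)) f

/-- The weak gradient of `f ∈ H¹(𝕋^N)`: the `i`-th component has Fourier coefficients
`2π i k_i f̂(k)`. -/
def grad {N : ℕ} (f : Torus N → ℝ) (x : Torus N) : Vec N :=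
  WithLp.toLp 2 fun i =>
    multiplier (fun k => 2 * (Real.pi : ℂ) * Complex.I * (k i : ℂ)) f x

/-! ### Smooth functions on the torus -/

/-- The classical gradient of a smooth function on the torus. -/
def classicalGrad {N : ℕ} (ψ : Torus N → ℝ) (x : Torus N) : Vec N :=
  WithLp.toLp 2 fun i => deriv (fun s : ℝ => ψ (x + Pi.single i (s : UnitAddCircle))) 0

/-- `ψ ∈ C^∞(𝕋^N)`: the periodic function on `ℝ^N` that it induces is smooth. -/
def SmoothOnTorus {N : ℕ} (ψ : Torus N → ℝ) : Prop :=
  ContDiff ℝ ∞ fun y : Fin N → ℝ => ψ fun i => (y i : UnitAddCircle)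

/-- `φ ∈ C_c^∞([0, T) × 𝕋^N)`, as the restriction of a smooth function on `ℝ × 𝕋^N`. -/
def IsTestFunction {N : ℕ} (T : ℝ) (φ : ℝ → Torus N → ℝ) : Prop :=
  (ContDiff ℝ ∞ fun z : ℝ × (Fin N → ℝ) => φ z.1 fun i => (z.2 i : UnitAddCircle)) ∧
    ∃ T' < T, ∀ t, T' ≤ t → ∀ x, φ t x = 0

/-! ### The advecting flow -/

/-- `v ∈ L^∞(ℝ_+; L^q(𝕋^N))`. -/
def MemLinftyLq {N : ℕ} (q : ℝ≥0∞) (v : ℝ → Torus N → Vec N) : Prop :=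
  AEStronglyMeasurable (fun z : ℝ × Torus N => v z.1 z.2)
      ((volume.restrict (Ioi (0 : ℝ))).prod volume) ∧
    ∃ C : ℝ, ∀ᵐ t ∂(volume.restrict (Ioi (0 : ℝ))), eLpNorm (v t) q volume ≤ ENNReal.ofReal C

/-- `v(t)` is divergence free, in the sense of distributions, for almost every `t > 0`. -/
def Incompressible {N : ℕ} (v : ℝ → Torus N → Vec N) : Prop :=
  ∀ᵐ t ∂(volume.restrict (Ioi (0 : ℝ))), ∀ ψ : Torus N → ℝ, SmoothOnTorus ψ →
    ∫ x, inner ℝ (v t x) (classicalGrad ψ x) = 0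

/-! ### Mild solutions -/

/-- The space `X_T`: `u ∈ C([0, T]; L²)` with `∇u(t) ∈ L²` for `0 < t ≤ T` and
`sup_{0 < t ≤ T} t^{1/2} ‖∇u(t)‖_{L²} < ∞`. -/
def MemXT {N : ℕ} (T : ℝ) (u : ℝ → L2 N) : Prop :=
  ContinuousOn u (Icc 0 T) ∧
    (∀ t ∈ Ioc 0 T, MemH1 (u t)) ∧
    ∃ C : ℝ, ∀ t ∈ Ioc 0 T, Real.sqrt t * Real.sqrt (∫ x, ‖grad (u t) x‖ ^ 2) ≤ C

/-- `u` is a mild solution on `[0, T]` of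
`∂_t u + v·∇u - Δu = |u|^p - ∫ |u|^p`, `u(0) = u₀`:
`u(t) = e^{tΔ}u₀ + ∫_0^t e^{(t-τ)Δ}(|u|^p) dτ - ∫_0^t e^{(t-τ)Δ}(v·∇u) dτ - ∫_0^t ∫ |u|^p dx dτ`,
with Bochner integrals in `L²(𝕋^N)`. -/
structure IsMildSolution {N : ℕ} (p : ℝ) (v : ℝ → Torus N → Vec N) (u₀ : L2 N) (T : ℝ)
    (u : ℝ → L2 N) : Prop where
  continuousOn : ContinuousOn u (Icc 0 T)
  memH1 : ∀ t ∈ Ioc 0 T, MemH1 (u t)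
  integrable_source : ∀ t ∈ Icc 0 T,
    IntervalIntegrable (fun τ => heat (t - τ) fun x => |u τ x| ^ p) volume 0 t
  integrable_advection : ∀ t ∈ Icc 0 T,
    IntervalIntegrable (fun τ => heat (t - τ) fun x => inner ℝ (v τ x) (grad (u τ) x)) volume 0 t
  integrable_mean : IntervalIntegrable (fun τ => ∫ x, |u τ x| ^ p) volume 0 T
  eq_duhamel : ∀ t ∈ Icc 0 T,
    u t = heat t u₀ + (∫ τ in (0 : ℝ)..t, heat (t - τ) fun x => |u τ x| ^ p)
      - (∫ τ in (0 : ℝ)..t, heat (t - τ) fun x => inner ℝ (v τ x) (grad (u τ) x))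
      - Lp.const 2 volume (∫ τ in (0 : ℝ)..t, ∫ x, |u τ x| ^ p)

/-! ### Weak solutions -/

/-- The iterated integral `∫_0^T ∫ F(t, x) dx dt` exists. -/
def IteratedIntegrable {N : ℕ} (T : ℝ) (F : ℝ → Torus N → ℝ) : Prop :=
  (∀ᵐ t ∂(volume.restrict (Ioo 0 T)), Integrable (F t) volume) ∧
    IntegrableOn (fun t => ∫ x, F t x) (Ioo 0 T) volume

/-- `a ∈ L²([0, T]; H^s(𝕋^N))`, where an element of `H^s` is given by its Fourier coefficients. -/
def MemL2Hs {N : ℕ} (T s : ℝ) (a : ℝ → (Fin N → ℤ) → ℂ) : Prop :=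
  (∀ k, AEStronglyMeasurable (fun t => a t k) (volume.restrict (Ioo 0 T))) ∧
    ∫⁻ t in Ioo 0 T, sobolevNormSq s (a t) < ⊤

/-- `∂_t u ∈ L²([0, T]; H^{-1}(𝕋^N))`: there is `w ∈ L²([0, T]; H^{-1})` with
`∫_0^T η'(t) u(t) dt = -∫_0^T η(t) w(t) dt` for all `η ∈ C_c^∞((0, T))`, the identity being
expressed in Fourier coefficients. -/
def TimeDerivMemL2Hneg1 {N : ℕ} (T : ℝ) (u : ℝ → L2 N) : Prop :=
  ∃ w : ℝ → (Fin N → ℤ) → ℂ, MemL2Hs T (-1) w ∧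
    ∀ η : ℝ → ℝ, ContDiff ℝ ∞ η → HasCompactSupport η → tsupport η ⊆ Ioo 0 T →
      ∀ k, ∫ t in Ioo 0 T, ((deriv η t : ℝ) : ℂ) * fourierCoef (u t) k
        = -∫ t in Ioo 0 T, (η t : ℂ) * w t k

/-- `u` is a weak solution on `[0, T)` of `∂_t u + v·∇u - Δu = |u|^p - ∫ |u|^p`, `u(0) = u₀`. -/
structure IsWeakSolution {N : ℕ} (p : ℝ) (v : ℝ → Torus N → Vec N) (u₀ : L2 N) (T : ℝ)
    (u : ℝ → L2 N) : Prop where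
  memLinftyL2 : MemLp u ⊤ (volume.restrict (Ioo 0 T))
  memL2H1 : MemL2Hs T 1 (fun t => fourierCoef (u t))
  initial : u 0 = u₀
  timeDeriv : TimeDerivMemL2Hneg1 T u
  integrable_mean : IntegrableOn (fun t => ∫ x, |u t x| ^ p) (Ioo 0 T) volume
  integrable : ∀ φ : ℝ → Torus N → ℝ, IsTestFunction T φ →
    IteratedIntegrable T (fun t x => u t x * deriv (fun s => φ s x) t) ∧
    IteratedIntegrable T (fun t x => φ t x * inner ℝ (v t x) (grad (u t) x)) ∧
    IteratedIntegrable T (fun t x => |u t x| ^ p * φ t x) ∧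
    IteratedIntegrable T (fun t x => inner ℝ (grad (u t) x) (classicalGrad (φ t) x)) ∧
    IntegrableOn (fun t => (∫ x, |u t x| ^ p) * ∫ x, φ t x) (Ioo 0 T) volume
  weak_form : ∀ φ : ℝ → Torus N → ℝ, IsTestFunction T φ →
    (∫ x, u₀ x * φ 0 x) + (∫ t in (0 : ℝ)..T, ∫ x, u t x * deriv (fun s => φ s x) t)
      = (∫ t in (0 : ℝ)..T, ∫ x, φ t x * inner ℝ (v t x) (grad (u t) x))
        - (∫ t in (0 : ℝ)..T, ∫ x, |u t x| ^ p * φ t x)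
        + (∫ t in (0 : ℝ)..T, ∫ x, inner ℝ (grad (u t) x) (classicalGrad (φ t) x))
        + ∫ t in (0 : ℝ)..T, (∫ x, |u t x| ^ p) * ∫ x, φ t x

end AdvectionTorus

end

noncomputable section

namespace AdvectionTorus

open Filter Topology ComplexConjugate

variable {N : ℕ}

/-! ### Fourier coefficients of square integrable functions -/

/-! The linear part of the equation is diagonal in Fourier space. The `k`-th coefficient of
Duhamel's formula reads y(t) = e^{-λt} y(0) + ∫₀ᵗ e^{-λ(t-τ)} g(τ) dτ with λ = 4π²|k|² and g
integrable in time, so y is absolutely continuous and y' = -λy + g in integrated form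
(`IsPrimitiveOn.of_duhamel`, `IsMildSolution.isPrimitiveOn`). Integrating by parts in time against
the coefficients of a test function, or of u itself, and summing over `k` by Parseval gives the weak
formulation and the energy identity. What has to be justified is the exchange of sum and time
integral: the partial sums must be dominated, uniformly over finite sets of frequencies, by an
integrable function of time (`hasSum_intervalIntegral`).

The bounds come from a subcritical Gagliardo–Nirenberg inequality (`exists_eLpNorm_le`), proved by
cutting into dyadic blocks. Since p < 1 + 2/N, it puts |u|^p in L² with squared norm O(t^{-β}) for
some β < 1, given that ‖u‖ is bounded and ‖∇u‖ = O(t^{-1/2}). Since q = α/(p-1) exceeds N + 2, H¹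
embeds in L^s with 1/s = 1/2 - 1/q, so by Hölder v·∇u pairs with H¹ functions and its H⁻¹ norm is at
most a constant times ‖∇u‖. Parseval still holds for this pairing (`AdvectionData.hasSum_mul_conj`),
and incompressibility makes v·∇u orthogonal to u (`AdvectionData.integral_mul_self`).

The class X_T only gives ‖∇u(t)‖² = O(1/t), which is not integrable at 0. The energy identity is
therefore first proved on [r, t] with r > 0, where every bound is harmless. It controls the
dissipation on [r, T] uniformly in r, so the dissipation is integrable up to time 0. This gives u ∈
L²H¹ and ∂ₜu ∈ L²H⁻¹, lets r tend to 0 in the energy identity, and supplies the domination needed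
for the weak formulation (`FlowEstimates`). -/

lemma fourierCoef_congr_ae {f g : Torus N → ℝ} (h : f =ᵐ[volume] g) :
    fourierCoef f = fourierCoef g := by
  ext k
  refine integral_congr_ae ?_
  filter_upwards [h] with x hx
  simp [hx]

lemma mFourierCoeff_congr_ae {f g : Torus N → ℂ} (h : f =ᵐ[volume] g) :
    UnitAddTorus.mFourierCoeff f = UnitAddTorus.mFourierCoeff g := by
  ext k
  refine integral_congr_ae ?_
  filter_upwards [h] with x hx
  simp [hx]

lemma fourierCoef_eq_integral_conj (f : Torus N → ℝ) (k : Fin N → ℤ) :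
    fourierCoef f k = ∫ x, conj (UnitAddTorus.mFourier k x) * (f x : ℂ) := by
  simp only [fourierCoef, UnitAddTorus.mFourierCoeff, UnitAddTorus.mFourier_neg, smul_eq_mul]

lemma conj_fourierCoef (f : Torus N → ℝ) (k : Fin N → ℤ) :
    conj (fourierCoef f k) = ∫ x, UnitAddTorus.mFourier k x * (f x : ℂ) := by
  rw [fourierCoef_eq_integral_conj, ← integral_conj]
  simp

lemma fourierCoef_neg (f : Torus N → ℝ) (k : Fin N → ℤ) :
    fourierCoef f (-k) = conj (fourierCoef f k) := by
  rw [conj_fourierCoef]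
  simp [fourierCoef, UnitAddTorus.mFourierCoeff]

lemma norm_mFourier_apply (k : Fin N → ℤ) (x : Torus N) :
    ‖UnitAddTorus.mFourier k x‖ = 1 := by
  simp only [UnitAddTorus.mFourier, fourier_apply, ContinuousMap.coe_mk, norm_prod,
    Circle.norm_coe, Finset.prod_const_one]

/-- The inclusion of real-valued into complex-valued `L²`. -/
def toC : L2 N →L[ℝ] Lp ℂ 2 (volume : Measure (Torus N)) :=
  Complex.ofRealCLM.compLpL 2 volume

lemma coeFn_toC (f : L2 N) : toC f =ᵐ[volume] fun x => (f x : ℂ) :=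
  Complex.ofRealCLM.coeFn_compLpL f

lemma mFourierCoeff_toC (f : L2 N) (k : Fin N → ℤ) :
    UnitAddTorus.mFourierCoeff (toC f) k = fourierCoef f k := by
  rw [mFourierCoeff_congr_ae (coeFn_toC f)]; rfl

lemma fourierCoef_toLp {f : Torus N → ℝ} (hf : MemLp f 2 volume) :
    fourierCoef (hf.toLp f) = fourierCoef f :=
  fourierCoef_congr_ae hf.coeFn_toLp

/-- The Fourier coefficient as a continuous linear functional on complex `L²`. -/
def coefC (k : Fin N → ℤ) : Lp ℂ 2 (volume : Measure (Torus N)) →L[ℂ] ℂ :=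
  innerSL ℂ (UnitAddTorus.mFourierLp (d := Fin N) 2 k)

lemma coefC_apply (k : Fin N → ℤ) (f : Lp ℂ 2 (volume : Measure (Torus N))) :
    coefC k f = UnitAddTorus.mFourierCoeff f k := by
  rw [← UnitAddTorus.mFourierBasis_repr, HilbertBasis.repr_apply_apply,
    UnitAddTorus.coe_mFourierBasis]
  rfl

/-- The Fourier coefficient as a continuous linear functional on real `L²`. -/
def coefR (k : Fin N → ℤ) : L2 N →L[ℝ] ℂ := ((coefC k).restrictScalars ℝ).comp toC

lemma coefR_apply (k : Fin N → ℤ) (f : L2 N) : coefR k f = fourierCoef f k := by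
  rw [← mFourierCoeff_toC, ← coefC_apply]; rfl

lemma coefC_mFourierLp (k l : Fin N → ℤ) :
    coefC k (UnitAddTorus.mFourierLp (d := Fin N) 2 l) = if k = l then 1 else 0 :=
  orthonormal_iff_ite.mp UnitAddTorus.orthonormal_mFourier k l

lemma hasSum_fourierCoef_mul_conj {f g : Torus N → ℝ} (hf : MemLp f 2 volume)
    (hg : MemLp g 2 volume) :
    HasSum (fun k => fourierCoef f k * conj (fourierCoef g k)) ((∫ x, f x * g x : ℝ) : ℂ) := by
  have h := UnitAddTorus.hasSum_prod_mFourierCoeff (toC (hg.toLp g)) (toC (hf.toLp f))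
  simp only [mFourierCoeff_toC, fourierCoef_toLp] at h
  convert! h using 1
  · ext k; ring
  · rw [← integral_complex_ofReal]
    refine integral_congr_ae ?_
    filter_upwards [coeFn_toC (hg.toLp g), coeFn_toC (hf.toLp f), hg.coeFn_toLp, hf.coeFn_toLp]
      with x h1 h2 h3 h4
    simp [h1, h2, h3, h4, mul_comm]

lemma hasSum_norm_sq_fourierCoef {f : Torus N → ℝ} (hf : MemLp f 2 volume) :
    HasSum (fun k => ‖fourierCoef f k‖ ^ 2) (∫ x, f x ^ 2) := by
  have h := Complex.hasSum_re (hasSum_fourierCoef_mul_conj hf hf)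
  convert! h using 1
  · ext k
    rw [Complex.mul_conj, Complex.ofReal_re, Complex.normSq_eq_norm_sq]
  · simp [sq]

lemma L2_norm_sq (f : L2 N) : ‖f‖ ^ 2 = ∫ x, f x ^ 2 := by
  rw [← real_inner_self_eq_norm_sq, L2.inner_def]
  simp [sq]

lemma hasSum_norm_sq_fourierCoef_L2 (f : L2 N) :
    HasSum (fun k => ‖fourierCoef f k‖ ^ 2) (‖f‖ ^ 2) := by
  rw [L2_norm_sq]
  exact hasSum_norm_sq_fourierCoef (Lp.memLp f)

lemma eq_of_fourierCoef_eq {f g : L2 N} (h : ∀ k, fourierCoef f k = fourierCoef g k) : f = g := by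
  have h0 : ‖f - g‖ ^ 2 = 0 := by
    refine (hasSum_norm_sq_fourierCoef_L2 (f - g)).unique ?_
    convert! hasSum_zero using 1
    ext k
    rw [← coefR_apply, map_sub, coefR_apply, coefR_apply, h k]
    simp
  exact sub_eq_zero.mp (norm_eq_zero.mp (by simpa using h0))

/-! ### Multipliers -/

/-- Riesz–Fischer: a square summable family is an ℓ² vector, and the series is its expansion in the
Fourier Hilbert basis. -/
lemma summable_smul_mFourierLp {a : (Fin N → ℤ) → ℂ} (ha : Summable fun k => ‖a k‖ ^ 2) :
    Summable fun k => a k • UnitAddTorus.mFourierLp (d := Fin N) 2 k := by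
  have hm : Memℓp a 2 := memℓp_gen (by simpa using ha)
  have := (UnitAddTorus.mFourierBasis (d := Fin N)).hasSum_repr_symm ⟨a, hm⟩
  simp only [UnitAddTorus.coe_mFourierBasis] at this
  exact this.summable

lemma coefC_tsum {a : (Fin N → ℤ) → ℂ} (ha : Summable fun k => ‖a k‖ ^ 2) (k : Fin N → ℤ) :
    coefC k (∑' l, a l • UnitAddTorus.mFourierLp (d := Fin N) 2 l) = a k := by
  rw [(coefC k).map_tsum (summable_smul_mFourierLp ha)]
  simp only [map_smul, coefC_mFourierLp, smul_eq_mul]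
  rw [tsum_eq_single k (fun l hl => by simp [hl.symm])]
  simp

lemma mFourierCoeff_conj (f : Torus N → ℂ) (k : Fin N → ℤ) :
    UnitAddTorus.mFourierCoeff (fun x => conj (f x)) k
      = conj (UnitAddTorus.mFourierCoeff f (-k)) := by
  simp only [UnitAddTorus.mFourierCoeff, ← integral_conj, UnitAddTorus.mFourier_neg, smul_eq_mul,
    map_mul, neg_neg]

lemma integrable_mFourier_mul {f : Torus N → ℂ} (hf : Integrable f volume) (k : Fin N → ℤ) :
    Integrable (fun x => UnitAddTorus.mFourier k x • f x) volume := by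
  refine hf.bdd_mul (c := 1) (UnitAddTorus.mFourier k).continuous.aestronglyMeasurable ?_
  exact ae_of_all _ fun x => (norm_mFourier_apply k x).le

/-- A square summable family of coefficients with Hermitian symmetry is the family of Fourier
coefficients of the real part of its Fourier series. -/
lemma fourierCoef_re_tsum {a : (Fin N → ℤ) → ℂ} (ha : Summable fun k => ‖a k‖ ^ 2)
    (hsymm : ∀ k, a (-k) = conj (a k)) (k : Fin N → ℤ) :
    fourierCoef (Complex.reCLM.compLp
      (∑' l, a l • UnitAddTorus.mFourierLp (d := Fin N) 2 l)) k = a k := by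
  set G := ∑' l, a l • UnitAddTorus.mFourierLp (d := Fin N) 2 l with hG
  have hGi : Integrable G volume := (Lp.memLp G).integrable (by norm_num)
  have hGk : ∀ k, UnitAddTorus.mFourierCoeff G k = a k := fun k => by
    rw [← coefC_apply, hG, coefC_tsum ha]
  -- Re G = (G + conj G)/2, and conj G has coefficient conj (a (-k)) at `k`, which is `a k` by the
  -- symmetry.
  have h1 : fourierCoef (Complex.reCLM.compLp G) k
      = UnitAddTorus.mFourierCoeff (fun x => (2 : ℂ)⁻¹ * (G x + conj (G x))) k := by
    refine congrFun (mFourierCoeff_congr_ae ?_) k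
    filter_upwards [Complex.reCLM.coeFn_compLp G] with x hx
    rw [hx, Complex.add_conj]
    simp
  have hGc : Integrable (fun x => conj (G x)) volume := by
    simpa using hGi.norm.mono' (Complex.continuous_conj.comp_aestronglyMeasurable
      hGi.aestronglyMeasurable) (by simp)
  have h2 : UnitAddTorus.mFourierCoeff (fun x => (2 : ℂ)⁻¹ * (G x + conj (G x))) k
      = (2 : ℂ)⁻¹ * (UnitAddTorus.mFourierCoeff G k
          + UnitAddTorus.mFourierCoeff (fun x => conj (G x)) k) := by
    simp only [UnitAddTorus.mFourierCoeff]
    rw [← integral_add (integrable_mFourier_mul hGi _) (integrable_mFourier_mul hGc _),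
      ← integral_const_mul]
    congr 1; ext x; simp only [smul_eq_mul]; ring
  rw [h1, h2, mFourierCoeff_conj, hGk, hGk, hsymm, Complex.conj_conj]
  ring

lemma fourierCoef_multiplier {m : (Fin N → ℤ) → ℂ} {f : Torus N → ℝ}
    (hs : Summable fun k => ‖m k * fourierCoef f k‖ ^ 2) (hm : ∀ k, m (-k) = conj (m k))
    (k : Fin N → ℤ) : fourierCoef (multiplier m f) k = m k * fourierCoef f k :=
  fourierCoef_re_tsum hs (fun l => by rw [hm, fourierCoef_neg, map_mul]) k

/-! ### Sobolev norms -/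

lemma freqSq_nonneg (k : Fin N → ℤ) : 0 ≤ freqSq k := Finset.sum_nonneg fun _ _ => sq_nonneg _

lemma freqSq_neg (k : Fin N → ℤ) : freqSq (-k) = freqSq k := by simp [freqSq]

lemma sobolevNormSq_lt_top_iff {s : ℝ} {a : (Fin N → ℤ) → ℂ} :
    sobolevNormSq s a < ⊤ ↔ Summable fun k => (1 + freqSq k) ^ s * ‖a k‖ ^ 2 := by
  have h0 : ∀ k, 0 ≤ (1 + freqSq k) ^ s * ‖a k‖ ^ 2 := fun k =>
    mul_nonneg (Real.rpow_nonneg (by linarith [freqSq_nonneg k]) _) (sq_nonneg _)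
  constructor
  · intro h
    have := ENNReal.summable_toReal h.ne
    simpa only [ENNReal.toReal_ofReal (h0 _)] using this
  · intro h
    rw [sobolevNormSq, ← ENNReal.ofReal_tsum_of_nonneg h0 h]
    exact ENNReal.ofReal_lt_top

/-- The squared `H¹` norm. -/
def h1Sq (a : (Fin N → ℤ) → ℂ) : ℝ := ∑' k, (1 + freqSq k) * ‖a k‖ ^ 2

lemma memH1_iff {f : Torus N → ℝ} :
    MemH1 f ↔ Summable fun k => (1 + freqSq k) * ‖fourierCoef f k‖ ^ 2 := by
  rw [MemH1, sobolevNormSq_lt_top_iff]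
  simp only [Real.rpow_one]

lemma h1Sq_nonneg (a : (Fin N → ℤ) → ℂ) : 0 ≤ h1Sq a :=
  tsum_nonneg fun k => mul_nonneg (by linarith [freqSq_nonneg k]) (sq_nonneg _)

lemma norm_gradSymbol_sq (k : Fin N → ℤ) (i : Fin N) (z : ℂ) :
    ‖2 * (Real.pi : ℂ) * Complex.I * (k i : ℂ) * z‖ ^ 2
      = 4 * Real.pi ^ 2 * (k i : ℝ) ^ 2 * ‖z‖ ^ 2 := by
  simp only [norm_mul, Complex.norm_I, Complex.norm_real, Complex.norm_intCast, Complex.norm_ofNat,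
    mul_pow, Real.norm_eq_abs, sq_abs, one_pow]
  ring

lemma sq_le_freqSq (k : Fin N → ℤ) (i : Fin N) : (k i : ℝ) ^ 2 ≤ freqSq k :=
  Finset.single_le_sum (f := fun i => (k i : ℝ) ^ 2) (fun _ _ => sq_nonneg _) (Finset.mem_univ i)

lemma MemH1.summable_freqSq {f : Torus N → ℝ} (hf : MemH1 f) :
    Summable fun k => 4 * Real.pi ^ 2 * freqSq k * ‖fourierCoef f k‖ ^ 2 := by
  refine Summable.of_nonneg_of_le (fun k => ?_) (fun k => ?_)
    ((memH1_iff.mp hf).mul_left (4 * Real.pi ^ 2))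
  · have := freqSq_nonneg k; positivity
  · rw [mul_assoc (4 * Real.pi ^ 2)]
    gcongr
    linarith

lemma MemH1.summable_gradSymbol {f : Torus N → ℝ} (hf : MemH1 f) (i : Fin N) :
    Summable fun k : Fin N → ℤ =>
      ‖2 * (Real.pi : ℂ) * Complex.I * (k i : ℂ) * fourierCoef f k‖ ^ 2 := by
  refine Summable.of_nonneg_of_le (fun k => by positivity) (fun k => ?_) hf.summable_freqSq
  rw [norm_gradSymbol_sq]
  gcongr
  exact sq_le_freqSq k i

lemma MemH1.fourierCoef_grad {f : Torus N → ℝ} (hf : MemH1 f) (i : Fin N) (k : Fin N → ℤ) :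
    fourierCoef (fun x => grad f x i) k
      = 2 * (Real.pi : ℂ) * Complex.I * (k i : ℂ) * fourierCoef f k := by
  refine fourierCoef_multiplier (hf.summable_gradSymbol i) (fun l => ?_) k
  simp only [Pi.neg_apply, map_mul, Complex.conj_ofReal, Complex.conj_I, Complex.conj_ofNat,
    map_intCast]
  push_cast
  ring

lemma memLp_grad_apply (f : Torus N → ℝ) (i : Fin N) :
    MemLp (fun x => grad f x i) 2 volume := Lp.memLp _

lemma memLp_grad (f : Torus N → ℝ) : MemLp (grad f) 2 volume :=
  MemLp.of_eval_piLp fun i => memLp_grad_apply f i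

/-- `∫ ⟪∇f, G⟫` by Parseval, for a square integrable field `G` whose components have Fourier
coefficients `2πi k_i b_k`. -/
lemma MemH1.hasSum_inner_grad {f : Torus N → ℝ} (hf : MemH1 f) {G : Torus N → Vec N}
    (hG : ∀ i, MemLp (fun x => G x i) 2 volume) {b : (Fin N → ℤ) → ℂ}
    (hb : ∀ i k, fourierCoef (fun x => G x i) k
      = 2 * (Real.pi : ℂ) * Complex.I * (k i : ℂ) * b k) :
    HasSum (fun k => ((4 * Real.pi ^ 2 * freqSq k : ℝ) : ℂ) * (fourierCoef f k * conj (b k)))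
      ((∫ x, inner ℝ (grad f x) (G x) : ℝ) : ℂ) := by
  have h : ∀ i, HasSum (fun k => 4 * (Real.pi : ℂ) ^ 2 * (k i : ℂ) ^ 2 *
      (fourierCoef f k * conj (b k))) ((∫ x, grad f x i * G x i : ℝ) : ℂ) := fun i => by
    convert! hasSum_fourierCoef_mul_conj (memLp_grad_apply f i) (hG i) using 1
    ext k
    rw [hf.fourierCoef_grad, hb]
    simp only [map_mul, Complex.conj_ofReal, Complex.conj_I, Complex.conj_ofNat, map_intCast]
    linear_combination 4 * (Real.pi : ℂ) ^ 2 * (k i : ℂ) ^ 2 *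
      (fourierCoef f k * conj (b k)) * Complex.I_sq
  convert! hasSum_sum (s := Finset.univ) (fun i _ => h i) using 1
  · ext k
    rw [← Finset.sum_mul, freqSq]
    push_cast
    rw [Finset.mul_sum]
  · rw [← Complex.ofReal_sum, ← integral_finsetSum]
    · congr 2; ext x
      simp [PiLp.inner_apply, mul_comm]
    · intro i _
      exact (memLp_grad_apply f i).integrable_mul (hG i)

lemma MemH1.hasSum_norm_grad_sq {f : Torus N → ℝ} (hf : MemH1 f) :
    HasSum (fun k => 4 * Real.pi ^ 2 * freqSq k * ‖fourierCoef f k‖ ^ 2)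
      (∫ x, ‖grad f x‖ ^ 2) := by
  have h := Complex.hasSum_re (hf.hasSum_inner_grad (memLp_grad_apply f) (hf.fourierCoef_grad))
  convert! h using 1
  · ext k
    rw [Complex.mul_conj, ← Complex.ofReal_mul, Complex.ofReal_re, Complex.normSq_eq_norm_sq]
  · simp

/-- The weight in `h1Sq` is 1 + |k|², whereas ‖∇f‖² carries 4π²|k|² because the circle has period
one; hence the factor (4π²)⁻¹. -/
lemma h1Sq_fourierCoef {f : L2 N} (hf : MemH1 f) :
    h1Sq (fourierCoef f) = ‖f‖ ^ 2 + (4 * Real.pi ^ 2)⁻¹ * ∫ x, ‖grad f x‖ ^ 2 := by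
  rw [h1Sq, ((hasSum_norm_sq_fourierCoef_L2 f).add
    (hf.hasSum_norm_grad_sq.mul_left (4 * Real.pi ^ 2)⁻¹)).tsum_eq.symm]
  congr 1; ext k
  have := Real.pi_ne_zero
  field_simp

/-! ### Trigonometric polynomials and the subcritical Sobolev inequality -/

/-- The trigonometric polynomial with coefficients `c` on the finite set of frequencies `S`. -/
def trig (S : Finset (Fin N → ℤ)) (c : (Fin N → ℤ) → ℂ) : C(Torus N, ℂ) :=
  ∑ k ∈ S, c k • UnitAddTorus.mFourier k

lemma trig_apply (S : Finset (Fin N → ℤ)) (c : (Fin N → ℤ) → ℂ) (x : Torus N) :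
    trig S c x = ∑ k ∈ S, c k * UnitAddTorus.mFourier k x := by
  simp [trig, ContinuousMap.sum_apply]

/-- Cauchy–Schwarz, the characters having modulus one. This is the sup-norm end of Bernstein's
inequality. -/
lemma norm_trig_sq_le (S : Finset (Fin N → ℤ)) (c : (Fin N → ℤ) → ℂ) (x : Torus N) :
    ‖trig S c x‖ ^ 2 ≤ S.card * ∑ k ∈ S, ‖c k‖ ^ 2 := by
  refine le_trans ?_ (sq_sum_le_card_mul_sum_sq (s := S) (f := fun k => ‖c k‖))
  gcongr
  rw [trig_apply]
  refine (norm_sum_le _ _).trans_eq ?_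
  simp [norm_mFourier_apply]

lemma coeFn_sum_mFourierLp (S : Finset (Fin N → ℤ)) (c : (Fin N → ℤ) → ℂ) :
    (∑ k ∈ S, c k • UnitAddTorus.mFourierLp (d := Fin N) 2 k :
      Lp ℂ 2 (volume : Measure (Torus N))) =ᵐ[volume] trig S c := by
  have h : ContinuousMap.toLp (E := ℂ) 2 volume ℂ (trig S c)
      = ∑ k ∈ S, c k • UnitAddTorus.mFourierLp (d := Fin N) 2 k := by
    simp [trig, map_sum, map_smul]
  rw [← h]
  exact ContinuousMap.coeFn_toLp volume (trig S c)

lemma lintegral_trig_sq (S : Finset (Fin N → ℤ)) (c : (Fin N → ℤ) → ℂ) :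
    ∫⁻ x, ‖trig S c x‖ₑ ^ (2 : ℝ) = ENNReal.ofReal (∑ k ∈ S, ‖c k‖ ^ 2) := by
  set g : Lp ℂ 2 (volume : Measure (Torus N)) :=
    ∑ k ∈ S, c k • UnitAddTorus.mFourierLp (d := Fin N) 2 k with hg
  have h1 : ‖g‖ ^ 2 = ∑ k ∈ S, ‖c k‖ ^ 2 := by
    have h := UnitAddTorus.orthonormal_mFourier.inner_sum c c S
    rw [inner_self_eq_norm_sq_to_K] at h
    have h' : ((‖g‖ ^ 2 : ℝ) : ℂ) = ((∑ k ∈ S, ‖c k‖ ^ 2 : ℝ) : ℂ) := by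
      push_cast
      simpa [Complex.conj_mul'] using h
    exact_mod_cast h'
  have h2 : eLpNorm (trig S c) 2 volume = ENNReal.ofReal ‖g‖ := by
    rw [← eLpNorm_congr_ae (coeFn_sum_mFourierLp S c), Lp.norm_def,
      ENNReal.ofReal_toReal (Lp.eLpNorm_ne_top _)]
  rw [eLpNorm_eq_lintegral_rpow_enorm_toReal (by norm_num) (by norm_num)] at h2
  simp only [ENNReal.toReal_ofNat] at h2
  rw [← h1, ENNReal.ofReal_pow (norm_nonneg _), ← h2, ← ENNReal.rpow_two, ← ENNReal.rpow_mul]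
  norm_num

/-- Bernstein's inequality from L² to L^s: write |P|^s = |P|^{s-2}|P|², bound the first factor by
the supremum and integrate the second by Parseval. -/
lemma eLpNorm_trig_le_card {s : ℝ} (hs : 2 ≤ s) (S : Finset (Fin N → ℤ))
    (c : (Fin N → ℤ) → ℂ) :
    eLpNorm (trig S c) (ENNReal.ofReal s) volume
      ≤ ENNReal.ofReal ((S.card : ℝ) ^ (1 / 2 - 1 / s) * √(∑ k ∈ S, ‖c k‖ ^ 2)) := by
  set Q := ∑ k ∈ S, ‖c k‖ ^ 2 with hQ
  have hQ0 : 0 ≤ Q := Finset.sum_nonneg fun _ _ => sq_nonneg _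
  have hs0 : 0 < s := by linarith
  have hn0 : (0 : ℝ) ≤ S.card := Nat.cast_nonneg _
  rw [eLpNorm_eq_lintegral_rpow_enorm_toReal (by simpa using hs0) ENNReal.ofReal_ne_top,
    ENNReal.toReal_ofReal hs0.le]
  have h1 : ∫⁻ x, ‖trig S c x‖ₑ ^ s
      ≤ ENNReal.ofReal ((S.card * Q) ^ ((s - 2) / 2) * Q) := by
    rw [ENNReal.ofReal_mul (by positivity), ← lintegral_trig_sq,
      ← lintegral_const_mul' _ _ ENNReal.ofReal_ne_top]
    refine lintegral_mono fun x => ?_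
    dsimp only
    have : s = (s - 2) + 2 := by ring
    nth_rw 1 [this]
    rw [ENNReal.rpow_add_of_nonneg _ _ (by linarith) (by norm_num)]
    gcongr
    rw [← ofReal_norm, ENNReal.ofReal_rpow_of_nonneg (norm_nonneg _) (by linarith)]
    refine ENNReal.ofReal_le_ofReal ?_
    have h2 : s - 2 = 2 * ((s - 2) / 2) := by ring
    rw [h2, Real.rpow_mul (norm_nonneg _), Real.rpow_two, ← h2]
    exact Real.rpow_le_rpow (sq_nonneg _) (norm_trig_sq_le S c x) (by linarith)
  refine (ENNReal.rpow_le_rpow h1 (by positivity)).trans_eq ?_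
  rw [ENNReal.ofReal_rpow_of_nonneg (by positivity) (by positivity)]
  congr 1
  rw [Real.mul_rpow hn0 hQ0, mul_assoc, Real.mul_rpow (by positivity) (by positivity),
    ← Real.rpow_mul hn0]
  have e1 : (s - 2) / 2 * (1 / s) = 1 / 2 - 1 / s := by field_simp
  rw [e1, Real.sqrt_eq_rpow]
  congr 1
  -- Adding real exponents needs a positive base, so the zero polynomial is treated apart.
  rcases eq_or_lt_of_le hQ0 with h | h
  · rw [← h, mul_zero, Real.zero_rpow (by positivity), Real.zero_rpow (by norm_num)]
  · nth_rw 2 [← Real.rpow_one Q]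
    rw [← Real.rpow_add h, ← Real.rpow_mul h.le]
    congr 1
    field_simp
    ring

/-- The dyadic size of a frequency. -/
def dyadicSize (k : Fin N → ℤ) : ℕ := (Finset.univ.sup fun i => (k i).natAbs).size

/-- Every coordinate has absolute value below 2^j, hence lies in [-2^j, 2^j), which contains exactly
2^{j+1} integers. -/
lemma card_dyadicSize_le (S : Finset (Fin N → ℤ)) (j : ℕ) :
    (({k ∈ S | dyadicSize k = j}).card : ℝ) ≤ (2 : ℝ) ^ ((N : ℝ) * (j + 1)) := by
  classical
  have h1 : {k ∈ S | dyadicSize k = j} ⊆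
      Fintype.piFinset fun _ : Fin N => Finset.Ico (-(2 : ℤ) ^ j) (2 ^ j) := by
    intro k hk
    rw [Finset.mem_filter] at hk
    rw [Fintype.mem_piFinset]
    intro i
    have h2 := Nat.size_le.mp hk.2.le
    have h3 : (k i).natAbs ≤ Finset.univ.sup fun i => (k i).natAbs :=
      Finset.le_sup (f := fun i => (k i).natAbs) (Finset.mem_univ i)
    have h4 : ((k i).natAbs : ℤ) < (2 : ℤ) ^ j := by exact_mod_cast h3.trans_lt h2
    rw [Finset.mem_Ico]
    omega
  have h2 := Finset.card_le_card h1
  rw [Fintype.card_piFinset_const, Int.card_Ico] at h2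
  have h3 : ((2 : ℤ) ^ j - -(2 : ℤ) ^ j).toNat = 2 ^ (j + 1) := by
    have : (2 : ℤ) ^ j - -(2 : ℤ) ^ j = ((2 ^ (j + 1) : ℕ) : ℤ) := by push_cast; ring
    rw [this, Int.toNat_natCast]
  rw [h3] at h2
  calc (({k ∈ S | dyadicSize k = j}).card : ℝ) ≤ (((2 ^ (j + 1)) ^ N : ℕ) : ℝ) := by
        exact_mod_cast h2
    _ = _ := by
        rw [← pow_mul, mul_comm, Nat.cast_pow, Nat.cast_ofNat, ← Real.rpow_natCast]
        push_cast
        ring_nf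

/-- At size j + 1 some coordinate is at least 2^j in absolute value, and passing from 2^j to 2^{j+1}
costs the factor 4. Size zero is the zero frequency, covered by the summand 1. -/
lemma two_pow_dyadicSize_sq_le (k : Fin N → ℤ) :
    ((2 : ℝ) ^ dyadicSize k) ^ 2 ≤ 4 * (1 + freqSq k) := by
  have h0 := freqSq_nonneg k
  rcases Nat.eq_zero_or_pos (dyadicSize k) with h | h
  · rw [h]; norm_num; linarith
  · obtain ⟨j, hj⟩ := Nat.exists_eq_succ_of_ne_zero h.ne'
    have h1 : 2 ^ j ≤ Finset.univ.sup fun i => (k i).natAbs :=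
      Nat.lt_size.mp (by change j < dyadicSize k; omega)
    have hne : (Finset.univ : Finset (Fin N)).Nonempty := by
      by_contra hne
      rw [Finset.not_nonempty_iff_eq_empty] at hne
      rw [hne] at h1
      simp at h1
    obtain ⟨i, -, hi⟩ := Finset.exists_mem_eq_sup _ hne fun i => (k i).natAbs
    rw [hi] at h1
    have h2 : ((2 : ℝ) ^ j) ^ 2 ≤ (k i : ℝ) ^ 2 := by
      rw [← sq_abs (k i : ℝ)]
      have h3 : (2 : ℝ) ^ j ≤ |(k i : ℝ)| := by
        have : ((2 ^ j : ℕ) : ℝ) ≤ (((k i).natAbs : ℕ) : ℝ) := by exact_mod_cast h1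
        rw [Nat.cast_natAbs] at this
        push_cast at this
        exact this
      gcongr
    have h4 := sq_le_freqSq k i
    have h5 : ((2 : ℝ) ^ (j + 1)) ^ 2 = 4 * ((2 : ℝ) ^ j) ^ 2 := by ring
    rw [hj, Nat.succ_eq_add_one, h5]
    linarith

/-- Split the polynomial into dyadic blocks. With θ = 1/2 - 1/s, Bernstein costs about 2^{jNθ} on
block j, while interpolating its L² norm between `A` and 2^{1-j}`B` gains 2^{-jσ}. As Nθ < σ, the
block norms form a convergent geometric series. -/
lemma eLpNorm_trig_le {s σ : ℝ} (hs : 2 ≤ s) (hσ0 : 0 ≤ σ) (hσ1 : σ ≤ 1)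
    (hσ : N * (1 / 2 - 1 / s) < σ) (S : Finset (Fin N → ℤ)) (c : (Fin N → ℤ) → ℂ) {A B : ℝ}
    (hA : √(∑ k ∈ S, ‖c k‖ ^ 2) ≤ A) (hB : √(∑ k ∈ S, (1 + freqSq k) * ‖c k‖ ^ 2) ≤ B) :
    eLpNorm (trig S c) (ENNReal.ofReal s) volume
      ≤ ENNReal.ofReal ((2 : ℝ) ^ (N * (1 / 2 - 1 / s) + σ)
          * (1 - (2 : ℝ) ^ (N * (1 / 2 - 1 / s) - σ))⁻¹ * (A ^ (1 - σ) * B ^ σ)) := by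
  set θ := 1 / 2 - 1 / s with hθ
  have hθ0 : 0 ≤ θ := by
    rw [hθ, sub_nonneg]; exact one_div_le_one_div_of_le (by norm_num) hs
  have hA0 : 0 ≤ A := (Real.sqrt_nonneg _).trans hA
  have hB0 : 0 ≤ B := (Real.sqrt_nonneg _).trans hB
  set r := (2 : ℝ) ^ (N * θ - σ) with hr
  have hr0 : 0 ≤ r := by positivity
  have hr1 : r < 1 := Real.rpow_lt_one_of_one_lt_of_neg (by norm_num) (by linarith)
  let block : ℕ → Finset (Fin N → ℤ) := fun j => {k ∈ S | dyadicSize k = j}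
  have hblock : ∀ j, eLpNorm (trig (block j) c) (ENNReal.ofReal s) volume
      ≤ ENNReal.ofReal ((2 : ℝ) ^ (N * θ + σ) * (A ^ (1 - σ) * B ^ σ) * r ^ j) := by
    intro j
    refine (eLpNorm_trig_le_card hs _ _).trans (ENNReal.ofReal_le_ofReal ?_)
    set Q := √(∑ k ∈ block j, ‖c k‖ ^ 2) with hQ
    have hQ0 : 0 ≤ Q := Real.sqrt_nonneg _
    have hQA : Q ≤ A := by
      refine le_trans (Real.sqrt_le_sqrt ?_) hA
      exact Finset.sum_le_sum_of_subset_of_nonneg (Finset.filter_subset _ _)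
        fun _ _ _ => sq_nonneg _
    -- On block j the weight satisfies 1 + |k|² ≥ 2^{2j}/4, so the H¹ bound gains a factor 2^{1-j}.
    have hQB : Q ≤ (2 : ℝ) ^ (1 - (j : ℝ)) * B := by
      have h1 : (2 : ℝ) ^ j * Q ≤ 2 * B := by
        calc (2 : ℝ) ^ j * Q = √(((2 : ℝ) ^ j) ^ 2 * ∑ k ∈ block j, ‖c k‖ ^ 2) := by
              rw [Real.sqrt_mul (by positivity), Real.sqrt_sq (by positivity)]
          _ ≤ √(2 ^ 2 * ∑ k ∈ S, (1 + freqSq k) * ‖c k‖ ^ 2) := by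
              refine Real.sqrt_le_sqrt ?_
              rw [Finset.mul_sum, Finset.mul_sum]
              refine (Finset.sum_le_sum fun k hk => ?_).trans
                (Finset.sum_le_sum_of_subset_of_nonneg (Finset.filter_subset _ _) ?_)
              · have hk2 := (Finset.mem_filter.mp hk).2
                rw [← mul_assoc, ← hk2]
                gcongr
                have := two_pow_dyadicSize_sq_le k
                linarith
              · intro k _ _
                have := freqSq_nonneg k
                positivity
          _ ≤ 2 * B := by
              rw [Real.sqrt_mul (by positivity), Real.sqrt_sq (by positivity)]
              gcongr
      rw [Real.rpow_sub (by norm_num), Real.rpow_one, Real.rpow_natCast, div_mul_eq_mul_div,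
        le_div_iff₀ (by positivity)]
      linarith
    have hQi : Q ≤ A ^ (1 - σ) * ((2 : ℝ) ^ (1 - (j : ℝ)) * B) ^ σ := by
      rcases eq_or_lt_of_le hQ0 with h | h
      · rw [← h]; positivity
      · calc Q = Q ^ (1 - σ) * Q ^ σ := by
              rw [← Real.rpow_add h]; simp
          _ ≤ _ := by
              have : 0 ≤ 1 - σ := by linarith
              gcongr
    calc ((block j).card : ℝ) ^ θ * Q
        ≤ ((2 : ℝ) ^ ((N : ℝ) * (j + 1))) ^ θ
            * (A ^ (1 - σ) * ((2 : ℝ) ^ (1 - (j : ℝ)) * B) ^ σ) := by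
          gcongr
          exact card_dyadicSize_le S j
      _ = _ := by
          rw [Real.mul_rpow (by positivity) hB0, ← Real.rpow_mul (by norm_num),
            ← Real.rpow_mul (by norm_num), hr, ← Real.rpow_natCast, ← Real.rpow_mul (by norm_num)]
          have : (2 : ℝ) ^ ((N : ℝ) * (j + 1) * θ) * (2 : ℝ) ^ ((1 - (j : ℝ)) * σ)
              = (2 : ℝ) ^ (N * θ + σ) * (2 : ℝ) ^ ((N * θ - σ) * j) := by
            rw [← Real.rpow_add (by norm_num), ← Real.rpow_add (by norm_num)]
            congr 1; ring
          linear_combination (A ^ (1 - σ) * B ^ σ) * this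
  have hmaps : ∀ k ∈ S, dyadicSize k ∈ Finset.range (S.sup dyadicSize + 1) := fun k hk => by
    rw [Finset.mem_range, Nat.lt_succ_iff]
    exact Finset.le_sup hk
  have hsum : (trig S c : Torus N → ℂ)
      = ∑ j ∈ Finset.range (S.sup dyadicSize + 1), (trig (block j) c : Torus N → ℂ) := by
    ext x
    rw [Finset.sum_apply]
    simp only [trig_apply]
    exact (Finset.sum_fiberwise_of_maps_to hmaps _).symm
  rw [hsum]
  refine (eLpNorm_sum_le (fun j _ => (trig (block j) c).continuous.aestronglyMeasurable) ?_).trans ?_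
  · rw [ENNReal.one_le_ofReal]; linarith
  refine (Finset.sum_le_sum fun j _ => hblock j).trans ?_
  rw [← ENNReal.ofReal_sum_of_nonneg fun j _ => by positivity]
  refine ENNReal.ofReal_le_ofReal ?_
  rw [← Finset.mul_sum]
  have hgeo : ∑ j ∈ Finset.range (S.sup dyadicSize + 1), r ^ j ≤ (1 - r)⁻¹ := by
    rw [← tsum_geometric_of_lt_one hr0 hr1]
    exact Summable.sum_le_tsum _ (fun _ _ => by positivity)
      (summable_geometric_of_lt_one hr0 hr1)
  calc _ ≤ (2 : ℝ) ^ (N * θ + σ) * (A ^ (1 - σ) * B ^ σ) * (1 - r)⁻¹ := by gcongr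
    _ = _ := by ring

/-- Subcritical Gagliardo–Nirenberg–Sobolev inequality on the torus. -/
lemma exists_eLpNorm_le (N : ℕ) {s σ : ℝ} (hs : 2 ≤ s) (hσ0 : 0 ≤ σ) (hσ1 : σ ≤ 1)
    (hσ : N * (1 / 2 - 1 / s) < σ) :
    ∃ C : ℝ, 0 ≤ C ∧ ∀ f : Lp ℂ 2 (volume : Measure (Torus N)),
      (Summable fun k => (1 + freqSq k) * ‖UnitAddTorus.mFourierCoeff f k‖ ^ 2) →
      eLpNorm f (ENNReal.ofReal s) volume
        ≤ ENNReal.ofReal (C * (‖f‖ ^ (1 - σ) * √(h1Sq (UnitAddTorus.mFourierCoeff f)) ^ σ)) := by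
  refine ⟨(2 : ℝ) ^ (N * (1 / 2 - 1 / s) + σ) * (1 - (2 : ℝ) ^ (N * (1 / 2 - 1 / s) - σ))⁻¹,
    mul_nonneg (by positivity) (inv_nonneg.mpr (sub_nonneg.mpr
      (Real.rpow_lt_one_of_one_lt_of_neg (by norm_num) (by linarith)).le)), fun f hf => ?_⟩
  -- The partial Fourier sums obey the bound uniformly and converge to `f` in L², hence in measure;
  -- the L^s norm is lower semicontinuous under this convergence.
  have hmeas := tendstoInMeasure_of_tendsto_Lp
    (l := (atTop : Filter (Finset (Fin N → ℤ)))) (UnitAddTorus.hasSum_mFourier_series_L2 f)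
  refine eLpNorm_le_of_tendstoInMeasure (Eventually.of_forall fun S => ?_) hmeas
    (fun S => Lp.aestronglyMeasurable _)
  rw [eLpNorm_congr_ae (coeFn_sum_mFourierLp S _)]
  have hP : HasSum (fun k => ‖UnitAddTorus.mFourierCoeff f k‖ ^ 2) (‖f‖ ^ 2) := by
    convert! UnitAddTorus.hasSum_sq_mFourierCoeff f using 1
    have := inner_self_eq_norm_sq (𝕜 := ℂ) f
    rw [← this, L2.inner_def, ← integral_re (L2.integrable_inner f f)]
    simp only [inner_self_eq_norm_sq]
  refine eLpNorm_trig_le hs hσ0 hσ1 hσ S _ ?_ ?_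
  · rw [← Real.sqrt_sq (norm_nonneg f)]
    exact Real.sqrt_le_sqrt (sum_le_hasSum _ (fun _ _ => sq_nonneg _) hP)
  · refine Real.sqrt_le_sqrt (hf.sum_le_tsum _ fun k _ => ?_)
    have := freqSq_nonneg k
    positivity

/-! ### The advection term as an element of `H⁻¹` -/

/-- `H¹(𝕋^N)` embeds in `L^s(𝕋^N)` with constant `K`. -/
def H1Embeds (N : ℕ) (s K : ℝ) : Prop :=
  0 ≤ K ∧ ∀ f : Lp ℂ 2 (volume : Measure (Torus N)),
    (Summable fun k => (1 + freqSq k) * ‖UnitAddTorus.mFourierCoeff f k‖ ^ 2) →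
      eLpNorm f (ENNReal.ofReal s) volume
        ≤ ENNReal.ofReal (K * √(h1Sq (UnitAddTorus.mFourierCoeff f)))

/-- The endpoint σ = 1 of the interpolation inequality, where the L² factor has exponent zero. -/
lemma exists_h1Embeds {s : ℝ} (hs : 2 ≤ s) (hN : N * (1 / 2 - 1 / s) < 1) :
    ∃ K, H1Embeds N s K := by
  obtain ⟨K, hK0, hK⟩ := exists_eLpNorm_le N hs zero_le_one le_rfl hN
  exact ⟨K, hK0, fun f hf => by simpa using hK f hf⟩

/-- The product of an `L^q` field, an `L²` field and an `L^s` function is integrable. -/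
lemma integral_inner_mul_le {q s : ℝ} (hqs : q.HolderTriple s 2) {v G : Torus N → Vec N}
    {V Γ W : ℝ} (hV : 0 ≤ V) (hΓ : 0 ≤ Γ) (hW : 0 ≤ W)
    (hv : AEStronglyMeasurable v volume)
    (hvq : eLpNorm v (ENNReal.ofReal q) volume ≤ ENNReal.ofReal V)
    (hG : AEStronglyMeasurable G volume) (hG2 : eLpNorm G 2 volume ≤ ENNReal.ofReal Γ)
    {w : Torus N → ℂ} (hw : AEStronglyMeasurable w volume)
    (hws : eLpNorm w (ENNReal.ofReal s) volume ≤ ENNReal.ofReal W) :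
    Integrable (fun x => ((inner ℝ (v x) (G x) : ℝ) : ℂ) * w x) volume ∧
      ‖∫ x, ((inner ℝ (v x) (G x) : ℝ) : ℂ) * w x‖ ≤ V * Γ * W := by
  have hmeas : AEStronglyMeasurable (fun x => ((inner ℝ (v x) (G x) : ℝ) : ℂ) * w x) volume :=
    (Complex.continuous_ofReal.comp_aestronglyMeasurable (hv.inner hG)).mul hw
  have hH := hqs.ennrealOfReal
  rw [ENNReal.ofReal_ofNat] at hH
  -- Hölder is used twice: 1/q + 1/s = 1/2 places |v||w| in L², and Cauchy–Schwarz then pairs it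
  -- with G.
  have h1 : eLpNorm (fun x => ‖v x‖ * ‖w x‖) 2 volume ≤ ENNReal.ofReal V * ENNReal.ofReal W := by
    have := eLpNorm_le_eLpNorm_mul_eLpNorm_of_nnnorm (r := 2) hv hw
      (fun a z => ‖a‖ * ‖z‖) 1 (ae_of_all _ fun x => by simp) (hpqr := hH)
    refine this.trans ?_
    rw [ENNReal.coe_one, one_mul]
    gcongr
  have h2 : eLpNorm (fun x => ((inner ℝ (v x) (G x) : ℝ) : ℂ) * w x) 1 volume
      ≤ ENNReal.ofReal (V * Γ * W) := by
    have := eLpNorm_le_eLpNorm_mul_eLpNorm_of_nnnorm (p := 2) (q := 2) (r := 1) hG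
      (hv.norm.mul hw.norm) (fun a (z : ℝ) => ‖a‖ * z) 1
      (ae_of_all _ fun x => by simp)
    refine (eLpNorm_mono fun x => ?_).trans (this.trans ?_)
    · rw [norm_mul, Complex.norm_real]
      have h := norm_inner_le_norm (𝕜 := ℝ) (v x) (G x)
      simp only [Pi.mul_apply, norm_mul, norm_norm]
      calc _ ≤ ‖v x‖ * ‖G x‖ * ‖w x‖ := by gcongr
        _ = _ := by ring
    · rw [ENNReal.coe_one, one_mul]
      calc _ ≤ ENNReal.ofReal Γ * (ENNReal.ofReal V * ENNReal.ofReal W) := by gcongr; exact h1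
        _ = _ := by
          rw [← ENNReal.ofReal_mul hV, ← ENNReal.ofReal_mul hΓ]; congr 1; ring
  have hint : Integrable (fun x => ((inner ℝ (v x) (G x) : ℝ) : ℂ) * w x) volume :=
    memLp_one_iff_integrable.mp ⟨hmeas, h2.trans_lt ENNReal.ofReal_lt_top⟩
  refine ⟨hint, (norm_integral_le_integral_norm _).trans ?_⟩
  rw [integral_norm_eq_lintegral_enorm hmeas, ← eLpNorm_one_eq_lintegral_enorm]
  exact ENNReal.toReal_le_of_le_ofReal (by positivity) h2

lemma integral_mul_trig {F : Torus N → ℝ} (hF : Integrable F volume) (S : Finset (Fin N → ℤ))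
    (c : (Fin N → ℤ) → ℂ) :
    ∫ x, (F x : ℂ) * trig S c x = ∑ k ∈ S, c k * conj (fourierCoef F k) := by
  simp only [trig_apply, Finset.mul_sum]
  rw [integral_finsetSum]
  · refine Finset.sum_congr rfl fun k _ => ?_
    rw [conj_fourierCoef, ← integral_const_mul]
    congr 1; ext x; ring
  · intro k _
    have := (integrable_mFourier_mul hF.ofReal k).const_mul (c k)
    refine this.congr (ae_of_all _ fun x => ?_)
    simp only [smul_eq_mul, Complex.coe_algebraMap]
    ring

lemma mFourierCoeff_sum_mFourierLp (S : Finset (Fin N → ℤ)) (c : (Fin N → ℤ) → ℂ)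
    (k : Fin N → ℤ) [Decidable (k ∈ S)] :
    UnitAddTorus.mFourierCoeff (∑ l ∈ S, c l • UnitAddTorus.mFourierLp (d := Fin N) 2 l :
      Lp ℂ 2 (volume : Measure (Torus N))) k = if k ∈ S then c k else 0 := by
  rw [← coefC_apply, map_sum]
  simp only [map_smul, coefC_mFourierLp, smul_eq_mul, mul_ite, mul_one, mul_zero]
  convert! Finset.sum_ite_eq S k c

lemma eLpNorm_trig_le_h1 {s K : ℝ} (hK : H1Embeds N s K) (S : Finset (Fin N → ℤ))
    (c : (Fin N → ℤ) → ℂ) :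
    eLpNorm (trig S c) (ENNReal.ofReal s) volume
      ≤ ENNReal.ofReal (K * √(∑ k ∈ S, (1 + freqSq k) * ‖c k‖ ^ 2)) := by
  classical
  have h0 : ∀ k ∉ S, (1 + freqSq k) * ‖if k ∈ S then c k else 0‖ ^ 2 = 0 := fun k hk => by
    simp [hk]
  have h := hK.2 (∑ k ∈ S, c k • UnitAddTorus.mFourierLp (d := Fin N) 2 k) (by
    simp only [mFourierCoeff_sum_mFourierLp]
    exact summable_of_ne_finset_zero h0)
  rw [eLpNorm_congr_ae (coeFn_sum_mFourierLp S c)] at h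
  simp only [h1Sq, mFourierCoeff_sum_mFourierLp] at h
  rw [tsum_eq_sum h0] at h
  rwa [Finset.sum_congr rfl fun k hk => by rw [if_pos hk]] at h

/-- The truncation error of `w` keeps only the frequencies outside `S`, so the embedding bounds it
by the H¹ tail. That tail vanishes along finite sets, being the tail of a convergent series. -/
lemma eLpNorm_sub_trig_le {s K : ℝ} (hK : H1Embeds N s K) {w : L2 N} (hw : MemH1 w)
    (S : Finset (Fin N → ℤ)) :
    eLpNorm (fun x => (w x : ℂ) - trig S (fourierCoef w) x) (ENNReal.ofReal s) volume
      ≤ ENNReal.ofReal (K * √(∑' k : {k // k ∉ S},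
          (1 + freqSq k.1) * ‖fourierCoef w k.1‖ ^ 2)) := by
  classical
  set g : Lp ℂ 2 (volume : Measure (Torus N)) :=
    toC w - ∑ k ∈ S, fourierCoef w k • UnitAddTorus.mFourierLp (d := Fin N) 2 k with hg
  have hgk : ∀ k, (1 + freqSq k) * ‖UnitAddTorus.mFourierCoeff g k‖ ^ 2
      = {k | k ∉ S}.indicator (fun k => (1 + freqSq k) * ‖fourierCoef w k‖ ^ 2) k := fun k => by
    rw [← coefC_apply, hg, map_sub, coefC_apply, coefC_apply, mFourierCoeff_toC,
      mFourierCoeff_sum_mFourierLp]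
    by_cases hk : k ∈ S <;> simp [hk]
  have hga : (fun x => (w x : ℂ) - trig S (fourierCoef w) x) =ᵐ[volume] g := by
    filter_upwards [Lp.coeFn_sub (toC w)
      (∑ k ∈ S, fourierCoef w k • UnitAddTorus.mFourierLp (d := Fin N) 2 k), coeFn_toC w,
      coeFn_sum_mFourierLp S (fourierCoef w)] with x h1 h2 h3
    rw [hg, h1, Pi.sub_apply, h2, h3]
  rw [eLpNorm_congr_ae hga]
  refine (hK.2 g ?_).trans_eq ?_
  · simp only [hgk]
    exact (memH1_iff.mp hw).indicator _
  · simp only [h1Sq, hgk]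
    congr 3
    exact (tsum_subtype {k | k ∉ S} _).symm

lemma tendsto_h1_tail (w : L2 N) (C : ℝ) :
    Tendsto (fun S : Finset (Fin N → ℤ) => C * √(∑' k : {k // k ∉ S},
      (1 + freqSq k.1) * ‖fourierCoef w k.1‖ ^ 2)) atTop (𝓝 0) := by
  have := (tendsto_tsum_compl_atTop_zero
    fun k => (1 + freqSq k) * ‖fourierCoef w k‖ ^ 2).sqrt.const_mul C
  simpa using this

/-- The hypotheses on the advecting field at a fixed time, and a gradient field. -/
structure AdvectionData (q s : ℝ) (v G : Torus N → Vec N) (V Γ K : ℝ) : Prop where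
  holder : q.HolderTriple s 2
  embeds : H1Embeds N s K
  V_nonneg : 0 ≤ V
  Γ_nonneg : 0 ≤ Γ
  aesm_v : AEStronglyMeasurable v volume
  eLpNorm_v : eLpNorm v (ENNReal.ofReal q) volume ≤ ENNReal.ofReal V
  aesm_G : AEStronglyMeasurable G volume
  eLpNorm_G : eLpNorm G 2 volume ≤ ENNReal.ofReal Γ

namespace AdvectionData

variable {q s V Γ K : ℝ} {v G : Torus N → Vec N} (h : AdvectionData q s v G V Γ K)
include h

lemma integrable : Integrable (fun x => inner ℝ (v x) (G x)) volume := by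
  -- The torus has measure one, so the constant 1 is admissible as third factor, with L^s norm 1.
  have h1 : eLpNorm (fun _ : Torus N => (1 : ℂ)) (ENNReal.ofReal s) volume
      ≤ ENNReal.ofReal 1 := by
    rw [eLpNorm_const _ (by simpa using h.holder.symm.pos) (NeZero.ne _)]
    simp
  have := (integral_inner_mul_le h.holder h.V_nonneg h.Γ_nonneg zero_le_one h.aesm_v h.eLpNorm_v
    h.aesm_G h.eLpNorm_G aestronglyMeasurable_const h1).1
  simpa using this.re

/-- The finite sum is the integral of v·G against a trigonometric polynomial, so Hölder and the
embedding bound it by the H¹ norm of the polynomial. This is membership in H⁻¹ in dual form. -/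
lemma norm_sum_mul_conj_le (S : Finset (Fin N → ℤ)) (c : (Fin N → ℤ) → ℂ) :
    ‖∑ k ∈ S, c k * conj (fourierCoef (fun x => inner ℝ (v x) (G x)) k)‖
      ≤ V * Γ * (K * √(∑ k ∈ S, (1 + freqSq k) * ‖c k‖ ^ 2)) := by
  rw [← integral_mul_trig h.integrable]
  exact (integral_inner_mul_le h.holder h.V_nonneg h.Γ_nonneg
    (mul_nonneg h.embeds.1 (Real.sqrt_nonneg _)) h.aesm_v h.eLpNorm_v
    h.aesm_G h.eLpNorm_G (trig S c).continuous.aestronglyMeasurable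
    (eLpNorm_trig_le_h1 h.embeds S c)).2

/-- Test the dual bound with the Riesz representative, whose coefficients are those of v·G divided
by 1 + |k|². It becomes Q ≤ VΓK √Q, and one divides by √Q. -/
lemma sum_norm_sq_le (S : Finset (Fin N → ℤ)) :
    ∑ k ∈ S, (1 + freqSq k)⁻¹ * ‖fourierCoef (fun x => inner ℝ (v x) (G x)) k‖ ^ 2
      ≤ (V * Γ * K) ^ 2 := by
  set F := fourierCoef fun x => inner ℝ (v x) (G x)
  set Q := ∑ k ∈ S, (1 + freqSq k)⁻¹ * ‖F k‖ ^ 2 with hQ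
  have hpos : ∀ k : Fin N → ℤ, 0 < 1 + freqSq k := fun k => by linarith [freqSq_nonneg k]
  have hQ0 : 0 ≤ Q := Finset.sum_nonneg fun k _ => by have := hpos k; positivity
  have h1 := h.norm_sum_mul_conj_le S fun k => ((1 + freqSq k)⁻¹ : ℝ) * F k
  have e1 : ∑ k ∈ S, (((1 + freqSq k)⁻¹ : ℝ) * F k) * conj (F k) = (Q : ℂ) := by
    rw [hQ, Complex.ofReal_sum]
    refine Finset.sum_congr rfl fun k _ => ?_
    rw [mul_assoc, Complex.mul_conj, Complex.normSq_eq_norm_sq]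
    push_cast; ring
  have e2 : ∑ k ∈ S, (1 + freqSq k) * ‖(((1 + freqSq k)⁻¹ : ℝ) : ℂ) * F k‖ ^ 2 = Q := by
    refine Finset.sum_congr rfl fun k _ => ?_
    have := (hpos k).ne'
    rw [norm_mul, Complex.norm_real, mul_pow, Real.norm_eq_abs, sq_abs]
    field_simp
  rw [e1, e2, Complex.norm_real, Real.norm_of_nonneg hQ0] at h1
  have h2 : √Q ≤ V * Γ * K := by
    rcases eq_or_lt_of_le (Real.sqrt_nonneg Q) with h0 | h0
    · rw [← h0]
      exact mul_nonneg (mul_nonneg h.V_nonneg h.Γ_nonneg) h.embeds.1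
    · refine le_of_mul_le_mul_right ?_ h0
      rw [Real.mul_self_sqrt hQ0]
      linarith
  calc Q = √Q ^ 2 := (Real.sq_sqrt hQ0).symm
    _ ≤ _ := by gcongr

lemma integrable_mul {w : L2 N} (hw : MemH1 w) :
    Integrable (fun x => inner ℝ (v x) (G x) * w x) volume ∧
      |∫ x, inner ℝ (v x) (G x) * w x| ≤ V * Γ * (K * √(h1Sq (fourierCoef w))) := by
  have hb : eLpNorm (fun x => (w x : ℂ)) (ENNReal.ofReal s) volume
      ≤ ENNReal.ofReal (K * √(h1Sq (fourierCoef w))) := by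
    rw [← eLpNorm_congr_ae (coeFn_toC w)]
    have := h.embeds.2 (toC w) (by simpa only [mFourierCoeff_toC] using memH1_iff.mp hw)
    simpa only [mFourierCoeff_toC, funext (mFourierCoeff_toC w)] using this
  have h1 := integral_inner_mul_le h.holder h.V_nonneg h.Γ_nonneg
    (mul_nonneg h.embeds.1 (Real.sqrt_nonneg _)) h.aesm_v h.eLpNorm_v h.aesm_G h.eLpNorm_G
    (Complex.continuous_ofReal.comp_aestronglyMeasurable (Lp.aestronglyMeasurable w)) hb
  simp only [← Complex.ofReal_mul] at h1
  refine ⟨by simpa using h1.1.re, ?_⟩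
  have h2 := h1.2
  rwa [integral_complex_ofReal, Complex.norm_real, Real.norm_eq_abs] at h2

/-- The product v·G need not be in L², so Parseval for two L² functions does not apply. Instead, the
error made by truncating `w` is bounded through the trilinear Hölder estimate by the H¹ tail of `w`.
-/
lemma hasSum_mul_conj {w : L2 N} (hw : MemH1 w) :
    HasSum (fun k => fourierCoef w k * conj (fourierCoef (fun x => inner ℝ (v x) (G x)) k))
      ((∫ x, inner ℝ (v x) (G x) * w x : ℝ) : ℂ) := by
  have hlim := tendsto_h1_tail w (V * Γ * K)
  rw [HasSum, SummationFilter.unconditional_filter, tendsto_iff_norm_sub_tendsto_zero]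
  refine squeeze_zero (fun _ => norm_nonneg _) (fun S => ?_) hlim
  have hi2 : Integrable (fun x => ((inner ℝ (v x) (G x) : ℝ) : ℂ) * trig S (fourierCoef w) x)
      volume :=
    (integral_inner_mul_le h.holder h.V_nonneg h.Γ_nonneg
      (mul_nonneg h.embeds.1 (Real.sqrt_nonneg _)) h.aesm_v h.eLpNorm_v
      h.aesm_G h.eLpNorm_G (trig S _).continuous.aestronglyMeasurable
      (eLpNorm_trig_le_h1 h.embeds S _)).1
  have hi1 : Integrable (fun x => ((inner ℝ (v x) (G x) : ℝ) : ℂ) * (w x : ℂ)) volume := by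
    simp only [← Complex.ofReal_mul]
    exact (h.integrable_mul hw).1.ofReal
  have h3 := (integral_inner_mul_le h.holder h.V_nonneg h.Γ_nonneg
    (mul_nonneg h.embeds.1 (Real.sqrt_nonneg _)) h.aesm_v h.eLpNorm_v
    h.aesm_G h.eLpNorm_G
    ((Complex.continuous_ofReal.comp_aestronglyMeasurable (Lp.aestronglyMeasurable w)).sub
      (trig S (fourierCoef w)).continuous.aestronglyMeasurable)
    (eLpNorm_sub_trig_le h.embeds hw S)).2
  rw [norm_sub_rev, ← integral_mul_trig h.integrable, ← integral_complex_ofReal]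
  simp only [Complex.ofReal_mul]
  rw [← integral_sub hi1 hi2]
  simp only [← mul_sub]
  refine h3.trans_eq ?_
  ring

end AdvectionData

/-! ### Smooth functions on the torus -/

/-- Smoothness is stated for the periodic lift, and continuity descends to the torus along a
quotient map. Openness is what makes the product with the time axis a quotient map again. -/
lemma isOpenQuotientMap_toTorus :
    IsOpenQuotientMap fun (y : Fin N → ℝ) (i : Fin N) => (y i : UnitAddCircle) :=
  IsOpenQuotientMap.piMap fun _ => QuotientAddGroup.isOpenQuotientMap_mk

lemma isOpenQuotientMap_prod_toTorus :
    IsOpenQuotientMap fun z : ℝ × (Fin N → ℝ) =>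
      (z.1, (fun i => (z.2 i : UnitAddCircle) : Torus N)) :=
  IsOpenQuotientMap.id.prodMap isOpenQuotientMap_toTorus

lemma toTorus_add_smul_single (y : Fin N → ℝ) (i : Fin N) (s : ℝ) :
    (fun j => (((y + s • Pi.single i (1 : ℝ) : Fin N → ℝ) j : ℝ) : UnitAddCircle))
      = (fun j => (y j : UnitAddCircle)) + Pi.single i (s : UnitAddCircle) := by
  ext j
  by_cases h : j = i
  · subst h; simp
  · simp [h]

/-- `φ` is smooth on `ℝ × 𝕋^N`. -/
def SmoothInTimeSpace (φ : ℝ → Torus N → ℝ) : Prop :=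
  ContDiff ℝ ∞ fun z : ℝ × (Fin N → ℝ) => φ z.1 fun i => (z.2 i : UnitAddCircle)

namespace SmoothInTimeSpace

variable {φ : ℝ → Torus N → ℝ} (h : SmoothInTimeSpace φ)
include h

lemma continuous : Continuous fun z : ℝ × Torus N => φ z.1 z.2 :=
  isOpenQuotientMap_prod_toTorus.isQuotientMap.continuous_iff.mpr (ContDiff.continuous h)

lemma continuous_slice (t : ℝ) : Continuous (φ t) :=
  h.continuous.comp (Continuous.prodMk_right t)

lemma hasDerivAt_time_lift (t : ℝ) (y : Fin N → ℝ) :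
    HasDerivAt (fun s => φ s fun i => (y i : UnitAddCircle))
      (fderiv ℝ (fun z : ℝ × (Fin N → ℝ) => φ z.1 fun i => (z.2 i : UnitAddCircle)) (t, y) (1, 0))
      t := by
  have h1 := (h.differentiable (by simp)).differentiableAt (x := (t, y)) |>.hasFDerivAt
  have h2 : HasDerivAt (fun s : ℝ => (s, y)) (1, 0) t :=
    (hasDerivAt_id t).prodMk (hasDerivAt_const t y)
  exact h1.comp_hasDerivAt t h2

lemma hasDerivAt_time (t : ℝ) (x : Torus N) :
    HasDerivAt (fun s => φ s x) (deriv (fun s => φ s x) t) t := by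
  obtain ⟨y, rfl⟩ := isOpenQuotientMap_toTorus.surjective x
  exact (h.hasDerivAt_time_lift t y).differentiableAt.hasDerivAt

lemma continuous_deriv_time :
    Continuous fun z : ℝ × Torus N => deriv (fun s => φ s z.2) z.1 := by
  rw [isOpenQuotientMap_prod_toTorus.isQuotientMap.continuous_iff]
  have h1 := (h.continuous_fderiv (by simp)).clm_apply
    (continuous_const (y := ((1 : ℝ), (0 : Fin N → ℝ))))
  refine h1.congr fun z => ?_
  exact (h.hasDerivAt_time_lift z.1 z.2).deriv.symm

lemma hasDerivAt_space_lift (t : ℝ) (y : Fin N → ℝ) (i : Fin N) :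
    HasDerivAt (fun s : ℝ => φ t ((fun j => (y j : UnitAddCircle)) +
        Pi.single i (s : UnitAddCircle)))
      (fderiv ℝ (fun z : ℝ × (Fin N → ℝ) => φ z.1 fun i => (z.2 i : UnitAddCircle)) (t, y)
        (0, Pi.single i 1)) 0 := by
  have h1 : HasFDerivAt (fun z : ℝ × (Fin N → ℝ) => φ z.1 fun i => (z.2 i : UnitAddCircle))
      (fderiv ℝ (fun z : ℝ × (Fin N → ℝ) => φ z.1 fun i => (z.2 i : UnitAddCircle)) (t, y))
      (t, y + (0 : ℝ) • Pi.single i (1 : ℝ)) := by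
    rw [zero_smul, add_zero]
    exact (h.differentiable (by simp)).differentiableAt.hasFDerivAt
  have h2 : HasDerivAt (fun s : ℝ => (t, y + s • Pi.single i (1 : ℝ)))
      (0, Pi.single i (1 : ℝ)) 0 := by
    refine (hasDerivAt_const _ t).prodMk ?_
    simpa using ((hasDerivAt_id (0 : ℝ)).smul_const (Pi.single i (1 : ℝ) : Fin N → ℝ)).const_add y
  have h3 := h1.comp_hasDerivAt (0 : ℝ) h2
  refine h3.congr_of_eventuallyEq (Eventually.of_forall fun s => ?_)
  simp only [Function.comp_apply]
  rw [← toTorus_add_smul_single]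

lemma classicalGrad_lift (t : ℝ) (y : Fin N → ℝ) (i : Fin N) :
    classicalGrad (φ t) (fun j => (y j : UnitAddCircle)) i
      = fderiv ℝ (fun z : ℝ × (Fin N → ℝ) => φ z.1 fun i => (z.2 i : UnitAddCircle)) (t, y)
        (0, Pi.single i 1) :=
  (h.hasDerivAt_space_lift t y i).deriv

lemma continuous_classicalGrad_apply (i : Fin N) :
    Continuous fun z : ℝ × Torus N => classicalGrad (φ z.1) z.2 i := by
  rw [isOpenQuotientMap_prod_toTorus.isQuotientMap.continuous_iff]
  have h1 := (h.continuous_fderiv (by simp)).clm_apply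
    (continuous_const (y := ((0 : ℝ), (Pi.single i 1 : Fin N → ℝ))))
  refine h1.congr fun z => ?_
  exact (h.classicalGrad_lift z.1 z.2 i).symm

/-- `classicalGrad` differentiates at parameter 0 only; shifting the base point along the circle
gives the derivative at every parameter. -/
lemma hasDerivAt_space (t : ℝ) (x : Torus N) (i : Fin N) (s : ℝ) :
    HasDerivAt (fun s : ℝ => φ t (x + Pi.single i (s : UnitAddCircle)))
      (classicalGrad (φ t) (x + Pi.single i (s : UnitAddCircle)) i) s := by
  obtain ⟨y, hy⟩ := isOpenQuotientMap_toTorus.surjective (x + Pi.single i (s : UnitAddCircle))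
  have h1 := h.hasDerivAt_space_lift t y i
  rw [← h.classicalGrad_lift t y i,
    show (fun j => (y j : UnitAddCircle)) = x + Pi.single i (s : UnitAddCircle) from hy] at h1
  have h2 : HasDerivAt (fun r : ℝ => r - s) 1 s := (hasDerivAt_id s).sub_const s
  have h3 := HasDerivAt.comp_of_eq s h1 h2 (sub_self s).symm
  rw [mul_one] at h3
  refine h3.congr_of_eventuallyEq (Eventually.of_forall fun r => ?_)
  simp only [Function.comp_apply]
  rw [add_assoc, ← Pi.single_add, AddCircle.coe_sub, add_sub_cancel]

end SmoothInTimeSpace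

lemma SmoothOnTorus.smoothInTimeSpace {ψ : Torus N → ℝ} (h : SmoothOnTorus ψ) :
    SmoothInTimeSpace fun _ => ψ :=
  ContDiff.comp (g := fun y : Fin N → ℝ => ψ fun i => (y i : UnitAddCircle)) h contDiff_snd

lemma SmoothInTimeSpace.smoothOnTorus {φ : ℝ → Torus N → ℝ} (h : SmoothInTimeSpace φ) (t : ℝ) :
    SmoothOnTorus (φ t) :=
  ContDiff.comp (g := fun z : ℝ × (Fin N → ℝ) => φ z.1 fun i => (z.2 i : UnitAddCircle)) h
    (contDiff_prodMk_right t)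

lemma mFourier_add_apply (k : Fin N → ℤ) (x y : Torus N) :
    UnitAddTorus.mFourier k (x + y) = UnitAddTorus.mFourier k x * UnitAddTorus.mFourier k y := by
  simp only [UnitAddTorus.mFourier, ContinuousMap.coe_mk, Pi.add_apply, fourier_apply, smul_add,
    AddCircle.toCircle_add, Circle.coe_mul, Finset.prod_mul_distrib]

lemma mFourier_single_apply (k : Fin N → ℤ) (i : Fin N) (s : ℝ) :
    UnitAddTorus.mFourier k (Pi.single i (s : UnitAddCircle))
      = Complex.exp (2 * Real.pi * Complex.I * k i * s) := by
  simp only [UnitAddTorus.mFourier, ContinuousMap.coe_mk]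
  rw [Finset.prod_eq_single i]
  · rw [Pi.single_eq_same, fourier_coe_apply]; simp
  · intro j _ hj
    rw [Pi.single_eq_of_ne hj, fourier_eval_zero]
  · simp

lemma hasDerivAt_mFourier (k : Fin N → ℤ) (x : Torus N) (i : Fin N) (s : ℝ) :
    HasDerivAt (fun s : ℝ => UnitAddTorus.mFourier k (x + Pi.single i (s : UnitAddCircle)))
      (2 * Real.pi * Complex.I * k i *
        UnitAddTorus.mFourier k (x + Pi.single i (s : UnitAddCircle))) s := by
  simp only [mFourier_add_apply, mFourier_single_apply]
  have h1 : HasDerivAt (fun s : ℝ => 2 * Real.pi * Complex.I * k i * (s : ℂ))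
      (2 * Real.pi * Complex.I * k i) s := by
    simpa using (Complex.ofRealCLM.hasDerivAt (x := s)).const_mul
      (2 * Real.pi * Complex.I * k i : ℂ)
  convert! (h1.cexp.const_mul (UnitAddTorus.mFourier k x)) using 1
  ring

/-- The integral of a partial derivative over the torus vanishes. -/
lemma integral_partial_eq_zero {g g' : Torus N → ℂ} (hg : Continuous g) (hg' : Continuous g')
    (i : Fin N)
    (hd : ∀ (x : Torus N) (s : ℝ), HasDerivAt (fun s : ℝ => g (x + Pi.single i (s : UnitAddCircle)))
      (g' (x + Pi.single i (s : UnitAddCircle))) s) :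
    ∫ x, g' x = 0 := by
  obtain ⟨C, hC⟩ := isCompact_univ.exists_bound_of_continuousOn (f := g') hg'.continuousOn
  have hint : ∀ {f : Torus N → ℂ}, Continuous f → Integrable f volume := fun hf =>
    hf.integrable_of_hasCompactSupport (HasCompactSupport.of_compactSpace _)
  have hs : ∀ s : ℝ, Continuous fun x : Torus N => x + Pi.single i (s : UnitAddCircle) :=
    fun s => continuous_add_const _
  have hm : ∀ (f : Torus N → ℂ) (s : ℝ), Continuous f → AEStronglyMeasurable
      (fun x : Torus N => f (x + Pi.single i (s : UnitAddCircle))) volume := fun f s hf =>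
    (hf.comp (hs s)).aestronglyMeasurable
  -- Differentiate the integral of the translate g(x + s eᵢ) under the integral sign. By translation
  -- invariance it does not depend on s, so its derivative vanishes.
  have h1 := (hasDerivAt_integral_of_dominated_loc_of_deriv_le (μ := (volume : Measure (Torus N)))
    (F := fun (s : ℝ) (x : Torus N) => g (x + Pi.single i (s : UnitAddCircle)))
    (F' := fun (s : ℝ) (x : Torus N) => g' (x + Pi.single i (s : UnitAddCircle)))
    (x₀ := (0 : ℝ)) (bound := fun _ => C) (s := univ) univ_mem
    (Eventually.of_forall fun s => hm g s hg)
    (hint (hg.comp (hs 0))) (hm g' 0 hg')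
    (ae_of_all _ fun x s _ => hC _ (mem_univ _)) (integrable_const _)
    (ae_of_all _ fun x s _ => hd x s)).2
  simp only [integral_add_right_eq_self] at h1
  exact h1.unique (hasDerivAt_const _ _)

/-- Integration by parts: the integral of ∂ᵢ(e_{-k} ψ) vanishes, and the product rule splits it into
the two coefficients. -/
lemma fourierCoef_classicalGrad {ψ : Torus N → ℝ} (hψ : SmoothOnTorus ψ) (i : Fin N)
    (k : Fin N → ℤ) :
    fourierCoef (fun x => classicalGrad ψ x i) k
      = 2 * (Real.pi : ℂ) * Complex.I * (k i : ℂ) * fourierCoef ψ k := by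
  have h := hψ.smoothInTimeSpace
  have hcg : Continuous fun x => classicalGrad ψ x i :=
    (h.continuous_classicalGrad_apply i).comp (Continuous.prodMk_right (0 : ℝ))
  have hc : Continuous ψ := h.continuous_slice 0
  have he : ∀ k : Fin N → ℤ, Continuous (UnitAddTorus.mFourier k) := fun k =>
    (UnitAddTorus.mFourier k).continuous
  have h0 := integral_partial_eq_zero (i := i)
    (g := fun x => UnitAddTorus.mFourier (-k) x * (ψ x : ℂ))
    (g' := fun x => 2 * Real.pi * Complex.I * ((-k) i : ℤ) * UnitAddTorus.mFourier (-k) x * (ψ x : ℂ)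
      + UnitAddTorus.mFourier (-k) x * (classicalGrad ψ x i : ℂ))
    ((he _).mul (Complex.continuous_ofReal.comp hc))
    (((continuous_const.mul (he _)).mul (Complex.continuous_ofReal.comp hc)).add
      ((he _).mul (Complex.continuous_ofReal.comp hcg)))
    (fun x s => (hasDerivAt_mFourier (-k) x i s).mul (h.hasDerivAt_space 0 x i s).ofReal_comp)
  have hint : ∀ {f : Torus N → ℂ}, Continuous f → Integrable f volume := fun hf =>
    hf.integrable_of_hasCompactSupport (HasCompactSupport.of_compactSpace _)
  have i1 : Integrable (fun x => 2 * Real.pi * Complex.I * ((-k) i : ℤ) *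
      UnitAddTorus.mFourier (-k) x * (ψ x : ℂ)) volume :=
    hint ((continuous_const.mul (he _)).mul (Complex.continuous_ofReal.comp hc))
  have i2 : Integrable (fun x => UnitAddTorus.mFourier (-k) x * (classicalGrad ψ x i : ℂ))
      volume := hint ((he _).mul (Complex.continuous_ofReal.comp hcg))
  rw [integral_add i1 i2] at h0
  simp only [mul_assoc, integral_const_mul] at h0
  simp only [fourierCoef, UnitAddTorus.mFourierCoeff, smul_eq_mul]
  simp only [Pi.neg_apply, Int.cast_neg] at h0
  linear_combination h0

lemma smoothOnTorus_memLp {ψ : Torus N → ℝ} (hψ : SmoothOnTorus ψ) : MemLp ψ 2 volume :=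
  (hψ.smoothInTimeSpace.continuous_slice 0).memLp_of_hasCompactSupport
    (HasCompactSupport.of_compactSpace _)

lemma memLp_classicalGrad_apply {ψ : Torus N → ℝ} (hψ : SmoothOnTorus ψ) (i : Fin N) :
    MemLp (fun x => classicalGrad ψ x i) 2 volume :=
  ((hψ.smoothInTimeSpace.continuous_classicalGrad_apply i).comp
    (Continuous.prodMk_right (0 : ℝ))).memLp_of_hasCompactSupport
    (HasCompactSupport.of_compactSpace _)

/-- Parseval's identity for the `H¹` norm of a smooth function. -/
lemma hasSum_h1_of_smooth {ψ : Torus N → ℝ} (hψ : SmoothOnTorus ψ) :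
    HasSum (fun k => (1 + freqSq k) * ‖fourierCoef ψ k‖ ^ 2)
      ((∫ x, ψ x ^ 2) + (4 * Real.pi ^ 2)⁻¹ * ∑ i, ∫ x, classicalGrad ψ x i ^ 2) := by
  have h1 := hasSum_norm_sq_fourierCoef (smoothOnTorus_memLp hψ)
  have h2 := hasSum_sum (s := Finset.univ)
    fun i _ => hasSum_norm_sq_fourierCoef (memLp_classicalGrad_apply hψ i)
  convert! h1.add (h2.mul_left (4 * Real.pi ^ 2)⁻¹) using 1
  ext k
  simp only [fourierCoef_classicalGrad hψ, norm_gradSymbol_sq]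
  rw [← Finset.sum_mul, ← Finset.mul_sum]
  have := Real.pi_ne_zero
  change _ = _ + _ * (_ * freqSq k * _)
  field_simp

lemma memH1_of_smooth {ψ : Torus N → ℝ} (hψ : SmoothOnTorus ψ) : MemH1 ψ :=
  memH1_iff.mpr (hasSum_h1_of_smooth hψ).summable

/-! ### Incompressibility -/

lemma smoothOnTorus_re_trig (S : Finset (Fin N → ℤ)) (c : (Fin N → ℤ) → ℂ) :
    SmoothOnTorus fun x => (trig S c x).re := by
  have h : ContDiff ℝ ∞ fun y : Fin N → ℝ => ∑ k ∈ S, c k *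
      ∏ j, Complex.exp (2 * Real.pi * Complex.I * k j * ((y j : ℝ) : ℂ)) := by
    refine ContDiff.sum fun k _ => contDiff_const.mul (contDiff_prod fun j _ => ?_)
    exact (contDiff_const.mul (Complex.ofRealCLM.contDiff.comp (contDiff_apply ℝ ℝ j))).cexp
  have h' := Complex.reCLM.contDiff.comp h
  rw [SmoothOnTorus]
  convert! h' using 2 with y
  simp only [Function.comp_apply, Complex.reCLM_apply, trig_apply, UnitAddTorus.mFourier,
    ContinuousMap.coe_mk, fourier_coe_apply, Complex.ofReal_one, div_one]

lemma classicalGrad_re_trig (S : Finset (Fin N → ℤ)) (c : (Fin N → ℤ) → ℂ) (x : Torus N)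
    (i : Fin N) :
    classicalGrad (fun x => (trig S c x).re) x i
      = (trig S (fun k => 2 * (Real.pi : ℂ) * Complex.I * (k i : ℂ) * c k) x).re := by
  have h1 : HasDerivAt (fun s : ℝ => trig S c (x + Pi.single i (s : UnitAddCircle)))
      (trig S (fun k => 2 * (Real.pi : ℂ) * Complex.I * (k i : ℂ) * c k) x) 0 := by
    simp only [trig_apply]
    convert! HasDerivAt.fun_sum fun k _ => (hasDerivAt_mFourier k x i 0).const_mul (c k) using 1
    refine Finset.sum_congr rfl fun k _ => ?_
    rw [AddCircle.coe_zero, Pi.single_zero, add_zero]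
    ring
  exact (Complex.reCLM.hasFDerivAt.comp_hasDerivAt (0 : ℝ) h1).deriv

lemma SmoothOnTorus.classicalGrad_sq {ψ : Torus N → ℝ} (hψ : SmoothOnTorus ψ) (x : Torus N) :
    classicalGrad (fun x => ψ x ^ 2) x = (2 * ψ x) • classicalGrad ψ x := by
  ext i
  have h1 := (hψ.smoothInTimeSpace.hasDerivAt_space 0 x i 0).fun_pow 2
  rw [AddCircle.coe_zero, Pi.single_zero, add_zero] at h1
  refine h1.deriv.trans ?_
  simp

/-- Test the divergence condition with ψ², whose gradient is 2ψ∇ψ. -/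
lemma integral_inner_classicalGrad_mul_self {v : Torus N → Vec N}
    (hdiv : ∀ ψ : Torus N → ℝ, SmoothOnTorus ψ → ∫ x, inner ℝ (v x) (classicalGrad ψ x) = 0)
    {ψ : Torus N → ℝ} (hψ : SmoothOnTorus ψ) :
    ∫ x, inner ℝ (v x) (classicalGrad ψ x) * ψ x = 0 := by
  have h := hdiv (fun x => ψ x ^ 2) (ContDiff.pow hψ 2)
  simp only [hψ.classicalGrad_sq, inner_smul_right, mul_assoc, integral_const_mul] at h
  simpa [mul_comm] using h

lemma eLpNorm_le_sum_apply {f : Torus N → Vec N}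
    (hf : ∀ i, AEStronglyMeasurable (fun x => f x i) volume) :
    eLpNorm f 2 volume ≤ ∑ i, eLpNorm (fun x => f x i) 2 volume := by
  have h1 : eLpNorm f 2 volume ≤ eLpNorm (∑ i, fun x => ‖f x i‖) 2 volume := by
    refine eLpNorm_mono_real fun x => ?_
    rw [Finset.sum_apply, EuclideanSpace.norm_eq]
    exact Real.sqrt_le_iff.mpr ⟨Finset.sum_nonneg fun _ _ => norm_nonneg _,
      Finset.sum_sq_le_sq_sum_of_nonneg fun _ _ => norm_nonneg _⟩
  refine h1.trans ((eLpNorm_sum_le (fun i _ => (hf i).norm) (by norm_num)).trans_eq ?_)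
  exact Finset.sum_congr rfl fun i _ => eLpNorm_norm _

/-- In each component the error is the real part of the tail of an L² convergent Fourier series.
This provides smooth approximations of `w` for which orthogonality is already known. -/
lemma tendsto_eLpNorm_grad_sub {w : L2 N} (hw : MemH1 w) :
    Tendsto (fun S : Finset (Fin N → ℤ) => eLpNorm (fun x => grad w x
      - classicalGrad (fun x => (trig S (fourierCoef w) x).re) x) 2 volume) atTop (𝓝 0) := by
  have hb : ∀ (S : Finset (Fin N → ℤ)) (i : Fin N),
      (fun x => grad w x i - classicalGrad (fun x => (trig S (fourierCoef w) x).re) x i)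
        =ᵐ[volume] Complex.reCLM.compLp
        ((∑' k, (2 * (Real.pi : ℂ) * Complex.I * (k i : ℂ) * fourierCoef w k) •
            UnitAddTorus.mFourierLp (d := Fin N) 2 k)
          - ∑ k ∈ S, (2 * (Real.pi : ℂ) * Complex.I * (k i : ℂ) * fourierCoef w k) •
            UnitAddTorus.mFourierLp (d := Fin N) 2 k) := by
    intro S i
    set X := ∑' k, (2 * (Real.pi : ℂ) * Complex.I * (k i : ℂ) * fourierCoef w k) •
            UnitAddTorus.mFourierLp (d := Fin N) 2 k with hX
    set Y := ∑ k ∈ S, (2 * (Real.pi : ℂ) * Complex.I * (k i : ℂ) * fourierCoef w k) •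
            UnitAddTorus.mFourierLp (d := Fin N) 2 k with hY
    have hg : (fun x => grad w x i) =ᵐ[volume] fun x => (X x).re :=
      Complex.reCLM.coeFn_compLp X
    filter_upwards [hg, Complex.reCLM.coeFn_compLp (X - Y), Lp.coeFn_sub X Y,
      coeFn_sum_mFourierLp S fun k => 2 * (Real.pi : ℂ) * Complex.I * (k i : ℂ) * fourierCoef w k]
      with x h1 h2 h3 h4
    rw [h2, h3, Pi.sub_apply, hY, h4, Complex.reCLM_apply, Complex.sub_re, ← h1,
      classicalGrad_re_trig]
  have hi : ∀ i : Fin N, Tendsto (fun S : Finset (Fin N → ℤ) => eLpNorm (fun x => grad w x i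
      - classicalGrad (fun x => (trig S (fourierCoef w) x).re) x i) 2 volume) atTop (𝓝 0) := by
    intro i
    have hs := (summable_smul_mFourierLp (hw.summable_gradSymbol i)).hasSum
    have h1 := ((tendsto_const_nhds (x := ∑' k, (2 * (Real.pi : ℂ) * Complex.I * (k i : ℂ) *
      fourierCoef w k) • UnitAddTorus.mFourierLp (d := Fin N) 2 k)).sub hs).norm
    rw [sub_self, norm_zero] at h1
    have h2 := (ENNReal.continuous_ofReal.tendsto 0).comp h1
    rw [ENNReal.ofReal_zero] at h2
    refine tendsto_of_tendsto_of_tendsto_of_le_of_le tendsto_const_nhds h2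
      (fun _ => zero_le) (fun S => ?_)
    rw [Function.comp_apply, eLpNorm_congr_ae (hb S i),
      ← ENNReal.ofReal_toReal (Lp.eLpNorm_ne_top _), ← Lp.norm_def]
    refine ENNReal.ofReal_le_ofReal ((Complex.reCLM.norm_compLp_le _).trans ?_)
    rw [Complex.reCLM_norm, one_mul]
  have hsum := tendsto_finsetSum Finset.univ fun i _ => hi i
  rw [Finset.sum_const_zero] at hsum
  refine tendsto_of_tendsto_of_tendsto_of_le_of_le tendsto_const_nhds hsum
    (fun _ => zero_le) (fun S => ?_)
  have hm : ∀ i : Fin N, AEStronglyMeasurable (fun x => grad w x i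
      - classicalGrad (fun x => (trig S (fourierCoef w) x).re) x i) volume := fun i =>
    ((memLp_grad_apply w i).sub
      (memLp_classicalGrad_apply (smoothOnTorus_re_trig S _) i)).aestronglyMeasurable
  exact eLpNorm_le_sum_apply hm

/-- The advection term is orthogonal to the transported function. -/
lemma AdvectionData.integral_mul_self {q s V Γ K : ℝ} {v : Torus N → Vec N} {w : L2 N}
    (h : AdvectionData q s v (grad w) V Γ K)
    (hdiv : ∀ ψ : Torus N → ℝ, SmoothOnTorus ψ → ∫ x, inner ℝ (v x) (classicalGrad ψ x) = 0)
    (hw : MemH1 w) : ∫ x, inner ℝ (v x) (grad w x) * w x = 0 := by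
  set Gs : Finset (Fin N → ℤ) → Torus N → Vec N := fun S x => grad w x
      - classicalGrad (fun x => (trig S (fourierCoef w) x).re) x with hGs
  have hcg : ∀ S : Finset (Fin N → ℤ), MemLp
      (classicalGrad (fun x => (trig S (fourierCoef w) x).re)) 2 volume := fun S =>
    MemLp.of_eval_piLp fun i => memLp_classicalGrad_apply (smoothOnTorus_re_trig S _) i
  have hGm : ∀ S, MemLp (Gs S) 2 volume := fun S => (memLp_grad w).sub (hcg S)
  have hdata : ∀ S, AdvectionData q s v (Gs S) V (eLpNorm (Gs S) 2 volume).toReal K := fun S =>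
    { h with
      Γ_nonneg := ENNReal.toReal_nonneg
      aesm_G := (hGm S).aestronglyMeasurable
      eLpNorm_G := (ENNReal.ofReal_toReal (hGm S).eLpNorm_ne_top).ge }
  have hdata' : ∀ S, AdvectionData q s v (classicalGrad fun x => (trig S (fourierCoef w) x).re) V
      (eLpNorm (classicalGrad fun x => (trig S (fourierCoef w) x).re) 2 volume).toReal K := fun S =>
    { h with
      Γ_nonneg := ENNReal.toReal_nonneg
      aesm_G := (hcg S).aestronglyMeasurable
      eLpNorm_G := (ENNReal.ofReal_toReal (hcg S).eLpNorm_ne_top).ge }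
  have hint : ∀ {G : Torus N → Vec N} {Γ : ℝ} (S), AdvectionData q s v G V Γ K →
      Integrable (fun x => ((inner ℝ (v x) (G x) : ℝ) : ℂ) * trig S (fourierCoef w) x) volume ∧
      ‖∫ x, ((inner ℝ (v x) (G x) : ℝ) : ℂ) * trig S (fourierCoef w) x‖
        ≤ V * Γ * (K * √(h1Sq (fourierCoef w))) := by
    intro G Γ S hd
    refine integral_inner_mul_le hd.holder hd.V_nonneg hd.Γ_nonneg
      (mul_nonneg hd.embeds.1 (Real.sqrt_nonneg _)) hd.aesm_v hd.eLpNorm_v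
      hd.aesm_G hd.eLpNorm_G (trig S _).continuous.aestronglyMeasurable
      ((eLpNorm_trig_le_h1 hd.embeds S _).trans (ENNReal.ofReal_le_ofReal ?_))
    have := hd.embeds.1
    gcongr
    refine (memH1_iff.mp hw).sum_le_tsum S fun k _ => ?_
    have := freqSq_nonneg k
    positivity
  have hre : ∀ {F : Torus N → ℝ} (S), Integrable (fun x => (F x : ℂ) * trig S (fourierCoef w) x)
      volume → (∫ x, (F x : ℂ) * trig S (fourierCoef w) x).re
        = ∫ x, F x * (trig S (fourierCoef w) x).re := by
    intro F S hF
    have := integral_re hF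
    simp only [RCLike.re_to_complex, Complex.re_ofReal_mul] at this
    exact this.symm
  have hF : Integrable (fun x => inner ℝ (v x) (grad w x)) volume := h.integrable
  -- Only the second factor is truncated here; Parseval for the H⁻¹–H¹ pairing identifies the limit.
  have hlim : Tendsto (fun S => (∫ x, ((inner ℝ (v x) (grad w x) : ℝ) : ℂ)
      * trig S (fourierCoef w) x).re) atTop (𝓝 (∫ x, inner ℝ (v x) (grad w x) * w x)) := by
    simp only [integral_mul_trig hF]
    exact (Complex.continuous_re.tendsto _).comp (h.hasSum_mul_conj hw)
  refine tendsto_nhds_unique hlim ?_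
  have hz : Tendsto (fun S => V * (eLpNorm (Gs S) 2 volume).toReal
      * (K * √(h1Sq (fourierCoef w)))) atTop (𝓝 0) := by
    have := (ENNReal.tendsto_toReal ENNReal.zero_ne_top).comp (tendsto_eLpNorm_grad_sub hw)
    simpa using (this.const_mul V).mul_const (K * √(h1Sq (fourierCoef w)))
  refine squeeze_zero_norm (fun S => ?_) hz
  -- With ψ the truncation of `w`, the integral of (v·∇ψ)ψ is zero and may be subtracted. Only v·(∇w
  -- - ∇ψ) remains against ψ, and the L² norm of ∇w - ∇ψ tends to 0.
  have key : (∫ x, ((inner ℝ (v x) (grad w x) : ℝ) : ℂ) * trig S (fourierCoef w) x).re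
      = (∫ x, ((inner ℝ (v x) (Gs S x) : ℝ) : ℂ) * trig S (fourierCoef w) x).re := by
    have e1 := hre S (hint S (hdata' S)).1
    rw [integral_inner_classicalGrad_mul_self hdiv (smoothOnTorus_re_trig S _)] at e1
    rw [← sub_zero (∫ x, ((inner ℝ (v x) (grad w x) : ℝ) : ℂ) * trig S (fourierCoef w) x).re,
      ← e1, ← Complex.sub_re, ← integral_sub (hint S h).1 (hint S (hdata' S)).1]
    congr 2
    ext x
    simp only [hGs, inner_sub_right]
    push_cast
    ring
  rw [key]
  exact (Complex.abs_re_le_norm _).trans (hint S (hdata S)).2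

/-! ### Fourier coefficients of test functions -/

namespace SmoothInTimeSpace

variable {φ : ℝ → Torus N → ℝ} (h : SmoothInTimeSpace φ)
include h

lemma hasDerivAt_fourierCoef (k : Fin N → ℤ) (t : ℝ) :
    HasDerivAt (fun t => fourierCoef (φ t) k)
      (fourierCoef (fun x => deriv (fun s => φ s x) t) k) t := by
  obtain ⟨C, hC⟩ := ((isCompact_Icc (a := t - 1) (b := t + 1)).prod
    (isCompact_univ (X := Torus N))).exists_bound_of_continuousOn
    h.continuous_deriv_time.continuousOn
  have he := (UnitAddTorus.mFourier (d := Fin N) (-k)).continuous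
  have hφ : ∀ t, Continuous fun x => UnitAddTorus.mFourier (-k) x • (φ t x : ℂ) := fun t =>
    he.smul (Complex.continuous_ofReal.comp (h.continuous_slice t))
  have hφ' : Continuous fun x => UnitAddTorus.mFourier (-k) x
      • ((deriv (fun s => φ s x) t : ℝ) : ℂ) :=
    he.smul (Complex.continuous_ofReal.comp
      (h.continuous_deriv_time.comp (Continuous.prodMk_right t)))
  exact (hasDerivAt_integral_of_dominated_loc_of_deriv_le (μ := (volume : Measure (Torus N)))
    (F := fun (t : ℝ) (x : Torus N) => UnitAddTorus.mFourier (-k) x • (φ t x : ℂ))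
    (F' := fun (t : ℝ) (x : Torus N) => UnitAddTorus.mFourier (-k) x
      • ((deriv (fun s => φ s x) t : ℝ) : ℂ))
    (x₀ := t) (bound := fun _ => C) (Icc_mem_nhds (by linarith : t - 1 < t) (by linarith : t < t + 1))
    (Eventually.of_forall fun s => (hφ s).aestronglyMeasurable)
    ((hφ t).integrable_of_hasCompactSupport (HasCompactSupport.of_compactSpace _))
    hφ'.aestronglyMeasurable
    (ae_of_all _ fun x s hs => by
      rw [norm_smul, norm_mFourier_apply, one_mul, Complex.norm_real]
      exact hC (s, x) ⟨hs, mem_univ _⟩) (integrable_const _)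
    (ae_of_all _ fun x s _ => ((h.hasDerivAt_time s x).ofReal_comp).const_smul
      (UnitAddTorus.mFourier (-k) x))).2

end SmoothInTimeSpace

lemma continuous_fourierCoef_of_continuous {f : ℝ → Torus N → ℝ}
    (hf : Continuous fun z : ℝ × Torus N => f z.1 z.2) (k : Fin N → ℤ) :
    Continuous fun t => fourierCoef (f t) k := by
  have h1 : Continuous (fun z : ℝ × Torus N =>
      UnitAddTorus.mFourier (-k) z.2 • (f z.1 z.2 : ℂ)) :=
    ((UnitAddTorus.mFourier (-k)).continuous.comp continuous_snd).smul
      (Complex.continuous_ofReal.comp hf)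
  have := continuous_parametric_integral_of_continuous (μ := (volume : Measure (Torus N)))
    (f := fun (t : ℝ) (x : Torus N) => UnitAddTorus.mFourier (-k) x • (f t x : ℂ)) h1 isCompact_univ
  rw [Measure.restrict_univ] at this
  exact this

lemma exists_bound_of_continuous {f : ℝ → Torus N → ℝ}
    (hf : Continuous fun z : ℝ × Torus N => f z.1 z.2) (T : ℝ) :
    ∃ M, ∀ t ∈ Icc 0 T, ∀ x, |f t x| ≤ M := by
  obtain ⟨C, hC⟩ := ((isCompact_Icc (a := (0 : ℝ)) (b := T)).prod
    (isCompact_univ (X := Torus N))).exists_bound_of_continuousOn hf.continuousOn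
  exact ⟨C, fun t ht x => hC (t, x) ⟨ht, mem_univ _⟩⟩

lemma integral_sq_le_of_bound {f : Torus N → ℝ} {M : ℝ} (hM : ∀ x, |f x| ≤ M) :
    ∫ x, f x ^ 2 ≤ M ^ 2 := by
  have h1 : ∀ x, f x ^ 2 ≤ M ^ 2 := fun x => by
    rw [← sq_abs]
    exact pow_le_pow_left₀ (abs_nonneg _) (hM x) 2
  have := norm_integral_le_of_norm_le_const (μ := (volume : Measure (Torus N)))
    (f := fun x => f x ^ 2) (C := M ^ 2) (ae_of_all _ fun x => by
      rw [Real.norm_of_nonneg (sq_nonneg _)]; exact h1 x)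
  simpa using (le_abs_self _).trans this

lemma SmoothInTimeSpace.exists_h1Sq_bound {φ : ℝ → Torus N → ℝ} (h : SmoothInTimeSpace φ)
    (T : ℝ) : ∃ M, ∀ t ∈ Icc 0 T, h1Sq (fourierCoef (φ t)) ≤ M := by
  obtain ⟨M, hM⟩ := exists_bound_of_continuous h.continuous T
  choose M' hM' using fun i => exists_bound_of_continuous
    (f := fun t x => classicalGrad (φ t) x i) (h.continuous_classicalGrad_apply i) T
  refine ⟨M ^ 2 + (4 * Real.pi ^ 2)⁻¹ * ∑ i, M' i ^ 2, fun t ht => ?_⟩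
  rw [h1Sq, (hasSum_h1_of_smooth (h.smoothOnTorus t)).tsum_eq]
  have h1 : ∀ i, ∫ x, classicalGrad (φ t) x i ^ 2 ≤ M' i ^ 2 := fun i =>
    integral_sq_le_of_bound (hM' i t ht)
  have h2 := integral_sq_le_of_bound (hM t ht)
  gcongr with i
  exact h1 i

/-! ### Absolutely continuous complex-valued functions of time -/

/-- `f` is a primitive of the integrable function `f'` on `[a, b]`. -/
structure IsPrimitiveOn {E : Type*} [NormedAddCommGroup E] [NormedSpace ℝ E] (f f' : ℝ → E)
    (a b : ℝ) : Prop where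
  intervalIntegrable : IntervalIntegrable f' volume a b
  eq_add_integral : ∀ t ∈ Icc a b, f t = f a + ∫ τ in a..t, f' τ

namespace IsPrimitiveOn

section

variable {E : Type*} [NormedAddCommGroup E] [NormedSpace ℝ E]
  {f f' : ℝ → E} {a b : ℝ}

lemma continuousOn (h : IsPrimitiveOn f f' a b) (hab : a ≤ b) : ContinuousOn f (Icc a b) := by
  have h1 : ContinuousOn (fun t => f a + ∫ τ in a..t, f' τ) (Icc a b) := by
    have := intervalIntegral.continuousOn_primitive_interval' h.intervalIntegrable
      (left_mem_uIcc)
    rw [uIcc_of_le hab] at this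
    exact continuousOn_const.add this
  exact h1.congr h.eq_add_integral

lemma mono (h : IsPrimitiveOn f f' a b) {c d : ℝ} (hac : a ≤ c) (hcd : c ≤ d) (hdb : d ≤ b) :
    IsPrimitiveOn f f' c d where
  intervalIntegrable := h.intervalIntegrable.mono_set (by
    rw [uIcc_of_le hcd, uIcc_of_le (hac.trans (hcd.trans hdb))]
    exact Icc_subset_Icc hac hdb)
  eq_add_integral := fun t ht => by
    have hi : ∀ {x y : ℝ}, a ≤ x → x ≤ y → y ≤ b → IntervalIntegrable f' volume x y :=
      fun h1 h2 h3 => h.intervalIntegrable.mono_set (by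
        rw [uIcc_of_le h2, uIcc_of_le (h1.trans (h2.trans h3))]
        exact Icc_subset_Icc h1 h3)
    rw [h.eq_add_integral t ⟨hac.trans ht.1, ht.2.trans hdb⟩,
      h.eq_add_integral c ⟨hac, hcd.trans hdb⟩, add_assoc,
      intervalIntegral.integral_add_adjacent_intervals (hi le_rfl hac (hcd.trans hdb))
        (hi hac ht.1 (ht.2.trans hdb))]

lemma map {F : Type*} [NormedAddCommGroup F] [NormedSpace ℝ F] [CompleteSpace E]
    [CompleteSpace F] (L : E →L[ℝ] F) (h : IsPrimitiveOn f f' a b) :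
    IsPrimitiveOn (fun t => L (f t)) (fun t => L (f' t)) a b where
  intervalIntegrable := ⟨L.integrable_comp h.intervalIntegrable.1,
    L.integrable_comp h.intervalIntegrable.2⟩
  eq_add_integral := fun t ht => by
    have hi : IntervalIntegrable f' volume a t := h.intervalIntegrable.mono_set (by
      rw [uIcc_of_le ht.1, uIcc_of_le (ht.1.trans ht.2)]
      exact Icc_subset_Icc le_rfl ht.2)
    rw [h.eq_add_integral t ht, map_add, L.intervalIntegral_comp_comm hi]

lemma of_hasDerivAt [CompleteSpace E] (h : ∀ t, HasDerivAt f (f' t) t) (hc : Continuous f') :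
    IsPrimitiveOn f f' a b where
  intervalIntegrable := hc.intervalIntegrable _ _
  eq_add_integral := fun t _ => by
    rw [intervalIntegral.integral_eq_sub_of_hasDerivAt (fun x _ => h x)
      (hc.intervalIntegrable _ _)]
    abel

end

/-- Integration by parts for absolutely continuous functions. Nothing is known about `f` outside [a,
b], so it is replaced by the globally defined indefinite integral, which agrees with it on [a, b]
and is differentiable almost everywhere there. -/
lemma integral_mul_real {f f' g g' : ℝ → ℝ} {a b : ℝ} (hab : a ≤ b) (hf : IsPrimitiveOn f f' a b)
    (hg : IsPrimitiveOn g g' a b) :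
    ∫ t in a..b, (f' t * g t + f t * g' t) = f b * g b - f a * g a := by
  have key : ∀ {f f' : ℝ → ℝ}, IsPrimitiveOn f f' a b →
      AbsolutelyContinuousOnInterval (fun t => f a + ∫ τ in a..t, f' τ) a b ∧
      ∀ᵐ t, t ∈ uIcc a b → HasDerivAt (fun t => f a + ∫ τ in a..t, f' τ) (f' t) t := by
    intro f f' h
    refine ⟨?_, ?_⟩
    · have h1 : AbsolutelyContinuousOnInterval (fun _ : ℝ => f a) a b :=
        (LipschitzOnWith.of_dist_le_mul (K := 0) fun _ _ _ _ => by
          simp).absolutelyContinuousOnInterval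
      exact h1.add (h.intervalIntegrable.absolutelyContinuousOnInterval_intervalIntegral
        left_mem_uIcc)
    · filter_upwards [h.intervalIntegrable.ae_hasDerivAt_integral] with t ht hmem
      exact (ht hmem a left_mem_uIcc).const_add (f a)
  have h1 := (key hf).1.integral_deriv_mul_eq_sub (key hg).1
  rw [← hf.eq_add_integral b ⟨hab, le_rfl⟩, ← hg.eq_add_integral b ⟨hab, le_rfl⟩,
    intervalIntegral.integral_same, intervalIntegral.integral_same, add_zero, add_zero] at h1
  rw [← h1]
  refine intervalIntegral.integral_congr_ae ?_
  filter_upwards [(key hf).2, (key hg).2] with t h2 h3 ht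
  have ht' := uIoc_subset_uIcc ht
  have ht2 : t ∈ Icc a b := by rwa [uIcc_of_le hab] at ht'
  rw [(h2 ht').deriv, (h3 ht').deriv, ← hf.eq_add_integral t ht2, ← hg.eq_add_integral t ht2]

/-- The real statement applied to the four products of real and imaginary parts. -/
lemma integral_mul {f f' g g' : ℝ → ℂ} {a b : ℝ} (hab : a ≤ b) (hf : IsPrimitiveOn f f' a b)
    (hg : IsPrimitiveOn g g' a b) :
    IntervalIntegrable (fun t => f' t * g t) volume a b ∧
    IntervalIntegrable (fun t => f t * g' t) volume a b ∧
    (∫ t in a..b, f' t * g t) + (∫ t in a..b, f t * g' t) = f b * g b - f a * g a := by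
  have hgc : ContinuousOn g (uIcc a b) := by rw [uIcc_of_le hab]; exact hg.continuousOn hab
  have hfc : ContinuousOn f (uIcc a b) := by rw [uIcc_of_le hab]; exact hf.continuousOn hab
  have i1 := hf.intervalIntegrable.mul_continuousOn hgc
  have i2 := hg.intervalIntegrable.continuousOn_mul hfc
  refine ⟨i1, i2, ?_⟩
  rw [← intervalIntegral.integral_add i1 i2]
  have fr := hf.map Complex.reCLM
  have fi := hf.map Complex.imCLM
  have gr := hg.map Complex.reCLM
  have gi := hg.map Complex.imCLM
  have hii : ∀ {p p' r r' : ℝ → ℝ}, IsPrimitiveOn p p' a b → IsPrimitiveOn r r' a b →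
      IntervalIntegrable (fun t => p' t * r t + p t * r' t) volume a b := by
    intro p p' r r' hp hr
    have hrc : ContinuousOn r (uIcc a b) := by rw [uIcc_of_le hab]; exact hr.continuousOn hab
    have hpc : ContinuousOn p (uIcc a b) := by rw [uIcc_of_le hab]; exact hp.continuousOn hab
    exact (hp.intervalIntegrable.mul_continuousOn hrc).add
      (hr.intervalIntegrable.continuousOn_mul hpc)
  apply Complex.ext
  · rw [← Complex.reCLM_apply, ← Complex.reCLM.intervalIntegral_comp_comm (i1.add i2),
      Complex.sub_re, Complex.mul_re, Complex.mul_re]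
    have e1 := integral_mul_real hab fr gr
    have e2 := integral_mul_real hab fi gi
    have e3 := intervalIntegral.integral_sub (hii fr gr) (hii fi gi)
    rw [e1, e2] at e3
    simp only [Complex.reCLM_apply, Complex.imCLM_apply] at e3 ⊢
    refine Eq.trans ?_ (e3.trans (by ring))
    congr 1; ext t
    simp only [Complex.add_re, Complex.mul_re]
    ring
  · rw [← Complex.imCLM_apply, ← Complex.imCLM.intervalIntegral_comp_comm (i1.add i2),
      Complex.sub_im, Complex.mul_im, Complex.mul_im]
    have e1 := integral_mul_real hab fr gi
    have e2 := integral_mul_real hab fi gr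
    have e3 := intervalIntegral.integral_add (hii fr gi) (hii fi gr)
    rw [e1, e2] at e3
    simp only [Complex.reCLM_apply, Complex.imCLM_apply] at e3 ⊢
    refine Eq.trans ?_ (e3.trans (by ring))
    congr 1; ext t
    simp only [Complex.add_im, Complex.mul_im]
    ring

lemma star {f f' : ℝ → ℂ} {a b : ℝ} (h : IsPrimitiveOn f f' a b) :
    IsPrimitiveOn (fun t => conj (f t)) (fun t => conj (f' t)) a b :=
  h.map (Complex.conjCLE : ℂ →L[ℝ] ℂ)

/-- Variation of constants: Duhamel's formula yields the differential equation. -/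
lemma of_duhamel {y g : ℝ → ℂ} {lam T : ℝ} (hT : 0 ≤ T)
    (hg : IntervalIntegrable g volume 0 T)
    (hy : ∀ t ∈ Icc 0 T, y t = (Real.exp (-lam * t) : ℂ) * y 0
      + ∫ τ in (0 : ℝ)..t, (Real.exp (-lam * (t - τ)) : ℂ) * g τ) :
    IsPrimitiveOn y (fun t => -(lam : ℂ) * y t + g t) 0 T := by
  -- Integrating factor: y = EG, where E solves the homogeneous equation and E G' = g; the product
  -- rule then gives the equation for y.
  let E : ℝ → ℂ := fun t => (Real.exp (-lam * t) : ℂ)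
  let G : ℝ → ℂ := fun t => y 0 + ∫ τ in (0 : ℝ)..t, (Real.exp (lam * τ) : ℂ) * g τ
  have hE : ∀ t, HasDerivAt E (-(lam : ℂ) * E t) t := fun t => by
    have h1 : HasDerivAt (fun t : ℝ => Real.exp (-lam * t)) (Real.exp (-lam * t) * -lam) t := by
      simpa using ((hasDerivAt_id t).const_mul (-lam)).exp
    convert! h1.ofReal_comp using 1
    simp only [E]
    push_cast
    ring
  have hEc : Continuous E := continuous_iff_continuousAt.mpr fun t => (hE t).continuousAt
  have hEp : ∀ {b}, IsPrimitiveOn E (fun t => -(lam : ℂ) * E t) 0 b :=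
    of_hasDerivAt hE (continuous_const.mul hEc)
  have hexp : Continuous fun τ : ℝ => (Real.exp (lam * τ) : ℂ) := by fun_prop
  have hGp : IsPrimitiveOn G (fun τ => (Real.exp (lam * τ) : ℂ) * g τ) 0 T :=
    ⟨hg.continuousOn_mul hexp.continuousOn, fun t _ => by simp [G]⟩
  have hyEG : ∀ t ∈ Icc 0 T, y t = E t * G t := fun t ht => by
    rw [hy t ht]
    simp only [E, G, mul_add]
    congr 1
    rw [← intervalIntegral.integral_const_mul]
    congr 1; ext τ
    rw [← mul_assoc, ← Complex.ofReal_mul, ← Real.exp_add]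
    congr 4; ring
  have hyc : ContinuousOn y (Icc 0 T) :=
    ((hEp.continuousOn hT).mul (hGp.continuousOn hT)).congr hyEG
  refine ⟨IntervalIntegrable.add ?_ hg, fun t ht => ?_⟩
  · refine ContinuousOn.intervalIntegrable ?_
    rw [uIcc_of_le hT]
    exact continuousOn_const.mul hyc
  · have h := integral_mul ht.1 hEp (hGp.mono le_rfl ht.1 ht.2)
    rw [← hyEG t ht, ← hyEG 0 ⟨le_rfl, hT⟩, ← intervalIntegral.integral_add h.1 h.2.1] at h
    rw [eq_comm, ← eq_sub_iff_add_eq', ← h.2.2]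
    refine intervalIntegral.integral_congr fun τ hτ => ?_
    rw [uIcc_of_le ht.1] at hτ
    have h1 : E τ * (Real.exp (lam * τ) : ℂ) = 1 := by
      simp only [E]
      rw [← Complex.ofReal_mul, ← Real.exp_add]
      simp
    simp only [hyEG τ ⟨hτ.1, hτ.2.trans ht.2⟩]
    linear_combination -(g τ) * h1

end IsPrimitiveOn

/-! ### The Fourier coefficients of a mild solution -/

/-- The eigenvalue of `-Δ` on the mode `k`. -/
def lam (k : Fin N → ℤ) : ℝ := 4 * Real.pi ^ 2 * freqSq k

lemma lam_nonneg (k : Fin N → ℤ) : 0 ≤ lam k := by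
  have := freqSq_nonneg k
  unfold lam; positivity

lemma fourierCoef_heat_of_summable {t : ℝ} {f : Torus N → ℝ}
    (h : Summable fun k => ‖(Real.exp (-lam k * t) : ℂ) * fourierCoef f k‖ ^ 2)
    (k : Fin N → ℤ) :
    fourierCoef (heat t f) k = (Real.exp (-lam k * t) : ℂ) * fourierCoef f k := by
  refine fourierCoef_multiplier h (fun l => ?_) k
  simp only [lam, freqSq_neg, Complex.conj_ofReal]

lemma fourierCoef_heat_of_memLp {t : ℝ} (ht : 0 ≤ t) {f : Torus N → ℝ} (hf : MemLp f 2 volume)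
    (k : Fin N → ℤ) :
    fourierCoef (heat t f) k = (Real.exp (-lam k * t) : ℂ) * fourierCoef f k := by
  refine fourierCoef_heat_of_summable ?_ k
  refine Summable.of_nonneg_of_le (fun _ => sq_nonneg _) (fun k => ?_)
    (hasSum_norm_sq_fourierCoef hf).summable
  rw [norm_mul, Complex.norm_real, Real.norm_of_nonneg (Real.exp_nonneg _)]
  gcongr
  refine mul_le_of_le_one_left (norm_nonneg _) (Real.exp_le_one_iff.mpr ?_)
  nlinarith [mul_nonneg (lam_nonneg k) ht]

/-- For positive time the heat factor beats the weight 1 + |k|², so H⁻¹ data are mapped into L².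
This ensures that the series in `multiplier` converges and does not take its default value. -/
lemma fourierCoef_heat_of_memHneg1 {t : ℝ} (ht : 0 < t) {f : Torus N → ℝ}
    (hf : Summable fun k => (1 + freqSq k)⁻¹ * ‖fourierCoef f k‖ ^ 2) (k : Fin N → ℤ) :
    fourierCoef (heat t f) k = (Real.exp (-lam k * t) : ℂ) * fourierCoef f k := by
  refine fourierCoef_heat_of_summable ?_ k
  have hc : 0 < 8 * Real.pi ^ 2 * t := by positivity
  refine Summable.of_nonneg_of_le (fun _ => sq_nonneg _) (fun k => ?_)
    (hf.mul_left (1 + (8 * Real.pi ^ 2 * t)⁻¹))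
  have hk := freqSq_nonneg k
  rw [norm_mul, Complex.norm_real, Real.norm_of_nonneg (Real.exp_nonneg _), mul_pow, ← mul_assoc]
  gcongr
  rw [← Real.exp_nat_mul, ← div_eq_mul_inv, le_div_iff₀ (by linarith)]
  -- This is 1 + x ≤ e^x at x = 8π²t|k|² = 2λt.
  have h1 : (1 + 8 * Real.pi ^ 2 * t * freqSq k)
      * Real.exp (((2 : ℕ) : ℝ) * (-lam k * t)) ≤ 1 := by
    have e : ((2 : ℕ) : ℝ) * (-lam k * t) = -(8 * Real.pi ^ 2 * t * freqSq k) := by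
      unfold lam; push_cast; ring
    rw [e, Real.exp_neg, ← div_eq_mul_inv, div_le_one (Real.exp_pos _), add_comm]
    exact Real.add_one_le_exp _
  have h2 : 1 + freqSq k ≤ (1 + (8 * Real.pi ^ 2 * t)⁻¹)
      * (1 + 8 * Real.pi ^ 2 * t * freqSq k) := by
    have e : (1 + (8 * Real.pi ^ 2 * t)⁻¹) * (1 + 8 * Real.pi ^ 2 * t * freqSq k)
        = 1 + freqSq k + (8 * Real.pi ^ 2 * t)⁻¹ + 8 * Real.pi ^ 2 * t * freqSq k := by
      field_simp
      ring
    rw [e]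
    have : 0 ≤ (8 * Real.pi ^ 2 * t)⁻¹ := by positivity
    have : 0 ≤ 8 * Real.pi ^ 2 * t * freqSq k := by positivity
    linarith
  calc _ ≤ Real.exp (((2 : ℕ) : ℝ) * (-lam k * t)) * ((1 + (8 * Real.pi ^ 2 * t)⁻¹)
      * (1 + 8 * Real.pi ^ 2 * t * freqSq k)) := by gcongr
    _ = (1 + (8 * Real.pi ^ 2 * t)⁻¹) * ((1 + 8 * Real.pi ^ 2 * t * freqSq k)
      * Real.exp (((2 : ℕ) : ℝ) * (-lam k * t))) := by ring
    _ ≤ _ := mul_le_of_le_one_right (by positivity) h1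

/-- Discards the endpoint τ = t, at which the heat factor has time zero and does not smooth. -/
lemma ae_of_ae_Ioo {T t : ℝ} (ht0 : 0 ≤ t) (ht : t ≤ T) {P : ℝ → Prop}
    (h : ∀ᵐ τ ∂(volume.restrict (Ioo 0 T)), P τ) :
    ∀ᵐ τ ∂(volume.restrict (Set.uIoc 0 t)), τ < t ∧ P τ := by
  rw [uIoc_of_le ht0, ← restrict_Ioo_eq_restrict_Ioc]
  have h1 := ae_restrict_of_ae_restrict_of_subset (Ioo_subset_Ioo_right ht) h
  filter_upwards [h1, ae_restrict_mem measurableSet_Ioo] with τ h2 h3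
  exact ⟨h3.2, h2⟩

/-- Fourier coefficients of a Duhamel integral. -/
lemma coefR_duhamel {T : ℝ} (hT : 0 < T) {F : ℝ → Torus N → ℝ} (k : Fin N → ℤ)
    (hF : ∀ t ∈ Icc 0 T, IntervalIntegrable (fun τ => heat (t - τ) (F τ)) volume 0 t)
    (hh : ∀ᵐ τ ∂(volume.restrict (Ioo 0 T)), ∀ s > 0,
      fourierCoef (heat s (F τ)) k = (Real.exp (-lam k * s) : ℂ) * fourierCoef (F τ) k) :
    IntervalIntegrable (fun τ => fourierCoef (F τ) k) volume 0 T ∧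
    ∀ t ∈ Icc 0 T, coefR k (∫ τ in (0 : ℝ)..t, heat (t - τ) (F τ))
      = ∫ τ in (0 : ℝ)..t, (Real.exp (-lam k * (t - τ)) : ℂ) * fourierCoef (F τ) k := by
  have hae : ∀ t ∈ Icc 0 T, (fun τ => coefR k (heat (t - τ) (F τ)))
      =ᵐ[volume.restrict (Set.uIoc 0 t)]
        fun τ => (Real.exp (-lam k * (t - τ)) : ℂ) * fourierCoef (F τ) k := by
    intro t ht
    filter_upwards [ae_of_ae_Ioo ht.1 ht.2 hh] with τ hτ
    rw [coefR_apply, hτ.2 _ (sub_pos.mpr hτ.1)]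
  constructor
  · have h0 := hF T ⟨hT.le, le_rfl⟩
    have h1 : IntervalIntegrable (fun τ => coefR k (heat (T - τ) (F τ))) volume 0 T :=
      ⟨(coefR k).integrable_comp h0.1, (coefR k).integrable_comp h0.2⟩
    have h2 := h1.congr_ae (hae T ⟨hT.le, le_rfl⟩)
    -- Integrability of the coefficient is recovered from the Duhamel integrand at the final time by
    -- multiplying with the inverse heat factor, which for a fixed mode is continuous in τ.
    have h3 := h2.continuousOn_mul (g := fun τ : ℝ => (Real.exp (lam k * (T - τ)) : ℂ))
      (by fun_prop)
    refine h3.congr fun τ _ => ?_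
    rw [← mul_assoc, ← Complex.ofReal_mul, ← Real.exp_add]
    simp
  · intro t ht
    rw [← (coefR k).intervalIntegral_comp_comm (hF t ht)]
    refine intervalIntegral.integral_congr_ae ?_
    have := hae t ht
    rwa [EventuallyEq, ae_restrict_iff' measurableSet_uIoc] at this

lemma fourierCoef_one_of_ne {k : Fin N → ℤ} (hk : k ≠ 0) :
    fourierCoef (fun _ : Torus N => (1 : ℝ)) k = 0 := by
  have h := coefC_mFourierLp k 0
  rw [if_neg hk, coefC_apply] at h
  rw [← h]
  refine (congrFun (mFourierCoeff_congr_ae ?_) k)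
  filter_upwards [UnitAddTorus.coeFn_mFourierLp (d := Fin N) 2 0] with x hx
  rw [hx, UnitAddTorus.mFourier_zero]
  simp

lemma coefR_const (c : ℝ) (k : Fin N → ℤ) :
    coefR k (Lp.const 2 (volume : Measure (Torus N)) c)
      = c * fourierCoef (fun _ : Torus N => (1 : ℝ)) k := by
  rw [coefR_apply, fourierCoef_congr_ae (Lp.coeFn_const (p := 2) (μ := volume) c)]
  simp only [fourierCoef, UnitAddTorus.mFourierCoeff, smul_eq_mul, Function.const_apply,
    Complex.ofReal_one, mul_one]
  rw [integral_mul_const, mul_comm]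

/-- The coefficient functional commutes with the Bochner integrals, which turns Duhamel's formula
into its scalar version for each mode. The hypotheses on the source and on the advection term make
the heat multiplier act on the coefficients as expected. -/
lemma IsMildSolution.isPrimitiveOn {p : ℝ} {v : ℝ → Torus N → Vec N} {u₀ : L2 N} {T : ℝ}
    {u : ℝ → L2 N} (hu : IsMildSolution p v u₀ T u) (hT : 0 < T)
    (hsrc : ∀ t ∈ Ioc 0 T, MemLp (fun x => |u t x| ^ p) 2 volume)
    (hadv : ∀ᵐ τ ∂(volume.restrict (Ioo 0 T)), Summable fun k => (1 + freqSq k)⁻¹ *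
      ‖fourierCoef (fun x => inner ℝ (v τ x) (grad (u τ) x)) k‖ ^ 2) :
    u 0 = u₀ ∧ ∀ k,
      IntervalIntegrable (fun τ => fourierCoef (fun x => |u τ x| ^ p) k) volume 0 T ∧
      IntervalIntegrable (fun τ => fourierCoef (fun x => inner ℝ (v τ x) (grad (u τ) x)) k)
        volume 0 T ∧
      IsPrimitiveOn (fun t => fourierCoef (u t) k) (fun t => -(lam k : ℂ) * fourierCoef (u t) k
        + (fourierCoef (fun x => |u t x| ^ p) k
          - fourierCoef (fun x => inner ℝ (v t x) (grad (u t) x)) k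
          - (∫ x, |u t x| ^ p : ℝ) * fourierCoef (fun _ : Torus N => (1 : ℝ)) k)) 0 T := by
  have hu0 : u 0 = u₀ := by
    have h := hu.eq_duhamel 0 ⟨le_rfl, hT.le⟩
    simp only [intervalIntegral.integral_same, add_zero, sub_zero, map_zero] at h
    refine eq_of_fourierCoef_eq fun k => ?_
    rw [h, fourierCoef_heat_of_memLp le_rfl (Lp.memLp u₀)]
    simp
  refine ⟨hu0, fun k => ?_⟩
  have h1 := coefR_duhamel hT k hu.integrable_source (by
    filter_upwards [ae_restrict_mem measurableSet_Ioo] with τ hτ s hs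
    exact fourierCoef_heat_of_memLp hs.le (hsrc τ ⟨hτ.1, hτ.2.le⟩) k)
  have h2 := coefR_duhamel hT k hu.integrable_advection (by
    filter_upwards [hadv] with τ hτ s hs
    exact fourierCoef_heat_of_memHneg1 hs hτ k)
  refine ⟨h1.1, h2.1, ?_⟩
  have hm : IntervalIntegrable (fun t => ((∫ x, |u t x| ^ p : ℝ) : ℂ)
      * fourierCoef (fun _ : Torus N => (1 : ℝ)) k) volume 0 T :=
    IntervalIntegrable.mul_const
      ⟨hu.integrable_mean.1.ofReal, hu.integrable_mean.2.ofReal⟩ _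
  refine IsPrimitiveOn.of_duhamel hT.le ((h1.1.sub h2.1).sub hm) fun t ht => ?_
  have hsub : ∀ {f : ℝ → ℂ}, IntervalIntegrable f volume 0 T → IntervalIntegrable
      (fun τ => (Real.exp (-lam k * (t - τ)) : ℂ) * f τ) volume 0 t := by
    intro f hf
    refine IntervalIntegrable.continuousOn_mul (hf.mono_set ?_) (by fun_prop)
    rw [uIcc_of_le ht.1, uIcc_of_le hT.le]
    exact Icc_subset_Icc le_rfl ht.2
  have h := congrArg (coefR k) (hu.eq_duhamel t ht)
  rw [map_sub, map_sub, map_add, h1.2 t ht, h2.2 t ht, coefR_const, coefR_apply, coefR_apply,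
    fourierCoef_heat_of_memLp ht.1 (Lp.memLp u₀)] at h
  rw [h, hu0]
  simp only [mul_sub (α := ℂ)]
  rw [intervalIntegral.integral_sub ((hsub h1.1).sub (hsub h2.1)) (hsub hm),
    intervalIntegral.integral_sub (hsub h1.1) (hsub h2.1)]
  -- The mean term carries no heat factor in Duhamel's formula. It lives on the zero mode, where the
  -- factor equals 1, so inserting it changes nothing.
  have e : ∫ τ in (0 : ℝ)..t, (Real.exp (-lam k * (t - τ)) : ℂ) *
      (((∫ x, |u τ x| ^ p : ℝ) : ℂ) * fourierCoef (fun _ : Torus N => (1 : ℝ)) k)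
      = ((∫ τ in (0 : ℝ)..t, ∫ x, |u τ x| ^ p : ℝ) : ℂ)
        * fourierCoef (fun _ : Torus N => (1 : ℝ)) k := by
    by_cases hk : k = 0
    · have hl : lam k = 0 := by simp [lam, freqSq, hk]
      simp only [hl, neg_zero, zero_mul, Real.exp_zero, Complex.ofReal_one, one_mul]
      rw [intervalIntegral.integral_mul_const, intervalIntegral.integral_ofReal]
    · simp [fourierCoef_one_of_ne hk]
  rw [e]
  ring

/-! ### Series of time integrals -/

/-- Dominated convergence for unconditional sums whose partial sums are dominated. -/
lemma hasSum_intervalIntegral {ι : Type*} [Countable ι] {c : ℝ → ι → ℝ} {L bnd : ℝ → ℝ}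
    {a b : ℝ} (hab : a ≤ b) (hc : ∀ k, IntervalIntegrable (fun t => c t k) volume a b)
    (hbnd : IntervalIntegrable bnd volume a b)
    (hle : ∀ᵐ t ∂(volume.restrict (Ioo a b)), ∀ S : Finset ι, |∑ k ∈ S, c t k| ≤ bnd t)
    (hL : ∀ᵐ t ∂(volume.restrict (Ioo a b)), HasSum (c t) (L t)) :
    IntervalIntegrable L volume a b ∧
      HasSum (fun k => ∫ t in a..b, c t k) (∫ t in a..b, L t) := by
  rw [restrict_Ioo_eq_restrict_Ioc] at hle hL
  have hS : ∀ S : Finset ι, IntervalIntegrable (fun t => ∑ k ∈ S, c t k) volume a b := fun S => by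
    have := IntervalIntegrable.sum S (f := fun k t => c t k) fun k _ => hc k
    simpa only [Finset.sum_fn] using this
  have hm : ∀ S : Finset ι, AEStronglyMeasurable (fun t => ∑ k ∈ S, c t k)
      (volume.restrict (Ioc a b)) := fun S => (hS S).1.aestronglyMeasurable
  have hLm : AEStronglyMeasurable L (volume.restrict (Ioc a b)) :=
    aestronglyMeasurable_of_tendsto_ae atTop hm hL
  constructor
  · rw [intervalIntegrable_iff_integrableOn_Ioc_of_le hab] at hbnd ⊢
    refine Integrable.mono' hbnd hLm ?_
    filter_upwards [hle, hL] with t h1 h2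
    exact le_of_tendsto h2.abs (Eventually.of_forall h1)
  · have := intervalIntegral.tendsto_integral_filter_of_dominated_convergence (μ := volume)
      (l := (atTop : Filter (Finset ι))) (a := a) (b := b) (f := L)
      (F := fun S t => ∑ k ∈ S, c t k) bnd
      (Eventually.of_forall fun S => by rw [uIoc_of_le hab]; exact hm S)
      (Eventually.of_forall fun S => by
        rw [uIoc_of_le hab]
        rw [ae_restrict_iff' measurableSet_Ioc] at hle
        filter_upwards [hle] with t ht hmem
        exact ht hmem S)
      hbnd
      (by
        rw [uIoc_of_le hab]
        rw [ae_restrict_iff' measurableSet_Ioc] at hL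
        exact hL)
    refine this.congr fun S => ?_
    exact intervalIntegral.integral_finsetSum fun k _ => hc k

lemma IsPrimitiveOn.integral_re_mul_conj {f f' g g' : ℝ → ℂ} {a b : ℝ} (hab : a ≤ b)
    (hf : IsPrimitiveOn f f' a b) (hg : IsPrimitiveOn g g' a b) :
    IntervalIntegrable (fun t => (f' t * conj (g t)).re) volume a b ∧
    IntervalIntegrable (fun t => (f t * conj (g' t)).re) volume a b ∧
    (∫ t in a..b, (f' t * conj (g t)).re) + (∫ t in a..b, (f t * conj (g' t)).re)
      = (f b * conj (g b)).re - (f a * conj (g a)).re := by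
  obtain ⟨h1, h2, h3⟩ := IsPrimitiveOn.integral_mul hab hf hg.star
  refine ⟨⟨h1.1.re, h1.2.re⟩, ⟨h2.1.re, h2.2.re⟩, ?_⟩
  rw [← Complex.sub_re, ← h3, Complex.add_re]
  congr 1
  · exact Complex.reCLM.intervalIntegral_comp_comm h1
  · exact Complex.reCLM.intervalIntegral_comp_comm h2

lemma abs_sum_re_mul_conj_le {ι : Type*} (S : Finset ι) (a b : ι → ℂ) :
    |∑ k ∈ S, (a k * conj (b k)).re| ≤ √(∑ k ∈ S, ‖a k‖ ^ 2) * √(∑ k ∈ S, ‖b k‖ ^ 2) := by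
  refine (Finset.abs_sum_le_sum_abs _ _).trans
    ((Finset.sum_le_sum fun k _ => ?_).trans (Real.sum_mul_le_sqrt_mul_sqrt S _ _))
  refine (Complex.abs_re_le_norm _).trans_eq ?_
  rw [norm_mul, RCLike.norm_conj]

/-! ### Consequences of the differential equation for the Fourier coefficients -/

/-- A curve in `L²` whose Fourier coefficients satisfy `∂ₜu + v·∇u - Δu = G`, with the bounds
available for mild solutions. -/
structure FlowEstimates (T : ℝ) (u : ℝ → L2 N) (v : ℝ → Torus N → Vec N) (G : ℝ → Torus N → ℝ)
    (q s V K M A D β : ℝ) : Prop where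
  T_pos : 0 < T
  continuousOn : ContinuousOn u (Icc 0 T)
  norm_le : ∀ t ∈ Icc 0 T, ‖u t‖ ≤ M
  memH1 : ∀ t ∈ Ioc 0 T, MemH1 (u t)
  h1Sq_le : ∀ t ∈ Ioc 0 T, h1Sq (fourierCoef (u t)) ≤ A / t
  A_nonneg : 0 ≤ A
  memLp_G : ∀ t ∈ Ioc 0 T, MemLp (G t) 2 volume
  G_le : ∀ t ∈ Ioc 0 T, ∫ x, G t x ^ 2 ≤ D * t ^ (-β)
  D_nonneg : 0 ≤ D
  β_lt_one : β < 1
  int_G : ∀ k, IntervalIntegrable (fun t => fourierCoef (G t) k) volume 0 T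
  int_adv : ∀ k, IntervalIntegrable
    (fun t => fourierCoef (fun x => inner ℝ (v t x) (grad (u t) x)) k) volume 0 T
  isPrimitiveOn : ∀ k, IsPrimitiveOn (fun t => fourierCoef (u t) k)
    (fun t => -(lam k : ℂ) * fourierCoef (u t) k + (fourierCoef (G t) k
      - fourierCoef (fun x => inner ℝ (v t x) (grad (u t) x)) k)) 0 T
  adv : ∀ᵐ t ∂(volume.restrict (Ioo 0 T)),
    AdvectionData q s (v t) (grad (u t)) V (√(∫ x, ‖grad (u t) x‖ ^ 2)) K
  div_free : ∀ᵐ t ∂(volume.restrict (Ioo 0 T)), ∀ ψ : Torus N → ℝ, SmoothOnTorus ψ →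
    ∫ x, inner ℝ (v t x) (classicalGrad ψ x) = 0

namespace FlowEstimates

variable {T q s V K M A D β : ℝ} {u : ℝ → L2 N} {v : ℝ → Torus N → Vec N}
  {G : ℝ → Torus N → ℝ} (h : FlowEstimates T u v G q s V K M A D β)
include h

lemma continuousOn_coef (k : Fin N → ℤ) :
    ContinuousOn (fun t => fourierCoef (u t) k) (Icc 0 T) := by
  simp only [← coefR_apply]
  exact (coefR k).continuous.comp_continuousOn h.continuousOn

lemma sum_norm_sq_coef_le {t : ℝ} (ht : t ∈ Icc 0 T) (S : Finset (Fin N → ℤ)) :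
    ∑ k ∈ S, ‖fourierCoef (u t) k‖ ^ 2 ≤ M ^ 2 := by
  refine (sum_le_hasSum S (fun _ _ => sq_nonneg _) (hasSum_norm_sq_fourierCoef_L2 (u t))).trans ?_
  exact pow_le_pow_left₀ (norm_nonneg _) (h.norm_le t ht) 2

lemma M_nonneg : 0 ≤ M := (norm_nonneg _).trans (h.norm_le 0 ⟨le_rfl, h.T_pos.le⟩)

/-- The bound for ‖G‖‖u‖: its singularity t^{-β/2} is integrable at 0 because β < 1. -/
lemma intervalIntegrable_sqrt_bound : IntervalIntegrable
    (fun t => √(D * t ^ (-β)) * M) volume 0 T := by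
  have h1 : IntervalIntegrable (fun t : ℝ => √D * t ^ (-β / 2) * M) volume 0 T := by
    refine ((intervalIntegral.intervalIntegrable_rpow' ?_).const_mul _).mul_const _
    linarith [h.β_lt_one]
  rw [intervalIntegrable_iff_integrableOn_Ioo_of_le h.T_pos.le] at h1 ⊢
  refine h1.congr_fun (fun t ht => ?_) measurableSet_Ioo
  dsimp only
  rw [Real.sqrt_mul h.D_nonneg, Real.sqrt_eq_rpow (t ^ (-β)), ← Real.rpow_mul ht.1.le]
  congr 3
  ring

/-- Integrability of the work of the source on a solution. -/
lemma work {a t : ℝ} (ha : 0 ≤ a) (hat : a ≤ t) (htT : t ≤ T) :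
    IntervalIntegrable (fun τ => ∫ x, G τ x * u τ x) volume a t ∧
    HasSum (fun k => ∫ τ in a..t, (fourierCoef (G τ) k * conj (fourierCoef (u τ) k)).re)
      (∫ τ in a..t, ∫ x, G τ x * u τ x) := by
  have hsub : uIcc a t ⊆ uIcc 0 T := by
    rw [uIcc_of_le hat, uIcc_of_le h.T_pos.le]
    exact Icc_subset_Icc ha htT
  refine hasSum_intervalIntegral hat (fun k => ?_)
    (h.intervalIntegrable_sqrt_bound.mono_set hsub) ?_ ?_
  · have h1 := (h.int_G k).mul_continuousOn (g := fun τ => conj (fourierCoef (u τ) k)) (by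
      rw [uIcc_of_le h.T_pos.le]
      exact Complex.continuous_conj.comp_continuousOn (h.continuousOn_coef k))
    have h2 := h1.mono_set hsub
    exact ⟨h2.1.re, h2.2.re⟩
  · filter_upwards [ae_restrict_mem measurableSet_Ioo] with τ hτ S
    have hτ' : τ ∈ Ioc 0 T := ⟨ha.trans_lt hτ.1, hτ.2.le.trans htT⟩
    refine (abs_sum_re_mul_conj_le S _ _).trans ?_
    gcongr
    · exact (sum_le_hasSum S (fun _ _ => sq_nonneg _)
        (hasSum_norm_sq_fourierCoef (h.memLp_G τ hτ'))).trans (h.G_le τ hτ')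
    · exact Real.sqrt_le_iff.mpr ⟨h.M_nonneg, h.sum_norm_sq_coef_le ⟨hτ'.1.le, hτ'.2⟩ S⟩
  · filter_upwards [ae_restrict_mem measurableSet_Ioo] with τ hτ
    have hτ' : τ ∈ Ioc 0 T := ⟨ha.trans_lt hτ.1, hτ.2.le.trans htT⟩
    exact Complex.hasSum_re (hasSum_fourierCoef_mul_conj (h.memLp_G τ hτ') (Lp.memLp (u τ)))

lemma sum_lam_le {t : ℝ} (ht : t ∈ Ioc 0 T) (S : Finset (Fin N → ℤ)) :
    ∑ k ∈ S, lam k * ‖fourierCoef (u t) k‖ ^ 2 ≤ ∫ x, ‖grad (u t) x‖ ^ 2 :=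
  sum_le_hasSum S (fun k _ => mul_nonneg (lam_nonneg k) (sq_nonneg _))
    (h.memH1 t ht).hasSum_norm_grad_sq

lemma dissipation_le {t : ℝ} (ht : t ∈ Ioc 0 T) :
    ∫ x, ‖grad (u t) x‖ ^ 2 ≤ 4 * Real.pi ^ 2 * (A / t) := by
  have h1 := h1Sq_fourierCoef (h.memH1 t ht)
  have h2 := h.h1Sq_le t ht
  have h3 : (4 * Real.pi ^ 2)⁻¹ * ∫ x, ‖grad (u t) x‖ ^ 2 ≤ A / t := by
    linarith [sq_nonneg ‖u t‖]
  rwa [inv_mul_le_iff₀ (by positivity)] at h3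

/-- The energy identity away from the initial time. -/
lemma energy_pos {r t : ℝ} (hr : 0 < r) (hrt : r ≤ t) (htT : t ≤ T) :
    IntervalIntegrable (fun τ => ∫ x, ‖grad (u τ) x‖ ^ 2) volume r t ∧
    ‖u r‖ ^ 2 + 2 * (∫ τ in r..t, ∫ x, G τ x * u τ x)
      = ‖u t‖ ^ 2 + 2 * ∫ τ in r..t, ∫ x, ‖grad (u τ) x‖ ^ 2 := by
  have hsub : Ioo r t ⊆ Ioo 0 T := Ioo_subset_Ioo hr.le htT
  have hmem : ∀ {τ}, τ ∈ Ioo r t → τ ∈ Ioc 0 T := fun hτ => ⟨hr.trans hτ.1, hτ.2.le.trans htT⟩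
  have hAr : ∀ {τ}, τ ∈ Ioo r t → A / τ ≤ A / r := fun hτ =>
    div_le_div_of_nonneg_left h.A_nonneg hr hτ.1.le
  have hcoef : ∀ k, ContinuousOn (fun τ => fourierCoef (u τ) k) (uIcc r t) := fun k =>
    (h.continuousOn_coef k).mono (by rw [uIcc_of_le hrt]; exact Icc_subset_Icc hr.le htT)
  -- Away from time zero the H¹ bound A/τ is at most A/r, so constants dominate the dissipation and
  -- the advection sums.
  have hD := hasSum_intervalIntegral (L := fun τ => ∫ x, ‖grad (u τ) x‖ ^ 2)
    (c := fun τ k => lam k * ‖fourierCoef (u τ) k‖ ^ 2) (bnd := fun _ => 4 * Real.pi ^ 2 * (A / r))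
    hrt (fun k => (continuousOn_const.mul ((hcoef k).norm.pow 2)).intervalIntegrable)
    intervalIntegrable_const
    (by
      filter_upwards [ae_restrict_mem measurableSet_Ioo] with τ hτ S
      rw [abs_of_nonneg (Finset.sum_nonneg fun k _ => mul_nonneg (lam_nonneg k) (sq_nonneg _))]
      refine (h.sum_lam_le (hmem hτ) S).trans ((h.dissipation_le (hmem hτ)).trans ?_)
      have := hAr hτ
      gcongr)
    (by
      filter_upwards [ae_restrict_mem measurableSet_Ioo] with τ hτ
      exact (h.memH1 τ (hmem hτ)).hasSum_norm_grad_sq)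
  have hP := h.work hr.le hrt htT
  have hadv := ae_restrict_of_ae_restrict_of_subset hsub h.adv
  have hdiv := ae_restrict_of_ae_restrict_of_subset hsub h.div_free
  have hQi : ∀ k, IntervalIntegrable (fun τ => (fourierCoef (u τ) k *
      conj (fourierCoef (fun x => inner ℝ (v τ x) (grad (u τ) x)) k)).re) volume r t := by
    intro k
    have h1 := ((h.int_adv k).mono_set (c := r) (d := t) (by
      rw [uIcc_of_le hrt, uIcc_of_le h.T_pos.le]; exact Icc_subset_Icc hr.le htT))
    have h2 : IntervalIntegrable (fun τ =>
        conj (fourierCoef (fun x => inner ℝ (v τ x) (grad (u τ) x)) k)) volume r t :=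
      ⟨(Complex.conjCLE : ℂ →L[ℝ] ℂ).integrable_comp h1.1,
        (Complex.conjCLE : ℂ →L[ℝ] ℂ).integrable_comp h1.2⟩
    have h3 := h2.continuousOn_mul (hcoef k)
    exact ⟨h3.1.re, h3.2.re⟩
  -- Incompressibility enters here: the advection coefficients paired with those of u sum to 0. The
  -- signs of `V` and `K` are known only at times where `adv` holds, hence the absolute values in
  -- the bound.
  have hQ := hasSum_intervalIntegral (L := fun _ => (0 : ℝ))
    (c := fun τ k => (fourierCoef (u τ) k *
      conj (fourierCoef (fun x => inner ℝ (v τ x) (grad (u τ) x)) k)).re)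
    (bnd := fun _ => |V| * √(4 * Real.pi ^ 2 * (A / r)) * (|K| * √(A / r)))
    hrt hQi intervalIntegrable_const
    (by
      filter_upwards [hadv, ae_restrict_mem measurableSet_Ioo] with τ h1 hτ S
      have h2 := h1.norm_sum_mul_conj_le S (fourierCoef (u τ))
      rw [← Complex.re_sum]
      refine (Complex.abs_re_le_norm _).trans (h2.trans ?_)
      have h3 := h.dissipation_le (hmem hτ)
      have h4 := hAr hτ
      have h5 : ∑ k ∈ S, (1 + freqSq k) * ‖fourierCoef (u τ) k‖ ^ 2 ≤ A / r := by
        refine le_trans ?_ ((h.h1Sq_le τ (hmem hτ)).trans h4)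
        refine (memH1_iff.mp (h.memH1 τ (hmem hτ))).sum_le_tsum S fun k _ => ?_
        have := freqSq_nonneg k
        positivity
      have h6 := h1.V_nonneg
      have h7 := h1.embeds.1
      have h8 : ∫ x, ‖grad (u τ) x‖ ^ 2 ≤ 4 * Real.pi ^ 2 * (A / r) :=
        h3.trans (by gcongr)
      gcongr
      · exact le_abs_self V
      · exact le_abs_self K)
    (by
      filter_upwards [hadv, hdiv, ae_restrict_mem measurableSet_Ioo] with τ h1 h2 hτ
      have h3 := Complex.hasSum_re (h1.hasSum_mul_conj (h.memH1 τ (hmem hτ)))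
      rwa [h1.integral_mul_self h2 (h.memH1 τ (hmem hτ))] at h3)
  refine ⟨hD.1, ?_⟩
  -- The energy balance of one mode, obtained by integrating by parts its coefficient against its
  -- own conjugate.
  have hk : ∀ k, 2 * (∫ τ in r..t, (fourierCoef (G τ) k * conj (fourierCoef (u τ) k)).re)
      - 2 * (∫ τ in r..t, lam k * ‖fourierCoef (u τ) k‖ ^ 2)
      - 2 * (∫ τ in r..t, (fourierCoef (u τ) k *
      conj (fourierCoef (fun x => inner ℝ (v τ x) (grad (u τ) x)) k)).re)
      = ‖fourierCoef (u t) k‖ ^ 2 - ‖fourierCoef (u r) k‖ ^ 2 := by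
    intro k
    have hp := (h.isPrimitiveOn k).mono hr.le hrt htT
    obtain ⟨i1, i2, e⟩ := IsPrimitiveOn.integral_re_mul_conj hrt hp hp
    rw [Complex.mul_conj, Complex.mul_conj, Complex.ofReal_re, Complex.ofReal_re,
      Complex.normSq_eq_norm_sq, Complex.normSq_eq_norm_sq] at e
    rw [← e, ← intervalIntegral.integral_add i1 i2]
    have hGi : IntervalIntegrable
        (fun τ => (fourierCoef (G τ) k * conj (fourierCoef (u τ) k)).re) volume r t := by
      have h1 := ((h.int_G k).mono_set (c := r) (d := t) (by
        rw [uIcc_of_le hrt, uIcc_of_le h.T_pos.le]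
        exact Icc_subset_Icc hr.le htT)).mul_continuousOn
          (Complex.continuous_conj.comp_continuousOn (hcoef k))
      exact ⟨h1.1.re, h1.2.re⟩
    have hDi : IntervalIntegrable (fun τ => lam k * ‖fourierCoef (u τ) k‖ ^ 2) volume r t :=
      (continuousOn_const.mul ((hcoef k).norm.pow 2)).intervalIntegrable
    rw [← intervalIntegral.integral_const_mul, ← intervalIntegral.integral_const_mul,
      ← intervalIntegral.integral_const_mul,
      ← intervalIntegral.integral_sub (hGi.const_mul 2) (hDi.const_mul 2),
      ← intervalIntegral.integral_sub ((hGi.const_mul 2).sub (hDi.const_mul 2))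
        ((hQi k).const_mul 2)]
    congr 1; ext τ
    rw [← Complex.normSq_eq_norm_sq, Complex.normSq_apply]
    simp only [Complex.mul_re, Complex.add_re, Complex.sub_re, Complex.neg_re, Complex.neg_im,
      Complex.mul_im, Complex.add_im, Complex.sub_im, Complex.ofReal_re, Complex.ofReal_im,
      Complex.conj_re, Complex.conj_im]
    ring
  have hs1 := ((hP.2.mul_left 2).sub (hD.2.mul_left 2)).sub (hQ.2.mul_left 2)
  have hs2 := (hasSum_norm_sq_fourierCoef_L2 (u t)).sub (hasSum_norm_sq_fourierCoef_L2 (u r))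
  simp only [hk] at hs1
  have := hs1.unique hs2
  rw [intervalIntegral.integral_zero] at this
  linarith

/-- The pointwise bound of order 1/t is not integrable at 0. The energy identity on [r, T] bounds
the dissipation there by (M² + 2W)/2, with W the total absolute work of the source, independently of
r. A nonnegative function whose integrals over [r, T] stay bounded is integrable up to 0. -/
lemma integrableOn_dissipation :
    IntegrableOn (fun τ => ∫ x, ‖grad (u τ) x‖ ^ 2) (Ioc 0 T) volume := by
  have hT := h.T_pos
  set W := ∫ τ in (0 : ℝ)..T, |∫ x, G τ x * u τ x| with hW
  have hWi := (h.work le_rfl hT.le le_rfl).1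
  have ha : Tendsto (fun n : ℕ => T / ((n : ℝ) + 2)) atTop (𝓝 0) :=
    tendsto_const_nhds.div_atTop (tendsto_atTop_add_const_right _ _ tendsto_natCast_atTop_atTop)
  have hpos : ∀ n : ℕ, 0 < T / ((n : ℝ) + 2) := fun n => by positivity
  have hle : ∀ n : ℕ, T / ((n : ℝ) + 2) ≤ T := fun n =>
    div_le_self hT.le (by have : (0 : ℝ) ≤ n := Nat.cast_nonneg n; linarith)
  refine integrableOn_Ioc_of_intervalIntegral_norm_bounded_left (l := atTop)
    (I := (M ^ 2 + 2 * W) / 2) (fun n => ?_) ha (Eventually.of_forall fun n => ?_)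
  · have := (h.energy_pos (hpos n) (hle n) le_rfl).1
    rwa [intervalIntegrable_iff_integrableOn_Ioc_of_le (hle n)] at this
  · have h1 := (h.energy_pos (hpos n) (hle n) le_rfl).2
    have h2 : ‖u (T / ((n : ℝ) + 2))‖ ^ 2 ≤ M ^ 2 :=
      pow_le_pow_left₀ (norm_nonneg _) (h.norm_le _ ⟨(hpos n).le, hle n⟩) 2
    have h3 : (∫ τ in (T / ((n : ℝ) + 2))..T, ∫ x, G τ x * u τ x) ≤ W := by
      refine (le_abs_self _).trans
        ((intervalIntegral.abs_integral_le_integral_abs (hle n)).trans ?_)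
      refine intervalIntegral.integral_mono_interval (hpos n).le (hle n) le_rfl
        (ae_of_all _ fun _ => abs_nonneg _) hWi.abs
    have h4 : ∫ τ in Ioc (T / ((n : ℝ) + 2)) T, ‖∫ x, ‖grad (u τ) x‖ ^ 2‖
        = ∫ τ in (T / ((n : ℝ) + 2))..T, ∫ x, ‖grad (u τ) x‖ ^ 2 := by
      rw [intervalIntegral.integral_of_le (hle n)]
      congr 1; ext τ
      exact Real.norm_of_nonneg (integral_nonneg fun _ => sq_nonneg _)
    rw [h4]
    linarith [sq_nonneg ‖u T‖]

lemma intervalIntegrable_dissipation :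
    IntervalIntegrable (fun τ => ∫ x, ‖grad (u τ) x‖ ^ 2) volume 0 T :=
  (intervalIntegrable_iff_integrableOn_Ioc_of_le h.T_pos.le).mpr h.integrableOn_dissipation

/-- The energy identity. -/
lemma energy {t : ℝ} (ht : t ∈ Icc 0 T) :
    ‖u 0‖ ^ 2 + 2 * (∫ τ in (0 : ℝ)..t, ∫ x, G τ x * u τ x)
      = ‖u t‖ ^ 2 + 2 * ∫ τ in (0 : ℝ)..t, ∫ x, ‖grad (u τ) x‖ ^ 2 := by
  rcases eq_or_lt_of_le ht.1 with h0 | h0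
  · rw [← h0]; simp
  -- The identity is passed to r → 0: indefinite integrals are continuous, and the dissipation is
  -- now known to be integrable at 0.
  have hlim : ∀ {f : ℝ → ℝ}, IntervalIntegrable f volume 0 T →
      Tendsto (fun r => ∫ τ in r..t, f τ) (𝓝[>] 0) (𝓝 (∫ τ in (0 : ℝ)..t, f τ)) := by
    intro f hf
    have h1 : IntervalIntegrable f volume 0 t := hf.mono_set (by
      rw [uIcc_of_le ht.1, uIcc_of_le h.T_pos.le]; exact Icc_subset_Icc le_rfl ht.2)
    have h2 := intervalIntegral.continuousOn_primitive_interval' h1 (right_mem_uIcc)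
    have h3 := (h2 0 left_mem_uIcc).neg
    rw [uIcc_of_le ht.1] at h3
    have h4 : Tendsto (fun r => -∫ τ in t..r, f τ) (𝓝[Icc 0 t] 0) (𝓝 (-∫ τ in t..0, f τ)) := h3
    simp only [← intervalIntegral.integral_symm] at h4
    refine h4.mono_left ?_
    rw [← nhdsWithin_Ioc_eq_nhdsGT h0]
    exact nhdsWithin_mono _ Ioc_subset_Icc_self
  have hn : Tendsto (fun r => ‖u r‖ ^ 2) (𝓝[>] 0) (𝓝 (‖u 0‖ ^ 2)) := by
    have h1 := ((h.continuousOn 0 ⟨le_rfl, h.T_pos.le⟩).norm.pow 2)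
    refine h1.mono_left ?_
    rw [← nhdsWithin_Ioc_eq_nhdsGT h.T_pos]
    exact nhdsWithin_mono _ Ioc_subset_Icc_self
  have hl := hn.add ((hlim (h.work le_rfl h.T_pos.le le_rfl).1).const_mul 2)
  have hr := (tendsto_const_nhds (x := ‖u t‖ ^ 2)).add
    ((hlim h.intervalIntegrable_dissipation).const_mul 2)
  refine tendsto_nhds_unique_of_eventuallyEq hl hr ?_
  have hmem : Ioc 0 t ∈ 𝓝[>] (0 : ℝ) := Ioc_mem_nhdsGT h0
  filter_upwards [hmem] with r hr
  exact (h.energy_pos hr.1 hr.2 ht.2).2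

end FlowEstimates

/-! ### Regularity of the time derivative and the weak formulation -/

lemma sobolevNormSq_le_ofReal {s : ℝ} {a : (Fin N → ℤ) → ℂ} {B : ℝ}
    (hB : ∀ S : Finset (Fin N → ℤ), ∑ k ∈ S, (1 + freqSq k) ^ s * ‖a k‖ ^ 2 ≤ B) :
    sobolevNormSq s a ≤ ENNReal.ofReal B := by
  rw [sobolevNormSq, ENNReal.tsum_eq_iSup_sum]
  refine iSup_le fun S => ?_
  rw [← ENNReal.ofReal_sum_of_nonneg]
  · exact ENNReal.ofReal_le_ofReal (hB S)
  · intro k _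
    have := freqSq_nonneg k
    positivity

/-- The H⁻¹–H¹ Parseval identity transferred from L² classes to an actual smooth test function. -/
lemma AdvectionData.hasSum_mul_conj_fun {q s V Γ K : ℝ} {v G : Torus N → Vec N}
    (h : AdvectionData q s v G V Γ K) {ψ : Torus N → ℝ} (hψ : SmoothOnTorus ψ) :
    Integrable (fun x => ψ x * inner ℝ (v x) (G x)) volume ∧
    HasSum (fun k => fourierCoef ψ k * conj (fourierCoef (fun x => inner ℝ (v x) (G x)) k))
      ((∫ x, ψ x * inner ℝ (v x) (G x) : ℝ) : ℂ) := by
  have hm := smoothOnTorus_memLp hψ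
  have hH : MemH1 (hm.toLp ψ) := by
    rw [MemH1, fourierCoef_toLp]; exact memH1_of_smooth hψ
  have h1 := (h.integrable_mul hH).1
  have h2 := h.hasSum_mul_conj hH
  have hae : (fun x => inner ℝ (v x) (G x) * hm.toLp ψ x)
      =ᵐ[volume] fun x => ψ x * inner ℝ (v x) (G x) := by
    filter_upwards [hm.coeFn_toLp] with x hx
    rw [hx, mul_comm]
  rw [fourierCoef_toLp, integral_congr_ae hae] at h2
  exact ⟨h1.congr hae, h2⟩

namespace FlowEstimates

variable {T q s V K M A D β : ℝ} {u : ℝ → L2 N} {v : ℝ → Torus N → Vec N}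
  {G : ℝ → Torus N → ℝ} (h : FlowEstimates T u v G q s V K M A D β)
include h

lemma aestronglyMeasurable_coef (k : Fin N → ℤ) :
    AEStronglyMeasurable (fun t => fourierCoef (u t) k) (volume.restrict (Ioo 0 T)) :=
  ((h.continuousOn_coef k).mono Ioo_subset_Icc_self).aestronglyMeasurable measurableSet_Ioo

lemma integrable_dissipation_Ioo :
    IntegrableOn (fun τ => ∫ x, ‖grad (u τ) x‖ ^ 2) (Ioo 0 T) volume :=
  h.integrableOn_dissipation.mono_set Ioo_subset_Ioc_self

lemma memL2H1 : MemL2Hs T 1 (fun t => fourierCoef (u t)) := by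
  refine ⟨h.aestronglyMeasurable_coef, ?_⟩
  have hi : IntegrableOn (fun t => M ^ 2 + (4 * Real.pi ^ 2)⁻¹ * ∫ x, ‖grad (u t) x‖ ^ 2)
      (Ioo 0 T) volume :=
    (integrable_const _).add (h.integrable_dissipation_Ioo.const_mul _)
  refine lt_of_le_of_lt (setLIntegral_mono' measurableSet_Ioo fun t ht => ?_) hi.lintegral_lt_top
  have ht' : t ∈ Ioc 0 T := ⟨ht.1, ht.2.le⟩
  refine sobolevNormSq_le_ofReal fun S => ?_
  simp only [Real.rpow_one]
  have h1 : ∑ k ∈ S, (1 + freqSq k) * ‖fourierCoef (u t) k‖ ^ 2 ≤ h1Sq (fourierCoef (u t)) := by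
    refine (memH1_iff.mp (h.memH1 t ht')).sum_le_tsum S fun k _ => ?_
    have := freqSq_nonneg k
    positivity
  rw [h1Sq_fourierCoef (h.memH1 t ht')] at h1
  have h2 := pow_le_pow_left₀ (norm_nonneg _) (h.norm_le t ⟨ht.1.le, ht.2.le⟩) 2
  linarith

lemma integrableOn_source_bound : IntegrableOn (fun t : ℝ => D * t ^ (-β)) (Ioo 0 T) volume := by
  have h1 : IntervalIntegrable (fun t : ℝ => D * t ^ (-β)) volume 0 T :=
    (intervalIntegral.intervalIntegrable_rpow' (by linarith [h.β_lt_one])).const_mul _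
  rwa [intervalIntegrable_iff_integrableOn_Ioo_of_le h.T_pos.le] at h1

/-- In H⁻¹ the diffusion term is controlled by the dissipation, because λ²/(1 + |k|²) ≤ 4π²λ; the
source by its L² norm; the advection term by V‖∇u‖K. All three squared bounds are integrable in
time, and 3 is the constant of (a + b + c)² ≤ 3(a² + b² + c²). -/
lemma memL2Hneg1_deriv : MemL2Hs T (-1) (fun t k => -(lam k : ℂ) * fourierCoef (u t) k
    + (fourierCoef (G t) k - fourierCoef (fun x => inner ℝ (v t x) (grad (u t) x)) k)) := by
  refine ⟨fun k => ?_, ?_⟩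
  · have := (h.isPrimitiveOn k).intervalIntegrable
    rw [intervalIntegrable_iff_integrableOn_Ioo_of_le h.T_pos.le] at this
    exact this.aestronglyMeasurable
  have hi : IntegrableOn (fun t => 3 * (4 * Real.pi ^ 2 * (∫ x, ‖grad (u t) x‖ ^ 2)
      + D * t ^ (-β) + V ^ 2 * (∫ x, ‖grad (u t) x‖ ^ 2) * K ^ 2)) (Ioo 0 T) volume :=
    (((h.integrable_dissipation_Ioo.const_mul _).add h.integrableOn_source_bound).add
      ((h.integrable_dissipation_Ioo.const_mul _).mul_const _)).const_mul _
  refine lt_of_le_of_lt (lintegral_mono_ae ?_) hi.lintegral_lt_top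
  filter_upwards [h.adv, ae_restrict_mem measurableSet_Ioo] with t hadv ht
  have ht' : t ∈ Ioc 0 T := ⟨ht.1, ht.2.le⟩
  refine sobolevNormSq_le_ofReal fun S => ?_
  have hD := h.sum_lam_le ht' S
  have hG := (sum_le_hasSum S (fun _ _ => sq_nonneg _)
    (hasSum_norm_sq_fourierCoef (h.memLp_G t ht'))).trans (h.G_le t ht')
  have hF := hadv.sum_norm_sq_le S
  rw [mul_pow, mul_pow, Real.sq_sqrt (integral_nonneg fun _ => sq_nonneg _)] at hF
  have hterm : ∀ k : Fin N → ℤ, (1 + freqSq k) ^ (-1 : ℝ) *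
      ‖-(lam k : ℂ) * fourierCoef (u t) k + (fourierCoef (G t) k
        - fourierCoef (fun x => inner ℝ (v t x) (grad (u t) x)) k)‖ ^ 2
      ≤ 3 * (4 * Real.pi ^ 2 * (lam k * ‖fourierCoef (u t) k‖ ^ 2) + ‖fourierCoef (G t) k‖ ^ 2
        + (1 + freqSq k)⁻¹ *
          ‖fourierCoef (fun x => inner ℝ (v t x) (grad (u t) x)) k‖ ^ 2) := by
    intro k
    have hk := freqSq_nonneg k
    set z := fourierCoef (fun x => inner ℝ (v t x) (grad (u t) x)) k
    set y := fourierCoef (u t) k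
    set g := fourierCoef (G t) k
    have h1 : ‖-(lam k : ℂ) * y + (g - z)‖ ≤ lam k * ‖y‖ + ‖g‖ + ‖z‖ := by
      refine (norm_add_le _ _).trans ?_
      rw [norm_mul, norm_neg, Complex.norm_real, Real.norm_of_nonneg (lam_nonneg k)]
      linarith [norm_sub_le g z]
    have h2 : ‖-(lam k : ℂ) * y + (g - z)‖ ^ 2
        ≤ 3 * (lam k ^ 2 * ‖y‖ ^ 2 + ‖g‖ ^ 2 + ‖z‖ ^ 2) := by
      refine (pow_le_pow_left₀ (norm_nonneg _) h1 2).trans ?_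
      nlinarith [sq_nonneg (lam k * ‖y‖ - ‖g‖), sq_nonneg (lam k * ‖y‖ - ‖z‖),
        sq_nonneg (‖g‖ - ‖z‖)]
    rw [Real.rpow_neg_one]
    have h3 : (1 + freqSq k)⁻¹ * lam k ^ 2 ≤ 4 * Real.pi ^ 2 * lam k := by
      rw [inv_mul_le_iff₀ (by linarith), sq, ← mul_assoc]
      refine mul_le_mul_of_nonneg_right ?_ (lam_nonneg k)
      unfold lam
      nlinarith [Real.pi_pos, sq_nonneg Real.pi]
    have h4 : (1 + freqSq k)⁻¹ ≤ 1 := inv_le_one_of_one_le₀ (by linarith)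
    have h5 : 0 ≤ (1 + freqSq k)⁻¹ := by positivity
    calc _ ≤ (1 + freqSq k)⁻¹ * (3 * (lam k ^ 2 * ‖y‖ ^ 2 + ‖g‖ ^ 2 + ‖z‖ ^ 2)) := by gcongr
      _ = 3 * (((1 + freqSq k)⁻¹ * lam k ^ 2) * ‖y‖ ^ 2 + (1 + freqSq k)⁻¹ * ‖g‖ ^ 2
          + (1 + freqSq k)⁻¹ * ‖z‖ ^ 2) := by ring
      _ ≤ 3 * ((4 * Real.pi ^ 2 * lam k) * ‖y‖ ^ 2 + 1 * ‖g‖ ^ 2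
          + (1 + freqSq k)⁻¹ * ‖z‖ ^ 2) := by gcongr
      _ = _ := by ring
  refine (Finset.sum_le_sum fun k _ => hterm k).trans ?_
  rw [← Finset.mul_sum, Finset.sum_add_distrib, Finset.sum_add_distrib, ← Finset.mul_sum]
  gcongr

lemma timeDeriv : TimeDerivMemL2Hneg1 T u := by
  refine ⟨_, h.memL2Hneg1_deriv, fun η hη _ hsupp k => ?_⟩
  have hη1 : ∀ t, HasDerivAt (fun t => (η t : ℂ)) ((deriv η t : ℝ) : ℂ) t := fun t =>
    ((hη.differentiable (by simp)).differentiableAt.hasDerivAt).ofReal_comp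
  have hη2 : Continuous fun t => ((deriv η t : ℝ) : ℂ) :=
    Complex.continuous_ofReal.comp (hη.continuous_deriv (by simp))
  have hz : ∀ t, t ∉ Ioo 0 T → η t = 0 := fun t ht =>
    image_eq_zero_of_notMem_tsupport fun hmem => ht (hsupp hmem)
  obtain ⟨-, -, e⟩ := IsPrimitiveOn.integral_mul h.T_pos.le
    (IsPrimitiveOn.of_hasDerivAt hη1 hη2) (h.isPrimitiveOn k)
  rw [hz 0 (by simp), hz T (by simp), Complex.ofReal_zero, zero_mul, zero_mul, sub_zero,
    intervalIntegral.integral_of_le h.T_pos.le, intervalIntegral.integral_of_le h.T_pos.le,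
    ← restrict_Ioo_eq_restrict_Ioc] at e
  exact eq_neg_of_add_eq_zero_left e

lemma memLinftyL2 : MemLp u ⊤ (volume.restrict (Ioo 0 T)) := by
  refine memLp_top_of_bound ((h.continuousOn.mono Ioo_subset_Icc_self).aestronglyMeasurable
    measurableSet_Ioo) M ?_
  filter_upwards [ae_restrict_mem measurableSet_Ioo] with t ht
  exact h.norm_le t ⟨ht.1.le, ht.2.le⟩

/-- The weak formulation. -/
lemma weak {φ : ℝ → Torus N → ℝ} (hφ : SmoothInTimeSpace φ) (hφT : ∀ x, φ T x = 0) :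
    IntervalIntegrable (fun t => ∫ x, u t x * deriv (fun s => φ s x) t) volume 0 T ∧
    IntervalIntegrable (fun t => ∫ x, φ t x * inner ℝ (v t x) (grad (u t) x)) volume 0 T ∧
    IntervalIntegrable (fun t => ∫ x, G t x * φ t x) volume 0 T ∧
    IntervalIntegrable (fun t => ∫ x, inner ℝ (grad (u t) x) (classicalGrad (φ t) x)) volume 0 T ∧
    (∫ x, u 0 x * φ 0 x) + (∫ t in (0 : ℝ)..T, ∫ x, u t x * deriv (fun s => φ s x) t)
      = (∫ t in (0 : ℝ)..T, ∫ x, φ t x * inner ℝ (v t x) (grad (u t) x))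
        - (∫ t in (0 : ℝ)..T, ∫ x, G t x * φ t x)
        + ∫ t in (0 : ℝ)..T, ∫ x, inner ℝ (grad (u t) x) (classicalGrad (φ t) x) := by
  have hT := h.T_pos
  have hIcc : ∀ {t}, t ∈ Ioo 0 T → t ∈ Icc 0 T := fun ht => ⟨ht.1.le, ht.2.le⟩
  have hIoc : ∀ {t}, t ∈ Ioo 0 T → t ∈ Ioc 0 T := fun ht => ⟨ht.1, ht.2.le⟩
  have huIcc : uIcc 0 T = Icc 0 T := uIcc_of_le hT.le
  obtain ⟨Mφ, hMφ⟩ := hφ.exists_h1Sq_bound T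
  obtain ⟨M', hM'⟩ := exists_bound_of_continuous (f := fun t x => deriv (fun s => φ s x) t)
    hφ.continuous_deriv_time T
  have hMφ0 : 0 ≤ Mφ := (h1Sq_nonneg _).trans (hMφ 0 ⟨le_rfl, hT.le⟩)
  have hφm : ∀ t, MemLp (φ t) 2 volume := fun t => smoothOnTorus_memLp (hφ.smoothOnTorus t)
  have hφtm : ∀ t, MemLp (fun x => deriv (fun s => φ s x) t) 2 volume := fun t =>
    (hφ.continuous_deriv_time.comp (Continuous.prodMk_right t)).memLp_of_hasCompactSupport
      (HasCompactSupport.of_compactSpace _)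
  have hφh1 : ∀ {t}, t ∈ Icc 0 T → ∀ S : Finset (Fin N → ℤ),
      ∑ k ∈ S, (1 + freqSq k) * ‖fourierCoef (φ t) k‖ ^ 2 ≤ Mφ := fun ht S => by
    refine ((memH1_iff.mp (memH1_of_smooth (hφ.smoothOnTorus _))).sum_le_tsum S
      fun k _ => ?_).trans (hMφ _ ht)
    have := freqSq_nonneg k
    positivity
  have hφ0 : ∀ {t}, t ∈ Icc 0 T → ∀ S : Finset (Fin N → ℤ),
      ∑ k ∈ S, ‖fourierCoef (φ t) k‖ ^ 2 ≤ Mφ := fun ht S => by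
    refine (Finset.sum_le_sum fun k _ => ?_).trans (hφh1 ht S)
    have := freqSq_nonneg k
    exact le_mul_of_one_le_left (sq_nonneg _) (by linarith)
  have hcu := fun k => h.continuousOn_coef k
  have hcφ : ∀ k, Continuous fun t => fourierCoef (φ t) k := fun k =>
    continuous_fourierCoef_of_continuous hφ.continuous k
  have hcφ' : ∀ k, Continuous fun t => fourierCoef (fun x => deriv (fun s => φ s x) t) k :=
    fun k => continuous_fourierCoef_of_continuous
      (f := fun t x => deriv (fun s => φ s x) t) hφ.continuous_deriv_time k
  have hsq : ∀ {t}, t ∈ Ioo 0 T → ∀ S : Finset (Fin N → ℤ),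
      √(∑ k ∈ S, ‖fourierCoef (u t) k‖ ^ 2) ≤ M := fun ht S =>
    Real.sqrt_le_iff.mpr ⟨h.M_nonneg, h.sum_norm_sq_coef_le (hIcc ht) S⟩
  have H1 := hasSum_intervalIntegral hT.le
    (c := fun t k => (fourierCoef (u t) k *
      conj (fourierCoef (fun x => deriv (fun s => φ s x) t) k)).re)
    (L := fun t => ∫ x, u t x * deriv (fun s => φ s x) t) (bnd := fun _ => M * √(M' ^ 2))
    (fun k => ContinuousOn.intervalIntegrable (by
      rw [huIcc]
      exact Complex.continuous_re.comp_continuousOn ((hcu k).mul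
        (Complex.continuous_conj.comp (hcφ' k)).continuousOn)))
    intervalIntegrable_const
    (by
      filter_upwards [ae_restrict_mem measurableSet_Ioo] with t ht S
      refine (abs_sum_re_mul_conj_le S _ _).trans (mul_le_mul (hsq ht S) ?_
        (Real.sqrt_nonneg _) h.M_nonneg)
      exact Real.sqrt_le_sqrt ((sum_le_hasSum S (fun _ _ => sq_nonneg _)
        (hasSum_norm_sq_fourierCoef (hφtm t))).trans (integral_sq_le_of_bound (hM' t (hIcc ht)))))
    (by
      filter_upwards [ae_restrict_mem measurableSet_Ioo] with t ht
      exact Complex.hasSum_re (hasSum_fourierCoef_mul_conj (Lp.memLp (u t)) (hφtm t)))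
  have hGi : ∀ k, IntervalIntegrable (fun t => (fourierCoef (G t) k *
      conj (fourierCoef (φ t) k)).re) volume 0 T := fun k => by
    have := (h.int_G k).mul_continuousOn (Complex.continuous_conj.comp (hcφ k)).continuousOn
    exact ⟨this.1.re, this.2.re⟩
  have H2 := hasSum_intervalIntegral hT.le
    (c := fun t k => (fourierCoef (G t) k * conj (fourierCoef (φ t) k)).re)
    (L := fun t => ∫ x, G t x * φ t x) (bnd := fun t => D * t ^ (-β) + Mφ)
    hGi
    (by
      rw [intervalIntegrable_iff_integrableOn_Ioo_of_le hT.le]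
      exact h.integrableOn_source_bound.add (integrable_const _))
    (by
      filter_upwards [ae_restrict_mem measurableSet_Ioo] with t ht S
      refine (abs_sum_re_mul_conj_le S _ _).trans ?_
      have e1 := (sum_le_hasSum S (fun _ _ => sq_nonneg _)
        (hasSum_norm_sq_fourierCoef (h.memLp_G t (hIoc ht)))).trans (h.G_le t (hIoc ht))
      have e2 := hφ0 (hIcc ht) S
      have e3 := Real.sq_sqrt (Finset.sum_nonneg fun k (_ : k ∈ S) =>
        sq_nonneg ‖fourierCoef (G t) k‖)
      have e4 := Real.sq_sqrt (Finset.sum_nonneg fun k (_ : k ∈ S) =>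
        sq_nonneg ‖fourierCoef (φ t) k‖)
      nlinarith [sq_nonneg (√(∑ k ∈ S, ‖fourierCoef (G t) k‖ ^ 2)
        - √(∑ k ∈ S, ‖fourierCoef (φ t) k‖ ^ 2)), Real.sqrt_nonneg (∑ k ∈ S,
        ‖fourierCoef (G t) k‖ ^ 2), Real.sqrt_nonneg (∑ k ∈ S, ‖fourierCoef (φ t) k‖ ^ 2)])
    (by
      filter_upwards [ae_restrict_mem measurableSet_Ioo] with t ht
      exact Complex.hasSum_re (hasSum_fourierCoef_mul_conj (h.memLp_G t (hIoc ht)) (hφm t)))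
  have hDi : ∀ k, IntervalIntegrable (fun t => lam k * (fourierCoef (u t) k *
      conj (fourierCoef (φ t) k)).re) volume 0 T := fun k =>
    ContinuousOn.intervalIntegrable (by
      rw [huIcc]
      exact continuousOn_const.mul (Complex.continuous_re.comp_continuousOn ((hcu k).mul
        (Complex.continuous_conj.comp (hcφ k)).continuousOn)))
  have H3 := hasSum_intervalIntegral hT.le
    (c := fun t k => lam k * (fourierCoef (u t) k * conj (fourierCoef (φ t) k)).re)
    (L := fun t => ∫ x, inner ℝ (grad (u t) x) (classicalGrad (φ t) x))
    (bnd := fun t => (∫ x, ‖grad (u t) x‖ ^ 2) + 4 * Real.pi ^ 2 * Mφ)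
    hDi (h.intervalIntegrable_dissipation.add intervalIntegrable_const)
    (by
      filter_upwards [ae_restrict_mem measurableSet_Ioo] with t ht S
      have e1 := h.sum_lam_le (hIoc ht) S
      have e2 : ∑ k ∈ S, lam k * ‖fourierCoef (φ t) k‖ ^ 2 ≤ 4 * Real.pi ^ 2 * Mφ := by
        refine le_trans ?_ (mul_le_mul_of_nonneg_left (hφh1 (hIcc ht) S) (by positivity))
        rw [Finset.mul_sum]
        refine Finset.sum_le_sum fun k _ => ?_
        rw [lam, mul_assoc]
        gcongr
        linarith
      refine (Finset.abs_sum_le_sum_abs _ _).trans (le_trans ?_ (add_le_add e1 e2))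
      rw [← Finset.sum_add_distrib]
      refine Finset.sum_le_sum fun k _ => ?_
      rw [abs_mul, abs_of_nonneg (lam_nonneg k), ← mul_add]
      refine mul_le_mul_of_nonneg_left ?_ (lam_nonneg k)
      refine (Complex.abs_re_le_norm _).trans ?_
      rw [norm_mul, RCLike.norm_conj]
      nlinarith [sq_nonneg (‖fourierCoef (u t) k‖ - ‖fourierCoef (φ t) k‖),
        norm_nonneg (fourierCoef (u t) k), norm_nonneg (fourierCoef (φ t) k)])
    (by
      filter_upwards [ae_restrict_mem measurableSet_Ioo] with t ht
      have e1 := Complex.hasSum_re ((h.memH1 t (hIoc ht)).hasSum_inner_grad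
        (memLp_classicalGrad_apply (hφ.smoothOnTorus t))
        (fourierCoef_classicalGrad (hφ.smoothOnTorus t)))
      simp only [Complex.re_ofReal_mul, Complex.ofReal_re] at e1
      exact e1)
  have hFi : ∀ k, IntervalIntegrable (fun t => (fourierCoef (φ t) k *
      conj (fourierCoef (fun x => inner ℝ (v t x) (grad (u t) x)) k)).re) volume 0 T := fun k => by
    have h1 := h.int_adv k
    have h2 : IntervalIntegrable (fun τ =>
        conj (fourierCoef (fun x => inner ℝ (v τ x) (grad (u τ) x)) k)) volume 0 T :=
      ⟨(Complex.conjCLE : ℂ →L[ℝ] ℂ).integrable_comp h1.1,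
        (Complex.conjCLE : ℂ →L[ℝ] ℂ).integrable_comp h1.2⟩
    have h3 := h2.continuousOn_mul (hcφ k).continuousOn
    exact ⟨h3.1.re, h3.2.re⟩
  have H4 := hasSum_intervalIntegral hT.le
    (c := fun t k => (fourierCoef (φ t) k *
      conj (fourierCoef (fun x => inner ℝ (v t x) (grad (u t) x)) k)).re)
    (L := fun t => ∫ x, φ t x * inner ℝ (v t x) (grad (u t) x))
    -- The natural bound is linear in ‖∇u‖; √x ≤ 1 + x replaces it by the dissipation, already known
    -- to be integrable.
    (bnd := fun t => |V| * (1 + ∫ x, ‖grad (u t) x‖ ^ 2) * (|K| * √Mφ))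
    hFi (((intervalIntegrable_const.add h.intervalIntegrable_dissipation).const_mul _).mul_const _)
    (by
      filter_upwards [h.adv, ae_restrict_mem measurableSet_Ioo] with t h1 ht S
      have h2 := h1.norm_sum_mul_conj_le S (fourierCoef (φ t))
      rw [← Complex.re_sum]
      refine (Complex.abs_re_le_norm _).trans (h2.trans ?_)
      have h5 := hφh1 (hIcc ht) S
      have h6 := h1.V_nonneg
      have h7 := h1.embeds.1
      have h8 : √(∫ x, ‖grad (u t) x‖ ^ 2) ≤ 1 + ∫ x, ‖grad (u t) x‖ ^ 2 := by
        have h9 : 0 ≤ ∫ x, ‖grad (u t) x‖ ^ 2 := integral_nonneg fun _ => sq_nonneg _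
        rw [Real.sqrt_le_iff]
        constructor <;> nlinarith
      gcongr
      · exact le_abs_self V
      · exact le_abs_self K)
    (by
      filter_upwards [h.adv] with t h1
      exact Complex.hasSum_re (h1.hasSum_mul_conj_fun (hφ.smoothOnTorus t)).2)
  refine ⟨H1.1, H4.1, H2.1, H3.1, ?_⟩
  -- The weak formulation for one mode: integrate by parts in time; the boundary term at `T`
  -- vanishes with φ.
  have hk : ∀ k, (∫ t in (0 : ℝ)..T, (fourierCoef (φ t) k *
      conj (fourierCoef (fun x => inner ℝ (v t x) (grad (u t) x)) k)).re)
      - (∫ t in (0 : ℝ)..T, (fourierCoef (G t) k * conj (fourierCoef (φ t) k)).re)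
      + (∫ t in (0 : ℝ)..T, lam k * (fourierCoef (u t) k * conj (fourierCoef (φ t) k)).re)
      = (fourierCoef (u 0) k * conj (fourierCoef (φ 0) k)).re
        + ∫ t in (0 : ℝ)..T, (fourierCoef (u t) k *
          conj (fourierCoef (fun x => deriv (fun s => φ s x) t) k)).re := by
    intro k
    obtain ⟨i1, i2, e⟩ := IsPrimitiveOn.integral_re_mul_conj hT.le (h.isPrimitiveOn k)
      (IsPrimitiveOn.of_hasDerivAt (fun t => hφ.hasDerivAt_fourierCoef k t) (hcφ' k))
    have hz : fourierCoef (φ T) k = 0 := by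
      simp [fourierCoef, UnitAddTorus.mFourierCoeff, hφT]
    rw [hz, map_zero, mul_zero, Complex.zero_re, zero_sub] at e
    rw [← intervalIntegral.integral_sub (hFi k) (hGi k),
      ← intervalIntegral.integral_add ((hFi k).sub (hGi k)) (hDi k)]
    have e' : (∫ t in (0 : ℝ)..T, (fourierCoef (φ t) k *
        conj (fourierCoef (fun x => inner ℝ (v t x) (grad (u t) x)) k)).re
        - (fourierCoef (G t) k * conj (fourierCoef (φ t) k)).re
        + lam k * (fourierCoef (u t) k * conj (fourierCoef (φ t) k)).re)
        = -∫ t in (0 : ℝ)..T, ((-(lam k : ℂ) * fourierCoef (u t) k + (fourierCoef (G t) k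
      - fourierCoef (fun x => inner ℝ (v t x) (grad (u t) x)) k))
        * conj (fourierCoef (φ t) k)).re := by
      rw [← intervalIntegral.integral_neg]
      congr 1; ext t
      simp only [Complex.mul_re, Complex.add_re, Complex.sub_re, Complex.neg_re, Complex.neg_im,
        Complex.mul_im, Complex.add_im, Complex.sub_im, Complex.ofReal_re, Complex.ofReal_im,
        Complex.conj_re, Complex.conj_im]
      ring
    rw [e']
    linarith
  have hs1 := (H4.2.sub H2.2).add H3.2
  simp only [hk] at hs1
  exact (((Complex.hasSum_re (hasSum_fourierCoef_mul_conj (Lp.memLp (u 0)) (hφm 0))).add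
    H1.2).unique hs1)

end FlowEstimates

/-! ### Mild solutions satisfy the estimates -/

lemma eLpNorm_two_eq_ofReal {E : Type*} [NormedAddCommGroup E] {f : Torus N → E}
    (hf : MemLp f 2 volume) :
    eLpNorm f 2 volume = ENNReal.ofReal (√(∫ x, ‖f x‖ ^ 2)) := by
  rw [hf.eLpNorm_eq_integral_rpow_norm (by norm_num) (by norm_num), Real.sqrt_eq_rpow]
  simp

lemma integral_sq_le_of_eLpNorm_le {f : Torus N → ℝ} (hf : MemLp f 2 volume) {B : ℝ}
    (hB0 : 0 ≤ B) (hB : eLpNorm f 2 volume ≤ ENNReal.ofReal B) : ∫ x, f x ^ 2 ≤ B ^ 2 := by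
  rw [eLpNorm_two_eq_ofReal hf, ENNReal.ofReal_le_ofReal_iff hB0] at hB
  have h := Real.sqrt_le_iff.mp hB
  simpa using h.2

/-- The power nonlinearity maps `H¹` to `L²`. -/
lemma exists_rpow_bound (N : ℕ) {p : ℝ} (hp : 1 < p) (hpN : p < 1 + 2 / (N : ℝ)) (hN : 0 < N) :
    ∃ C σ : ℝ, 0 ≤ C ∧ 0 ≤ σ ∧ σ ≤ 1 ∧ σ * p < 1 ∧ ∀ f : L2 N, MemH1 f →
      MemLp (fun x => |f x| ^ p) 2 volume ∧
      ∫ x, (|f x| ^ p) ^ 2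
        ≤ ((C * (‖f‖ ^ (1 - σ) * √(h1Sq (fourierCoef f)) ^ σ)) ^ p) ^ 2 := by
  have hN' : (0 : ℝ) < N := by exact_mod_cast hN
  have hp0 : 0 < p := by linarith
  -- The left side is N(p - 1)/(2p), so this is exactly p < 1 + 2/N. It leaves room for σ with σp <
  -- 1; as ‖|u|^p‖² is the 2p-th power of the L^{2p} norm of u, σp becomes the exponent of the time
  -- singularity.
  have hθ : (N : ℝ) * (1 / 2 - 1 / (2 * p)) < 1 / p := by
    have h1 : (p - 1) * N < 2 := by
      rw [← lt_div_iff₀ hN']; linarith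
    have e : (N : ℝ) * (1 / 2 - 1 / (2 * p)) = (p - 1) * N / 2 / p := by field_simp
    rw [e]
    gcongr
    linarith
  obtain ⟨σ, hσ1, hσ2⟩ := exists_between hθ
  have hσ0 : 0 ≤ σ := by
    refine le_trans (mul_nonneg hN'.le (sub_nonneg.mpr ?_)) hσ1.le
    exact one_div_le_one_div_of_le (by norm_num) (by linarith)
  have hσp : σ * p < 1 := (lt_div_iff₀ hp0).mp hσ2
  have hσle : σ ≤ 1 := by nlinarith
  obtain ⟨C, hC0, hC⟩ := exists_eLpNorm_le N (s := 2 * p) (by linarith) hσ0 hσle hσ1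
  refine ⟨C, σ, hC0, hσ0, hσle, hσp, fun f hf => ?_⟩
  have h1 := hC (toC f) (by simpa only [mFourierCoeff_toC] using memH1_iff.mp hf)
  have h2 : eLpNorm (toC f) (ENNReal.ofReal (2 * p)) volume
      = eLpNorm f (ENNReal.ofReal (2 * p)) volume := by
    refine eLpNorm_congr_norm_ae ?_
    filter_upwards [coeFn_toC f] with x hx
    rw [hx, Complex.norm_real]
  have h3 : ‖toC f‖ ≤ ‖f‖ := by
    refine (Complex.ofRealCLM.norm_compLp_le f).trans ?_
    rw [Complex.ofRealCLM_norm, one_mul]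
  rw [h2, funext (mFourierCoeff_toC f)] at h1
  set X := C * (‖f‖ ^ (1 - σ) * √(h1Sq (fourierCoef f)) ^ σ) with hX
  have hX0 : 0 ≤ X := by positivity
  have h4 : eLpNorm f (ENNReal.ofReal (2 * p)) volume ≤ ENNReal.ofReal X := by
    refine h1.trans (ENNReal.ofReal_le_ofReal ?_)
    have : 0 ≤ 1 - σ := by linarith
    rw [hX]; gcongr
  have h5 : eLpNorm (fun x => |f x| ^ p) 2 volume ≤ ENNReal.ofReal (X ^ p) := by
    have h6 := eLpNorm_norm_rpow (p := 2) (μ := volume) f hp0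
    simp only [Real.norm_eq_abs] at h6
    have e : (2 : ℝ≥0∞) * ENNReal.ofReal p = ENNReal.ofReal (2 * p) := by
      rw [ENNReal.ofReal_mul (by norm_num), ENNReal.ofReal_ofNat]
    rw [h6, e, ← ENNReal.ofReal_rpow_of_nonneg hX0 hp0.le]
    exact ENNReal.rpow_le_rpow h4 hp0.le
  have hmem : MemLp (fun x => |f x| ^ p) 2 volume :=
    ⟨((Lp.aestronglyMeasurable f).aemeasurable.abs.pow_const p).aestronglyMeasurable,
      h5.trans_lt ENNReal.ofReal_lt_top⟩
  exact ⟨hmem, integral_sq_le_of_eLpNorm_le hmem (by positivity) h5⟩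

/-- Variance is at most the second moment on a probability space, so subtracting the mean does not
worsen the source bound. -/
lemma integral_sub_mean_sq_le {f : Torus N → ℝ} (hf : MemLp f 2 volume) :
    ∫ x, (f x - ∫ y, f y) ^ 2 ≤ ∫ x, f x ^ 2 := by
  have hi : Integrable f volume := hf.integrable (by norm_num)
  set m := ∫ y, f y with hm
  have e : ∫ x, (f x - m) ^ 2 = (∫ x, f x ^ 2) - m ^ 2 := by
    have e1 : ∀ x, (f x - m) ^ 2 = f x ^ 2 - 2 * m * f x + m ^ 2 := fun x => by ring
    simp only [e1]
    have i1 : Integrable (fun x => f x ^ 2 - 2 * m * f x) volume :=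
      hf.integrable_sq.sub (hi.const_mul _)
    rw [integral_add i1 (integrable_const _),
      integral_sub hf.integrable_sq (hi.const_mul _), integral_const_mul, ← hm]
    simp only [integral_const, probReal_univ, one_smul]
    ring
  rw [e]
  linarith [sq_nonneg m]

lemma fourierCoef_sub_const {f : Torus N → ℝ} (hf : Integrable f volume) (c : ℝ)
    (k : Fin N → ℤ) :
    fourierCoef (fun x => f x - c) k
      = fourierCoef f k - c * fourierCoef (fun _ : Torus N => (1 : ℝ)) k := by
  have h1 : Integrable (fun x => UnitAddTorus.mFourier (-k) x • (f x : ℂ)) volume :=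
    integrable_mFourier_mul hf.ofReal (-k)
  have h2 : Integrable (fun x : Torus N => UnitAddTorus.mFourier (-k) x • ((1 : ℝ) : ℂ)) volume :=
    integrable_mFourier_mul (integrable_const _) (-k)
  simp only [fourierCoef, UnitAddTorus.mFourierCoeff]
  rw [← integral_const_mul, ← integral_sub h1 (h2.const_mul _)]
  congr 1; ext x
  simp only [smul_eq_mul]
  push_cast
  ring

lemma IsMildSolution.exists_flowEstimates (hN : 2 ≤ N) {α p : ℝ} (hp : 1 < p)
    (hpα : p < 1 + α / ((N : ℝ) + 2)) (hpN : p < 1 + 2 / (N : ℝ))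
    {v : ℝ → Torus N → Vec N} (hv : MemLinftyLq (ENNReal.ofReal (α / (p - 1))) v)
    (hdiv : Incompressible v) {u₀ : L2 N} {T : ℝ} (hT : 0 < T) {u : ℝ → L2 N}
    (hX : MemXT T u) (hu : IsMildSolution p v u₀ T u) :
    u 0 = u₀ ∧ (∀ t ∈ Ioc 0 T, MemLp (fun x => |u t x| ^ p) 2 volume) ∧
    ∃ q s V K M A D β : ℝ, FlowEstimates T u v
      (fun t x => |u t x| ^ p - ∫ y, |u t y| ^ p) q s V K M A D β := by
  have hN0 : (2 : ℝ) ≤ N := by exact_mod_cast hN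
  obtain ⟨hcont, hH1, C₀, hC₀⟩ := hX
  obtain ⟨M, hM⟩ := isCompact_Icc.exists_bound_of_continuousOn hcont
  have hM0 : 0 ≤ M := (norm_nonneg _).trans (hM 0 ⟨le_rfl, hT.le⟩)
  -- Bounds t‖u(t)‖² by M²T and t‖∇u(t)‖² by C₀², so t times the squared H¹ norm is at most A.
  set A := M ^ 2 * T + (4 * Real.pi ^ 2)⁻¹ * C₀ ^ 2 with hA
  have hA0 : 0 ≤ A := by positivity
  have hh1 : ∀ t ∈ Ioc 0 T, h1Sq (fourierCoef (u t)) ≤ A / t := by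
    intro t ht
    rw [h1Sq_fourierCoef (hH1 t ht), le_div_iff₀ ht.1, add_mul]
    have h1 := hM t ⟨ht.1.le, ht.2⟩
    have h2 := hC₀ t ht
    have h3 : t * ∫ x, ‖grad (u t) x‖ ^ 2 ≤ C₀ ^ 2 := by
      have h4 := pow_le_pow_left₀ (by positivity) h2 2
      rwa [mul_pow, Real.sq_sqrt ht.1.le,
        Real.sq_sqrt (integral_nonneg fun _ => sq_nonneg _)] at h4
    have h5 : ‖u t‖ ^ 2 * t ≤ M ^ 2 * T := by
      have := ht.1.le
      have := ht.2
      gcongr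
    have h6 : (4 * Real.pi ^ 2)⁻¹ * (t * ∫ x, ‖grad (u t) x‖ ^ 2)
        ≤ (4 * Real.pi ^ 2)⁻¹ * C₀ ^ 2 := by gcongr
    rw [hA]
    linarith
  obtain ⟨C, σ, hC0, hσ0, hσ1, hσp, hsrc⟩ := exists_rpow_bound N hp hpN (by omega)
  have hF : ∀ t ∈ Ioc 0 T, MemLp (fun x => |u t x| ^ p) 2 volume := fun t ht =>
    (hsrc (u t) (hH1 t ht)).1
  have hFi : ∀ t ∈ Ioc 0 T, Integrable (fun x => |u t x| ^ p) volume := fun t ht =>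
    (hF t ht).integrable (by norm_num)
  have hFle : ∀ t ∈ Ioc 0 T, ∫ x, (|u t x| ^ p) ^ 2
      ≤ ((C * (M ^ (1 - σ) * √A ^ σ)) ^ p) ^ 2 * t ^ (-(σ * p)) := by
    intro t ht
    refine ((hsrc (u t) (hH1 t ht)).2).trans ?_
    have h1 : (C * (‖u t‖ ^ (1 - σ) * √(h1Sq (fourierCoef (u t))) ^ σ))
        ≤ C * (M ^ (1 - σ) * √A ^ σ) * t ^ (-σ / 2) := by
      have h2 : √(h1Sq (fourierCoef (u t))) ≤ √A * t ^ (-1 / 2 : ℝ) := by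
        refine (Real.sqrt_le_sqrt (hh1 t ht)).trans_eq ?_
        rw [Real.sqrt_div hA0, div_eq_mul_inv, Real.sqrt_eq_rpow t, ← Real.rpow_neg ht.1.le]
        norm_num
      have h3 := hM t ⟨ht.1.le, ht.2⟩
      have h4 : 0 ≤ 1 - σ := by linarith
      calc _ ≤ C * (M ^ (1 - σ) * (√A * t ^ (-1 / 2 : ℝ)) ^ σ) := by gcongr
        _ = _ := by
          rw [Real.mul_rpow (Real.sqrt_nonneg _) (Real.rpow_nonneg ht.1.le _),
            ← Real.rpow_mul ht.1.le, show (-1 / 2 : ℝ) * σ = -σ / 2 by ring]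
          ring
    have ht0 := ht.1.le
    calc _ ≤ ((C * (M ^ (1 - σ) * √A ^ σ) * t ^ (-σ / 2)) ^ p) ^ 2 := by
          gcongr
      _ = _ := by
          rw [Real.mul_rpow (by positivity) (by positivity), mul_pow, ← Real.rpow_mul ht0,
            ← Real.rpow_natCast (t ^ (-σ / 2 * p)), ← Real.rpow_mul ht0]
          congr 2
          push_cast
          ring
  obtain ⟨hvm, C₁, hC₁⟩ := hv
  set q := α / (p - 1) with hq
  -- A restatement of p < 1 + α/(N + 2).
  have hqN : (N : ℝ) + 2 < q := by
    rw [hq, lt_div_iff₀ (by linarith)]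
    have h1 : p - 1 < α / ((N : ℝ) + 2) := by linarith
    rw [lt_div_iff₀ (by linarith)] at h1
    linarith
  -- Solves 1/q + 1/s = 1/2, so the embedding condition N(1/2 - 1/s) < 1 becomes q > N.
  set s := 2 * q / (q - 2) with hs
  have hq2 : 0 < q - 2 := by linarith
  have hq0 : 0 < q := by linarith
  have hqs : q.HolderTriple s 2 :=
    { inv_add_inv_eq_inv := by rw [hs]; field_simp; ring
      left_pos := hq0
      right_pos := by rw [hs]; positivity }
  have hs2 : 1 / 2 - 1 / s = 1 / q := by rw [hs]; field_simp; ring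
  have hs2' : 2 ≤ s := by rw [hs, le_div_iff₀ hq2]; linarith
  obtain ⟨K, hK⟩ := exists_h1Embeds (N := N) (s := s) hs2' (by
    rw [hs2, mul_one_div, div_lt_one hq0]; linarith)
  have hsub : Ioo 0 T ⊆ Ioi (0 : ℝ) := Ioo_subset_Ioi_self
  have hadv : ∀ᵐ t ∂(volume.restrict (Ioo 0 T)),
      AdvectionData q s (v t) (grad (u t)) |C₁| (√(∫ x, ‖grad (u t) x‖ ^ 2)) K := by
    filter_upwards [ae_restrict_of_ae_restrict_of_subset hsub hC₁,
      ae_restrict_of_ae_restrict_of_subset hsub hvm.prodMk_left] with t h1 h2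
    exact
      { holder := hqs
        embeds := hK
        V_nonneg := abs_nonneg _
        Γ_nonneg := Real.sqrt_nonneg _
        aesm_v := h2
        eLpNorm_v := h1.trans (ENNReal.ofReal_le_ofReal (le_abs_self _))
        aesm_G := (memLp_grad _).aestronglyMeasurable
        eLpNorm_G := (eLpNorm_two_eq_ofReal (memLp_grad _)).le }
  obtain ⟨hu0, hode⟩ := hu.isPrimitiveOn hT hF (by
    filter_upwards [hadv] with t ht
    refine summable_of_sum_le (fun k => ?_) ht.sum_norm_sq_le
    have := freqSq_nonneg k
    positivity)
  have hcoefG : ∀ t ∈ Ioc 0 T, ∀ k, fourierCoef (fun x => |u t x| ^ p - ∫ y, |u t y| ^ p) k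
      = fourierCoef (fun x => |u t x| ^ p) k
        - (∫ x, |u t x| ^ p : ℝ) * fourierCoef (fun _ : Torus N => (1 : ℝ)) k := fun t ht k =>
    fourierCoef_sub_const (hFi t ht) _ k
  have huIoc : ∀ {t}, t ∈ Set.uIoc 0 T → t ∈ Ioc 0 T := fun ht => by
    rwa [uIoc_of_le hT.le] at ht
  refine ⟨hu0, hF, q, s, |C₁|, K, M, A, ((C * (M ^ (1 - σ) * √A ^ σ)) ^ p) ^ 2, σ * p, ?_⟩
  exact
    { T_pos := hT
      continuousOn := hcont
      norm_le := hM
      memH1 := hH1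
      h1Sq_le := hh1
      A_nonneg := hA0
      memLp_G := fun t ht => (hF t ht).sub (memLp_const _)
      G_le := fun t ht => (integral_sub_mean_sq_le (hF t ht)).trans (hFle t ht)
      D_nonneg := sq_nonneg _
      β_lt_one := hσp
      int_G := fun k => by
        have hm : IntervalIntegrable (fun t => ((∫ x, |u t x| ^ p : ℝ) : ℂ)
            * fourierCoef (fun _ : Torus N => (1 : ℝ)) k) volume 0 T :=
          IntervalIntegrable.mul_const
            ⟨hu.integrable_mean.1.ofReal, hu.integrable_mean.2.ofReal⟩ _
        refine ((hode k).1.sub hm).congr fun t ht => ?_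
        exact (hcoefG t (huIoc ht) k).symm
      int_adv := fun k => (hode k).2.1
      isPrimitiveOn := fun k => by
        have h1 := (hode k).2.2
        refine ⟨h1.intervalIntegrable.congr fun t ht => ?_, fun t ht => ?_⟩
        · rw [hcoefG t (huIoc ht) k]
          ring
        · rw [h1.eq_add_integral t ht]
          congr 1
          -- The two integrands are compared on (0, t] only: at time 0 the power of the L² datum
          -- need not be integrable, and splitting off the mean could fail.
          refine intervalIntegral.integral_congr_ae (ae_of_all _ fun τ hτ => ?_)
          rw [uIoc_of_le ht.1] at hτ
          rw [hcoefG τ ⟨hτ.1, hτ.2.trans ht.2⟩ k]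
          ring
      adv := hadv
      div_free := ae_restrict_of_ae_restrict_of_subset hsub hdiv }

/-! ### Assembly of the theorem -/

lemma integrable_inner_of_apply {f g : Torus N → Vec N}
    (hf : ∀ i, MemLp (fun x => f x i) 2 volume) (hg : ∀ i, MemLp (fun x => g x i) 2 volume) :
    Integrable (fun x => inner ℝ (f x) (g x)) volume := by
  simp only [PiLp.inner_apply]
  refine integrable_finsetSum _ fun i _ => ?_
  simpa [mul_comm] using! (hf i).integrable_mul (hg i)

/-- The spatial mean is the real part of the zeroth Fourier coefficient, a continuous functional on
L². -/
lemma continuousOn_integral_coe {T : ℝ} {u : ℝ → L2 N} (hu : ContinuousOn u (Icc 0 T)) :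
    ContinuousOn (fun t => ∫ x, u t x) (Icc 0 T) := by
  have h1 : ∀ f : L2 N, ∫ x, f x = (coefR 0 f).re := fun f => by
    rw [coefR_apply, fourierCoef, UnitAddTorus.mFourierCoeff]
    simp [UnitAddTorus.mFourier_zero, integral_complex_ofReal]
  simp only [h1]
  exact Complex.continuous_re.comp_continuousOn ((coefR 0).continuous.comp_continuousOn hu)

lemma SmoothInTimeSpace.continuous_integral {φ : ℝ → Torus N → ℝ} (h : SmoothInTimeSpace φ) :
    Continuous fun t => ∫ x, φ t x := by
  have := continuous_parametric_integral_of_continuous (μ := (volume : Measure (Torus N)))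
    (f := φ) h.continuous isCompact_univ
  rwa [Measure.restrict_univ] at this

lemma integral_sub_const_mul {f g : Torus N → ℝ} (hf : MemLp f 2 volume) (hg : MemLp g 2 volume)
    (c : ℝ) : ∫ x, f x * g x = (∫ x, (f x - c) * g x) + c * ∫ x, g x := by
  have hfg : Integrable (fun x => f x * g x) volume := hf.integrable_mul hg
  have hgi : Integrable g volume := hg.integrable (by norm_num)
  simp only [sub_mul]
  rw [integral_sub hfg (hgi.const_mul c), integral_const_mul]
  ring

end AdvectionTorus

end

open AdvectionTorus in
theorem mainTheorem7 (N : ℕ) (hN : 2 ≤ N) (α p : ℝ) (hα : 2 ≤ α) (hp : 1 < p)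
    (hpα : p < 1 + α / ((N : ℝ) + 2)) (hpN : p < 1 + 2 / (N : ℝ))
    (v : ℝ → Torus N → Vec N) (hv : MemLinftyLq (ENNReal.ofReal (α / (p - 1))) v)
    (hdiv : Incompressible v)
    (u₀ : L2 N) (T : ℝ) (hT : 0 < T) (u : ℝ → L2 N)
    (hX : MemXT T u) (hu : IsMildSolution p v u₀ T u) :
    IsWeakSolution p v u₀ T u ∧
      IteratedIntegrable T (fun t x => |u t x| ^ p * u t x) ∧
      IntegrableOn (fun t => (∫ x, |u t x| ^ p) * ∫ x, u t x) (Set.Ioo 0 T) volume ∧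
      IteratedIntegrable T (fun t x => ‖grad (u t) x‖ ^ 2) ∧
      ∀ t ∈ Set.Ico 0 T,
        ‖u₀‖ ^ 2 + 2 * (∫ τ in (0 : ℝ)..t, ∫ x, |u τ x| ^ p * u τ x)
            - 2 * (∫ τ in (0 : ℝ)..t, (∫ x, |u τ x| ^ p) * ∫ x, u τ x)
          = ‖u t‖ ^ 2 + 2 * (∫ τ in (0 : ℝ)..t, ∫ x, ‖grad (u τ) x‖ ^ 2) := by
  obtain ⟨hu0, hF, q, s, V, K, M, A, D, β, h⟩ :=
    hu.exists_flowEstimates hN hp hpα hpN hv hdiv hT hX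
  have hIoc : ∀ {t}, t ∈ Ioo 0 T → t ∈ Ioc 0 T := fun ht => ⟨ht.1, ht.2.le⟩
  have hIoo : ∀ {f : ℝ → ℝ}, IntervalIntegrable f volume 0 T → IntegrableOn f (Ioo 0 T) volume :=
    fun hf => (intervalIntegrable_iff_integrableOn_Ioo_of_le hT.le).mp hf
  have hsubset : ∀ {t : ℝ}, t ∈ Icc 0 T → uIcc 0 t ⊆ uIcc 0 T := fun ht => by
    rw [uIcc_of_le ht.1, uIcc_of_le hT.le]; exact Icc_subset_Icc le_rfl ht.2
  -- The estimates treat the mean-free source as a single term; this separates it into |u|^p and its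
  -- mean, for w a test function or u itself.
  have hsplit : ∀ {w : ℝ → Torus N → ℝ}, (∀ t ∈ Ioc 0 T, MemLp (w t) 2 volume) →
      IntervalIntegrable (fun t => ∫ x, (|u t x| ^ p - ∫ y, |u t y| ^ p) * w t x) volume 0 T →
      IntervalIntegrable (fun t => (∫ x, |u t x| ^ p) * ∫ x, w t x) volume 0 T →
      IntervalIntegrable (fun t => ∫ x, |u t x| ^ p * w t x) volume 0 T ∧
      ∀ t ∈ Icc 0 T, ∫ τ in (0 : ℝ)..t, ∫ x, |u τ x| ^ p * w τ x
        = (∫ τ in (0 : ℝ)..t, ∫ x, (|u τ x| ^ p - ∫ y, |u τ y| ^ p) * w τ x)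
          + ∫ τ in (0 : ℝ)..t, (∫ x, |u τ x| ^ p) * ∫ x, w τ x := by
    intro w hw h1 h2
    have e : ∀ t ∈ Ioc 0 T, ∫ x, |u t x| ^ p * w t x
        = (∫ x, (|u t x| ^ p - ∫ y, |u t y| ^ p) * w t x) + (∫ x, |u t x| ^ p) * ∫ x, w t x :=
      fun t ht => integral_sub_const_mul (hF t ht) (hw t ht) _
    refine ⟨(h1.add h2).congr fun t ht => ?_, fun t ht => ?_⟩
    · rw [uIoc_of_le hT.le] at ht
      exact (e t ht).symm
    · rw [← intervalIntegral.integral_add (h1.mono_set (hsubset ht)) (h2.mono_set (hsubset ht))]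
      refine intervalIntegral.integral_congr_ae (ae_of_all _ fun τ hτ => ?_)
      rw [uIoc_of_le ht.1] at hτ
      exact e τ ⟨hτ.1, hτ.2.trans ht.2⟩
  have hmφ : ∀ {φ : ℝ → Torus N → ℝ}, SmoothInTimeSpace φ →
      IntervalIntegrable (fun t => (∫ x, |u t x| ^ p) * ∫ x, φ t x) volume 0 T := fun hφ =>
    hu.integrable_mean.mul_continuousOn hφ.continuous_integral.continuousOn
  have hmu : IntervalIntegrable (fun t => (∫ x, |u t x| ^ p) * ∫ x, u t x) volume 0 T :=
    hu.integrable_mean.mul_continuousOn (by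
      rw [uIcc_of_le hT.le]; exact continuousOn_integral_coe h.continuousOn)
  have htest : ∀ {φ : ℝ → Torus N → ℝ}, IsTestFunction T φ →
      SmoothInTimeSpace φ ∧ ∀ x, φ T x = 0 := by
    rintro φ ⟨h1, T', hT', h2⟩
    exact ⟨h1, fun x => h2 T hT'.le x⟩
  have hwork := hsplit (w := fun t x => u t x) (fun t _ => Lp.memLp (u t))
    (h.work le_rfl hT.le le_rfl).1 hmu
  refine ⟨⟨h.memLinftyL2, h.memL2H1, hu0, h.timeDeriv, hIoo hu.integrable_mean, ?_, ?_⟩,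
    ⟨?_, hIoo hwork.1⟩, hIoo hmu, ⟨?_, h.integrable_dissipation_Ioo⟩, ?_⟩
  · intro φ hφ
    obtain ⟨hs, hφT⟩ := htest hφ
    obtain ⟨i1, i2, i3, i4, -⟩ := h.weak hs hφT
    have hsm : ∀ t, MemLp (φ t) 2 volume := fun t => smoothOnTorus_memLp (hs.smoothOnTorus t)
    refine ⟨⟨?_, hIoo i1⟩, ⟨?_, hIoo i2⟩, ⟨?_, hIoo (hsplit (fun t _ => hsm t) i3 (hmφ hs)).1⟩,
      ⟨?_, hIoo i4⟩, hIoo (hmφ hs)⟩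
    · have hd : ∀ t, MemLp (fun x => deriv (fun s => φ s x) t) 2 volume := fun t =>
        (hs.continuous_deriv_time.comp (Continuous.prodMk_right t)).memLp_of_hasCompactSupport
          (HasCompactSupport.of_compactSpace _)
      exact ae_of_all _ fun t => (Lp.memLp (u t)).integrable_mul (hd t)
    · filter_upwards [h.adv] with t ht
      exact (ht.hasSum_mul_conj_fun (hs.smoothOnTorus t)).1
    · filter_upwards [ae_restrict_mem measurableSet_Ioo] with t ht
      exact (hF t (hIoc ht)).integrable_mul (hsm t)
    · exact ae_of_all _ fun t => integrable_inner_of_apply (memLp_grad_apply _)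
        (memLp_classicalGrad_apply (hs.smoothOnTorus t))
  · intro φ hφ
    obtain ⟨hs, hφT⟩ := htest hφ
    obtain ⟨-, -, i3, -, e⟩ := h.weak hs hφT
    have e2 := (hsplit (fun t _ => smoothOnTorus_memLp (hs.smoothOnTorus t)) i3 (hmφ hs)).2 T
      ⟨hT.le, le_rfl⟩
    rw [hu0] at e
    rw [e, e2]
    ring
  · filter_upwards [ae_restrict_mem measurableSet_Ioo] with t ht
    exact (hF t (hIoc ht)).integrable_mul (Lp.memLp (u t))
  · exact ae_of_all _ fun t => (memLp_grad _).integrable_norm_pow (by norm_num)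
  · intro t ht
    have ht' : t ∈ Icc 0 T := ⟨ht.1, ht.2.le⟩
    have e := h.energy ht'
    rw [hu0] at e
    rw [hwork.2 t ht', ← e]
    ring
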